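/- Let $\mathbb K$ be a field, let $1\le n_1\le\cdots\le n_d$ be integers and put $c=n_1+\cdots+n_d$. Let $R=\mathbb K[x_{i,j}\mid 1\le i\le d,\ 0\le j\le n_i]$, and let $I\subseteq R$ be the ideal of the rational normal scroll $\mathcal S_{n_1,\dots,n_d}\subseteq\mathbb P^{c+d-1}$, generated by the $2\times 2$ minors of the $2\times c$ matrix $\mathbf X=(\mathbf X_1,\dots,\mathbf X_d)$, where the block $\mathbf X_i$ has the columns $\binom{x_{i,j}}{x_{i,j+1}}$, $0\le j\le n_i-1$. Let $\mathbf M$ be the $2\times c$ matrix obtained by rearranging the columns of $\mathbf X$ as follows: for $j=0,1,2,\dots$ in turn take, for $i$ increasing, the columns $\binom{x_{i,j}}{x_{i,j+1}}$ with $j\le n_i-2$; after these $c-d$ columns come the last columns $\binom{x_{i,n_i-1}}{x_{i,n_i}}$ of the blocks, for $i=d,d-1,\dots,1$. Let $V=\{(\alpha,\beta)\mid 1\le\alpha<\beta\le c\}$ and $S=\mathbb K[T_{\alpha,\beta}\mid(\alpha,\beta)\in V]$, and let $P$ be the defining ideal of the fiber cone $\mathcal F(I)\cong\mathbb K[I]\subseteq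 R$, that is, the kernel of the $\mathbb K$-algebra map $\pi:S\to R$ sending $T_{\alpha,\beta}$ to the $2\times2$ minor of $\mathbf M$ on the columns $\alpha,\beta$. Order the monomials of $S$ as follows: first compare, lexicographically with $y_1>y_2>\cdots>y_c$, their images under $T_{\alpha,\beta}\mapsto y_\alpha y_\beta$; if these agree, compare their weights, where $T_{\alpha,\beta}$ has weight $(\beta-\alpha)(c-(\beta-\alpha))$ and the larger weight is the larger monomial; if these agree as well, compare lexicographically, where $T_{\alpha,\beta}>T_{\alpha',\beta'}$ when $(\alpha,\beta)$ precedes $(\alpha',\beta')$ lexicographically. Let $\operatorname{in}(P)$ be the initial ideal of $P$, and let the initial complex $\Delta$ be the Stanley–Reisner complex of $\operatorname{in}(P)$: the simplicial complex on $V$ whose faces are the sets $F\subseteq V$ with $\prod_{v\in F}T_v\notin\operatorname{in}(P)$. If $c\ge d+4$, then $\operatorname{in}(P)$ is squarefree, i.e. it is the Stanley–Reisner ideal of $\Delta$, and $\Delta$ is shellable: all its facets have the same cardinality, and they can be listed as $F_1,\dots,F_r$ in such a way that for all $i<j$ there are $v\in F_j\setminus F_i$ and $k<j$ with $F_j\setminus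 F_k=\{v\}$. -/

import Mathlib

open MvPolynomial

/-! ### Initial ideals, Stanley–Reisner complexes and shellability -/

/-- The initial ideal of an ideal `P`: the ideal generated by the leading monomials
of the nonzero elements of `P`. -/
noncomputable def initialIdeal {σ K : Type*} [Field K] (m : MonomialOrder σ) (P : Ideal (MvPolynomial σ K)) :
    Ideal (MvPolynomial σ K) :=
  Ideal.span {t | ∃ f ∈ P, f ≠ 0 ∧ t = monomial (m.degree f) (1 : K)}

/-- The Stanley–Reisner complex of a (squarefree monomial) ideal `J`: a nonempty finite set `F` of
variables is a face iff the product of the variables in `F` is not in `J`. -/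
def stanleyReisnerComplex {σ K : Type*} [Field K] (J : Ideal (MvPolynomial σ K)) :
    PreAbstractSimplicialComplex σ where
  faces := {F | F.Nonempty ∧ (∏ v ∈ F, X v) ∉ J}
  isRelLowerSet_faces := by
    rintro F ⟨hF, hFJ⟩
    refine ⟨hF, fun G hGF hG => ⟨hG, fun h => hFJ ?_⟩⟩
    obtain ⟨q, hq⟩ := Finset.prod_dvd_prod_of_subset G F (X : σ → MvPolynomial σ K) hGF
    rw [hq]
    exact J.mul_mem_right q h

/-- The Stanley–Reisner ideal of a complex `Δ`: the ideal generated by the squarefree monomials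
`∏_{v ∈ F} T_v` of the nonfaces `F`. -/
noncomputable def stanleyReisnerIdeal {σ : Type*} (K : Type*) [Field K] (Δ : PreAbstractSimplicialComplex σ) :
    Ideal (MvPolynomial σ K) :=
  Ideal.span {t | ∃ F : Finset σ, F.Nonempty ∧ F ∉ Δ.faces ∧ t = ∏ v ∈ F, X v}

/-- A facet is an inclusion-maximal face. -/
def IsFacet {σ : Type*} (Δ : PreAbstractSimplicialComplex σ) (F : Finset σ) : Prop :=
  Maximal (· ∈ Δ.faces) F

/-- `Δ` is shellable: it is pure (all facets have the same cardinality), and its facets can be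
listed as `F₁, …, F_r` so that for all `i < j` there are `v ∈ F_j \ F_i` and `k < j` with
`F_j \ F_k = {v}`. (Equivalently, for every `j ≥ 2` the complex
`⟨F₁, …, F_{j-1}⟩ ∩ ⟨F_j⟩` is generated by a nonempty set of maximal proper faces of `F_j`.) -/
def IsShellable {σ : Type*} [DecidableEq σ] (Δ : PreAbstractSimplicialComplex σ) : Prop :=
  (∀ F G : Finset σ, IsFacet Δ F → IsFacet Δ G → F.card = G.card) ∧
  ∃ (r : ℕ) (F : Fin r → Finset σ), Function.Injective F ∧
    (∀ G : Finset σ, IsFacet Δ G ↔ ∃ j, F j = G) ∧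
    ∀ i j : Fin r, i < j → ∃ v ∈ F j \ F i, ∃ k < j, F j \ F k = {v}

/-! ### The matrix `M` of a rational normal scroll and the defining ideal of its fiber cone -/

/-- The columns of the matrix `M`, from left to right. The pair `(i, j)` stands for the `j`-th
column `(x_{i,j}, x_{i,j+1})ᵀ` of the `i`-th catalecticant block, `0 ≤ j < n_i`. One first runs
through `j = 0, 1, 2, …`, taking for each `j` the `j`-th column of every block in which it is not
the last column, with `i` increasing; then come the last columns of the blocks, with `i`
decreasing. -/
def scrollColumns {d : ℕ} (n : Fin d → ℕ) : List (Σ i : Fin d, Fin (n i)) :=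
  ((List.range (∑ i, n i)).flatMap fun j =>
    (List.finRange d).filterMap fun i =>
      if h : j + 1 < n i then some ⟨i, ⟨j, by omega⟩⟩ else none) ++
  (List.finRange d).reverse.filterMap fun i =>
    if h : 0 < n i then some ⟨i, ⟨n i - 1, by omega⟩⟩ else none

theorem length_filterMap_dite {α β : Type*} (l : List α) (p : α → Prop) [DecidablePred p]
    (g : ∀ a, p a → β) :
    (l.filterMap fun a => if h : p a then some (g a h) else none).length =
      (l.map fun a => if p a then 1 else 0).sum := by
  induction l with
  | nil => rfl
  | cons a l ih =>
    by_cases h : p a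
    · simp [h, ih, add_comm]
    · simp [h, ih]

theorem length_scrollColumns {d : ℕ} (n : Fin d → ℕ) :
    (scrollColumns n).length = ∑ i, n i := by
  have hsum : ∀ f : Fin d → ℕ, ((List.finRange d).map f).sum = ∑ i, f i := fun f => by
    rw [← List.ofFn_eq_map, List.sum_ofFn]
  have hrange : ∀ (f : ℕ → ℕ) (N : ℕ), ((List.range N).map f).sum = ∑ j ∈ Finset.range N, f j :=
    fun f N => by rw [Finset.sum_range, ← List.sum_ofFn, List.ofFn_eq_map,
      ← List.map_coe_finRange_eq_range, List.map_map]; rfl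
  have h1 : ∀ i, ∑ j ∈ Finset.range (∑ i, n i), (if j + 1 < n i then 1 else 0) = n i - 1 := by
    intro i
    have hi : n i ≤ ∑ i, n i := Finset.single_le_sum (fun _ _ => Nat.zero_le _) (Finset.mem_univ i)
    rw [← Finset.card_filter]
    have : (Finset.range (∑ i, n i)).filter (fun j => j + 1 < n i) = Finset.range (n i - 1) := by
      ext j; simp only [Finset.mem_filter, Finset.mem_range]; omega
    rw [this, Finset.card_range]
  rw [scrollColumns, List.length_append, List.length_flatMap, length_filterMap_dite,
    List.map_reverse, List.sum_reverse, hsum]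
  simp only [length_filterMap_dite, hsum]
  rw [hrange, Finset.sum_comm]
  simp only [h1]
  rw [← Finset.sum_add_distrib]
  refine Finset.sum_congr rfl fun i _ => ?_
  split_ifs <;> omega

/-- The `α`-th column of `M`. -/
def scrollColumn {d : ℕ} (n : Fin d → ℕ) (α : Fin (∑ i, n i)) : Σ i : Fin d, Fin (n i) :=
  (scrollColumns n)[(α : ℕ)]'(by rw [length_scrollColumns]; exact α.2)

/-- The `2 × c` matrix `M` over `R = K[x_{i,j} | 0 ≤ j ≤ n_i]`. -/
noncomputable def scrollMatrix (K : Type*) [Field K] {d : ℕ} (n : Fin d → ℕ) :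
    Matrix (Fin 2) (Fin (∑ i, n i)) (MvPolynomial (Σ i : Fin d, Fin (n i + 1)) K) :=
  Matrix.of ![fun α => X ⟨(scrollColumn n α).1, (scrollColumn n α).2.castSucc⟩,
    fun α => X ⟨(scrollColumn n α).1, (scrollColumn n α).2.succ⟩]

/-- The vertices `(α, β)` with `α < β` among `c` columns, in lexicographic order. -/
abbrev ScrollVertex (c : ℕ) : Type :=
  {p : Fin c ×ₗ Fin c // (ofLex p).1 < (ofLex p).2}

/-- The left end point `α` of `(α, β)`. -/
def ScrollVertex.left {c : ℕ} (v : ScrollVertex c) : Fin c := (ofLex v.1).1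

/-- The right end point `β` of `(α, β)`. -/
def ScrollVertex.right {c : ℕ} (v : ScrollVertex c) : Fin c := (ofLex v.1).2

/-- The map `π : K[T_{α,β}] → R`, `T_{α,β} ↦ det M_{α,β}`, whose image is the fiber cone
`F(I) = K[I] ⊆ R` of the ideal `I` of maximal minors. -/
noncomputable def fiberConeMap (K : Type*) [Field K] {d : ℕ} (n : Fin d → ℕ) :
    MvPolynomial (ScrollVertex (∑ i, n i)) K →ₐ[K]
      MvPolynomial (Σ i : Fin d, Fin (n i + 1)) K :=
  aeval fun v => ((scrollMatrix K n).submatrix id ![v.left, v.right]).det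

/-- The defining ideal `P = ker π` of the fiber cone. -/
noncomputable def fiberConeIdeal (K : Type*) [Field K] {d : ℕ} (n : Fin d → ℕ) :
    Ideal (MvPolynomial (ScrollVertex (∑ i, n i)) K) :=
  RingHom.ker (fiberConeMap K n)

/-! ### The monomial order -/

/-- The multiplicity of the index `γ` in the monomial `T^e`, that is, the exponent of `y_γ` in the
image of `T^e` under `T_{α,β} ↦ y_α y_β`. -/
def columnDegree {c : ℕ} (e : ScrollVertex c →₀ ℕ) (γ : Fin c) : ℕ :=
  ∑ v, e v * ((if v.left = γ then 1 else 0) + (if v.right = γ then 1 else 0))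

/-- The weight of `T^e`, where `T_{α,β}` has weight `(β - α)(c - (β - α))`. -/
def chordWeight {c : ℕ} (e : ScrollVertex c →₀ ℕ) : ℕ :=
  ∑ v, e v * (((v.right : ℕ) - (v.left : ℕ)) * (c - ((v.right : ℕ) - (v.left : ℕ))))

/-- The key by which monomials are compared: lexicographically first by the column degrees
(column `1` being the most significant), then by the chord weight, and finally by the
lexicographic order. -/
noncomputable def scrollKey (c : ℕ) : (ScrollVertex c →₀ ℕ) →+
    Lex (Fin c → ℕ) ×ₗ (ℕ ×ₗ Lex (ScrollVertex c →₀ ℕ)) where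
  toFun e := toLex (toLex (columnDegree e), toLex (chordWeight e, toLex e))
  map_zero' := by
    have h1 : columnDegree (0 : ScrollVertex c →₀ ℕ) = 0 := by
      funext γ; simp [columnDegree]
    have h2 : chordWeight (0 : ScrollVertex c →₀ ℕ) = 0 := by simp [chordWeight]
    rw [h1, h2]; rfl
  map_add' e f := by
    have h1 : columnDegree (e + f) = columnDegree e + columnDegree f := by
      funext γ; simp [columnDegree, add_mul, Finset.sum_add_distrib]
    have h2 : chordWeight (e + f) = chordWeight e + chordWeight f := by
      simp [chordWeight, add_mul, Finset.sum_add_distrib]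
    rw [h1, h2]; rfl

theorem scrollKey_injective (c : ℕ) : Function.Injective (scrollKey c) := by
  intro e f h
  exact congrArg (fun x => ofLex (ofLex (ofLex x).2).2) h

theorem scrollKey_nonneg (c : ℕ) (e : ScrollVertex c →₀ ℕ) : 0 ≤ scrollKey c e := by
  have h1 : (0 : Lex (Fin c → ℕ)) ≤ toLex (columnDegree e) :=
    Pi.toLex_monotone (fun _ => Nat.zero_le _)
  have h2 : (0 : Lex (ScrollVertex c →₀ ℕ)) ≤ toLex e :=
    Finsupp.toLex_monotone zero_le
  have h3 : (0 : ℕ ×ₗ Lex (ScrollVertex c →₀ ℕ)) ≤ toLex (chordWeight e, toLex e) :=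
    Prod.Lex.toLex_mono ⟨Nat.zero_le _, h2⟩
  exact Prod.Lex.toLex_mono ⟨h1, h3⟩

/-- Exponent vectors are identified with their keys. -/
noncomputable def scrollKeyEquiv (c : ℕ) :
    (ScrollVertex c →₀ ℕ) ≃+ AddMonoidHom.mrange (scrollKey c) :=
  AddEquiv.ofBijective (scrollKey c).mrangeRestrict
    ⟨fun _ _ h => scrollKey_injective c (congrArg Subtype.val h),
      (scrollKey c).mrangeRestrict_surjective⟩

/-- The monomial order on `K[T_{α,β}]` given by comparing the keys. -/
noncomputable def scrollOrder (c : ℕ) : MonomialOrder (ScrollVertex c) where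
  syn := AddMonoidHom.mrange (scrollKey c)
  toSyn := scrollKeyEquiv c
  toSyn_monotone := by
    intro e f h
    obtain ⟨g, rfl⟩ := exists_add_of_le h
    change scrollKey c e ≤ scrollKey c (e + g)
    rw [map_add]
    exact le_add_of_nonneg_right (scrollKey_nonneg c g)

theorem scrollOrder_lt_iff {c : ℕ} {e f : ScrollVertex c →₀ ℕ} :
    (scrollOrder c).toSyn e < (scrollOrder c).toSyn f ↔ scrollKey c e < scrollKey c f :=
  Iff.rfl

/-! ### The initial complex -/

/-- The initial ideal `in(P)`. -/
noncomputable def fiberConeInitialIdeal (K : Type*) [Field K] {d : ℕ} (n : Fin d → ℕ) :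
    Ideal (MvPolynomial (ScrollVertex (∑ i, n i)) K) :=
  initialIdeal (scrollOrder (∑ i, n i)) (fiberConeIdeal K n)

/-- The initial complex `Δ` of the fiber cone: the Stanley–Reisner complex of `in(P)`. -/
noncomputable def initialComplex (K : Type*) [Field K] {d : ℕ} (n : Fin d → ℕ) :
    PreAbstractSimplicialComplex (ScrollVertex (∑ i, n i)) :=
  stanleyReisnerComplex (fiberConeInitialIdeal K n)

/-! Let `m = c - d`. The lower entry of each of the first `m` columns of the matrix is the upper
entry of a later column, its shift. Two families of quadrics lie in `P`. In a Plücker relation the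
strictly concave chord weight makes the product of the two crossing chords the leading term. The
other family expands 4×4 determinants with a repeated row; the leading terms are the products of
chords `u`, `v` such that both ends of `v` are shifts of columns to the right of `u.right`. Call a
set of chords standard if it contains no such pair. It remains to see that the monomials with
standard support are linearly independent modulo `P` (`eq_zero_of_standard`), so that these
squarefree quadrics generate the initial ideal (`exists_bad_of_mem`), and that the complex of
standard sets is shellable (`ShiftedColumns.isShellable`).

Both facts rest on writing this complex as a union of complexes Δ_a with `0 < a ≤ m - 2`, columns
being numbered from 0. The faces of Δ_a are the noncrossing sets of chords that neither lie left of
`a` nor join two shifts of columns right of `a`. For every `a` there is a weight on the variables of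
`R` under which exactly the minors of these allowed chords reach a uniform bound. Their leading
exponents form a vector configuration with regular triangulation Δ_a and cost the chord weight
(`IsRank.isRegularTriangulation`). Thus leading exponents of products over faces of Δ_a are
distinct, which gives independence.

A regular triangulation is shelled by a sweep: each facet carries the linear functional that agrees
with the cost on it, and the facets are ordered by the values of these functionals at a generic
point (`exists_lt_of_key_lt`). The shellings of the Δ_a are concatenated with `a` increasing. Every
facet of Δ_a has a chord with lower-ranked end `next a`, which no Δ_b with `b < a` admits. If there
is only one, removing it leads to Δ_(a-1) (`IsRank.exists_facet_pred`); if there are several, one of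
them can be removed inside Δ_a towards an earlier facet, provided that the generic point is chosen
close to the vectors of the other chords (`IsRank.exists_lt_of_two`). -/

/-! ### Regular triangulations of vector configurations are shellable -/

section RegularTriangulation

variable {V W : Type*} [Fintype V] [AddCommGroup W] [Module ℚ W]

/-- The set where a rational function on a finite type does not vanish. -/
def nzSupport (e : V → ℚ) : Finset V := Finset.univ.filter fun v => e v ≠ 0

theorem mem_nzSupport {e : V → ℚ} {v : V} : v ∈ nzSupport e ↔ e v ≠ 0 := by
  simp [nzSupport]

/-- `Face` is the set of faces of a triangulation of the cone spanned by the vectors `A v`, the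
faces being those supports on which the cost `ω` is minimal. -/
structure IsRegularTriangulation (A : V → W) (ω : V → ℚ) (Face : Finset V → Prop) : Prop where
  empty : Face ∅
  mono : ∀ {F G}, Face G → F ⊆ G → Face F
  -- Together with `inj`, this makes the expression over a face the unique cheapest one with its
  -- value.
  reduce : ∀ e : V → ℚ, 0 ≤ e → (∀ v, e v ≠ 0 → Face {v}) → ∃ e' : V → ℚ, 0 ≤ e' ∧
    Face (nzSupport e') ∧
    Fintype.linearCombination ℚ A e' = Fintype.linearCombination ℚ A e ∧
    (¬ Face (nzSupport e) →
      Fintype.linearCombination ℚ ω e' < Fintype.linearCombination ℚ ω e)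
  inj : ∀ e f : V → ℚ, 0 ≤ e → 0 ≤ f → Face (nzSupport e) → Face (nzSupport f) →
    Fintype.linearCombination ℚ A e = Fintype.linearCombination ℚ A f → e = f
  span : Submodule.span ℚ (A '' {v | Face {v}}) = ⊤

theorem exists_maximal_superset {V : Type*} [Finite V] {Face : Finset V → Prop} {F : Finset V}
    (hF : Face F) : ∃ G, F ⊆ G ∧ Maximal Face G := by
  obtain ⟨G, hFG, hG⟩ := (Set.toFinite {G | Face G}).exists_le_maximal hF
  exact ⟨G, hFG, hG⟩

theorem Finset.sdiff_eq_singleton_of_erase_subset {V : Type*} [DecidableEq V] {F G : Finset V}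
    (hcard : F.card = G.card) {v : V} (hv : v ∈ F) (h : F.erase v ⊆ G) (hne : G ≠ F) :
    F \ G = {v} := by
  ext u
  simp only [Finset.mem_sdiff, Finset.mem_singleton]
  constructor
  · rintro ⟨h1, h2⟩
    by_contra huv
    exact h2 (h (Finset.mem_erase.2 ⟨huv, h1⟩))
  · rintro rfl
    refine ⟨hv, fun hu => hne ?_⟩
    refine (Finset.eq_of_subset_of_card_le (fun x hx => ?_) hcard.ge).symm
    by_cases hxu : x = u
    · exact hxu ▸ hu
    · exact h (Finset.mem_erase.2 ⟨hxu, hx⟩)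

namespace IsRegularTriangulation

variable {A : V → W} {ω : V → ℚ} {Face : Finset V → Prop}

/-- The positive and negative parts of `c - c'` are nonnegative combinations over one face with the
same value, so `inj` identifies them. -/
theorem eq_of_comb_eq (T : IsRegularTriangulation A ω Face) {F : Finset V} (hF : Face F)
    {c c' : V → ℚ} (hc : ∀ v, v ∉ F → c v = 0) (hc' : ∀ v, v ∉ F → c' v = 0)
    (h : Fintype.linearCombination ℚ A c = Fintype.linearCombination ℚ A c') : c = c' := by
  have key : (fun v => max (c v - c' v) 0) = fun v => max (c' v - c v) 0 := by
    apply T.inj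
    · exact fun v => le_max_right _ _
    · exact fun v => le_max_right _ _
    · refine T.mono hF fun v hv => ?_
      by_contra hvF
      simp [mem_nzSupport, hc v hvF, hc' v hvF] at hv
    · refine T.mono hF fun v hv => ?_
      by_contra hvF
      simp [mem_nzSupport, hc v hvF, hc' v hvF] at hv
    · rw [← sub_eq_zero, ← map_sub]
      have : ((fun v => max (c v - c' v) 0) - fun v => max (c' v - c v) 0) = c - c' := by
        funext v
        simp only [Pi.sub_apply]
        rcases le_total (c v) (c' v) with h | h
        · rw [max_eq_right (by linarith), max_eq_left (by linarith)]; ring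
        · rw [max_eq_left (by linarith), max_eq_right (by linarith)]; ring
      rw [this, map_sub, h, sub_self]
  funext v
  have : max (c v - c' v) 0 = max (c' v - c v) 0 := congrFun key v
  rcases le_total (c v) (c' v) with h | h
  · rw [max_eq_right (by linarith), max_eq_left (by linarith)] at this; linarith
  · rw [max_eq_left (by linarith), max_eq_right (by linarith)] at this; linarith

variable [DecidableEq V]

theorem comb_single (A : V → W) (v : V) (x : ℚ) :
    Fintype.linearCombination ℚ A (Pi.single v x) = x • A v := by
  rw [Fintype.linearCombination_apply, Finset.sum_eq_single v]
  · simp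
  · intro b _ hb; simp [hb]
  · simp

/-- A face `F` together with a direction `A w` lies in a common larger face. -/
theorem exists_face_of_direction (T : IsRegularTriangulation A ω Face) {F : Finset V}
    (hF : Face F) {w : V} (hw : Face {w}) :
    ∃ (g : V → ℚ) (N : ℕ), 0 ≤ g ∧ Face (nzSupport g) ∧ F ⊆ nzSupport g ∧
      Fintype.linearCombination ℚ A g =
        (N : ℚ) • Fintype.linearCombination ℚ A (fun v => if v ∈ F then 1 else 0) + A w := by
  classical
  set one : V → ℚ := fun v => if v ∈ F then 1 else 0 with hone
  -- Reduce `N • one + w` for all `N`. By pigeonhole one support `G` occurs infinitely often, and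
  -- over `G` the reduced combinations are affine in `N` with some direction `x`. Large `N` force `0
  -- ≤ x`, and `x` has the same value as `one`, so uniqueness gives `x = one` and `F ⊆ G`.
  have hstep : ∀ N : ℕ, ∃ g : V → ℚ, 0 ≤ g ∧ Face (nzSupport g) ∧
      Fintype.linearCombination ℚ A g =
        (N : ℚ) • Fintype.linearCombination ℚ A one + A w := by
    intro N
    obtain ⟨e', h0, hf, hA, -⟩ := T.reduce ((N : ℚ) • one + Pi.single w 1) (by
        intro v
        have h1 : (0 : ℚ) ≤ N * one v := mul_nonneg (Nat.cast_nonneg _) (by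
          simp only [hone]; split_ifs <;> norm_num)
        have h2 : (0 : ℚ) ≤ (Pi.single w 1 : V → ℚ) v := by
          by_cases h : v = w
          · subst h; simp
          · simp [h]
        simpa using add_nonneg h1 h2) (by
        intro v hv
        by_cases h : v = w
        · rw [h]; exact hw
        · by_cases hvF : v ∈ F
          · exact T.mono hF (by simpa using hvF)
          · simp [hone, h, hvF] at hv)
    refine ⟨e', h0, hf, ?_⟩
    rw [hA, map_add, map_smul, comb_single, one_smul]
  choose g hg0 hgF hgA using hstep
  obtain ⟨G, hG⟩ := Finite.exists_infinite_fiber fun N => nzSupport (g N)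
  have hinf : ((fun N => nzSupport (g N)) ⁻¹' {G}).Infinite := Set.infinite_coe_iff.mp hG
  obtain ⟨N₁, hN₁, -⟩ := hinf.exists_gt 0
  obtain ⟨N₂, hN₂, hlt⟩ := hinf.exists_gt N₁
  simp only [Set.mem_preimage, Set.mem_singleton_iff] at hN₁ hN₂
  have hFG : Face G := hN₁ ▸ hgF N₁
  have hsup : ∀ N, nzSupport (g N) = G → ∀ v, v ∉ G → g N v = 0 := by
    intro N hN v hv
    by_contra h
    exact hv (hN ▸ mem_nzSupport.2 h)
  have hd : (0 : ℚ) < (N₂ : ℚ) - N₁ := sub_pos.2 (by exact_mod_cast hlt)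
  set x : V → ℚ := ((N₂ : ℚ) - N₁)⁻¹ • (g N₂ - g N₁) with hx
  have hxA : Fintype.linearCombination ℚ A x = Fintype.linearCombination ℚ A one := by
    rw [hx, map_smul, map_sub, hgA, hgA, add_sub_add_right_eq_sub, ← sub_smul, smul_smul,
      inv_mul_cancel₀ hd.ne', one_smul]
  have hxG : ∀ v, v ∉ G → x v = 0 := by
    intro v hv
    simp [hx, hsup N₁ hN₁ v hv, hsup N₂ hN₂ v hv]
  have haff : ∀ N, nzSupport (g N) = G → g N = g N₁ + ((N : ℚ) - N₁) • x := by
    intro N hN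
    refine T.eq_of_comb_eq hFG (hsup N hN) (fun v hv => ?_) ?_
    · simp [hsup N₁ hN₁ v hv, hxG v hv]
    · rw [map_add, map_smul, hxA, hgA, hgA, sub_smul]; abel
  have hx0 : 0 ≤ x := by
    intro v
    by_contra hneg
    have hneg : x v < 0 := by simpa using hneg
    obtain ⟨n, hn⟩ := exists_nat_gt ((g N₁ v) / (-(x v)) + N₁)
    obtain ⟨N, hN, hNn⟩ := hinf.exists_gt n
    have h1 := congrFun (haff N hN) v
    have h2 := hg0 N v
    simp only [Pi.add_apply, Pi.smul_apply, smul_eq_mul, Pi.zero_apply] at h1 h2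
    have h3 : (n : ℚ) < N := by exact_mod_cast hNn
    have h4 : (g N₁ v) / (-(x v)) < (N : ℚ) - N₁ := by linarith
    rw [div_lt_iff₀ (by linarith)] at h4
    nlinarith
  have hx1 : x = one := by
    apply T.inj _ _ hx0 _ _ _ hxA
    · intro v; simp only [hone]; split_ifs <;> norm_num
    · refine T.mono hFG fun v hv => ?_
      by_contra h
      exact mem_nzSupport.1 hv (hxG v h)
    · refine T.mono hF fun v hv => ?_
      by_contra h
      simp [mem_nzSupport, hone, h] at hv
  refine ⟨g N₁, N₁, hg0 _, hgF _, fun v hv => ?_, hgA _⟩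
  rw [hN₁]
  by_contra h
  have := hxG v h
  rw [hx1] at this
  simp [hone, hv] at this

/-- For a facet the larger face found in `exists_face_of_direction` is the facet itself, so every `A
w` is a combination of its vectors. -/
theorem comb_surjOn (T : IsRegularTriangulation A ω Face) {F : Finset V} (hF : Maximal Face F)
    (x : W) : ∃ c : V → ℚ, (∀ v, v ∉ F → c v = 0) ∧ Fintype.linearCombination ℚ A c = x := by
  have hx : x ∈ Submodule.span ℚ (A '' {v | Face {v}}) := T.span ▸ Submodule.mem_top
  induction hx using Submodule.span_induction with
  | mem x hx =>
    obtain ⟨w, hw, rfl⟩ := hx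
    obtain ⟨g, N, hg0, hg, hFg, hA⟩ := T.exists_face_of_direction hF.prop hw
    have hgF := hF.eq_of_le hg hFg
    refine ⟨g - (N : ℚ) • fun v => if v ∈ F then 1 else 0, fun v hv => ?_, ?_⟩
    · have : g v = 0 := by
        by_contra h
        exact hv (hgF ▸ mem_nzSupport.2 h)
      simp [this, hv]
    · rw [map_sub, map_smul, hA]; abel
  | zero => exact ⟨0, fun _ _ => rfl, map_zero _⟩
  | add x y _ _ hx hy =>
    obtain ⟨c, hc, rfl⟩ := hx
    obtain ⟨c', hc', rfl⟩ := hy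
    exact ⟨c + c', fun v hv => by simp [hc v hv, hc' v hv], map_add _ _ _⟩
  | smul a x _ hx =>
    obtain ⟨c, hc, rfl⟩ := hx
    exact ⟨a • c, fun v hv => by simp [hc v hv], map_smul _ _ _⟩

/-- The coordinates with respect to the vectors of a facet. -/
noncomputable def coord (T : IsRegularTriangulation A ω Face) {F : Finset V}
    (hF : Maximal Face F) : W →ₗ[ℚ] (V → ℚ) where
  toFun x := (T.comb_surjOn hF x).choose
  map_add' x y := by
    refine T.eq_of_comb_eq hF.prop (T.comb_surjOn hF _).choose_spec.1 (fun v hv => ?_) ?_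
    · simp [(T.comb_surjOn hF x).choose_spec.1 v hv, (T.comb_surjOn hF y).choose_spec.1 v hv]
    · rw [(T.comb_surjOn hF _).choose_spec.2, map_add, (T.comb_surjOn hF x).choose_spec.2,
        (T.comb_surjOn hF y).choose_spec.2]
  map_smul' a x := by
    refine T.eq_of_comb_eq hF.prop (T.comb_surjOn hF _).choose_spec.1 (fun v hv => ?_) ?_
    · simp [(T.comb_surjOn hF x).choose_spec.1 v hv]
    · rw [(T.comb_surjOn hF _).choose_spec.2, map_smul, (T.comb_surjOn hF x).choose_spec.2]; rfl

variable (T : IsRegularTriangulation A ω Face) {F G : Finset V}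

theorem coord_of_notMem (hF : Maximal Face F) (x : W) {v : V} (hv : v ∉ F) :
    T.coord hF x v = 0 := (T.comb_surjOn hF x).choose_spec.1 v hv

theorem comb_coord (hF : Maximal Face F) (x : W) :
    Fintype.linearCombination ℚ A (T.coord hF x) = x := (T.comb_surjOn hF x).choose_spec.2

theorem coord_comb (hF : Maximal Face F) {c : V → ℚ} (hc : ∀ v, v ∉ F → c v = 0) :
    T.coord hF (Fintype.linearCombination ℚ A c) = c :=
  T.eq_of_comb_eq hF.prop (fun _ => T.coord_of_notMem hF _) hc (T.comb_coord hF _)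

theorem coord_apply_mem (hF : Maximal Face F) {v : V} (hv : v ∈ F) :
    T.coord hF (A v) = Pi.single v 1 := by
  have := T.coord_comb hF (c := Pi.single v 1) (fun u hu => by
    have : u ≠ v := fun h => hu (h ▸ hv)
    simp [this])
  rwa [comb_single, one_smul] at this

/-- The vectors of a facet form a basis: `eq_of_comb_eq` gives independence, `comb_surjOn` spanning.
-/
theorem card_facet (T : IsRegularTriangulation A ω Face) {F : Finset V} (hF : Maximal Face F) : F.card = Module.finrank ℚ W := by
  have hext : ∀ g : F → ℚ, Fintype.linearCombination ℚ A
      (fun v => if h : v ∈ F then g ⟨v, h⟩ else 0) = ∑ i : F, g i • A i := by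
    intro g
    rw [Fintype.linearCombination_apply, ← Finset.sum_subset (Finset.subset_univ F)
      (fun v _ hv => by simp [hv]), ← Finset.sum_coe_sort F]
    exact Finset.sum_congr rfl fun i _ => by simp
  have hli : LinearIndependent ℚ fun v : F => A v := by
    rw [Fintype.linearIndependent_iff]
    intro g hg i
    have := T.eq_of_comb_eq hF.prop (c := fun v => if h : v ∈ F then g ⟨v, h⟩ else 0) (c' := 0)
      (fun v hv => by simp [hv]) (fun _ _ => rfl) (by rw [hext, hg, map_zero])
    simpa using congrFun this i
  have hsp : ⊤ ≤ Submodule.span ℚ (Set.range fun v : F => A v) := by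
    intro x _
    rw [← T.comb_coord hF x, Fintype.linearCombination_apply]
    refine Submodule.sum_mem _ fun v _ => ?_
    by_cases hv : v ∈ F
    · exact Submodule.smul_mem _ _ (Submodule.subset_span ⟨⟨v, hv⟩, rfl⟩)
    · rw [T.coord_of_notMem hF x hv, zero_smul]; exact Submodule.zero_mem _
  rw [Module.finrank_eq_card_basis (Module.Basis.mk hli hsp), Fintype.card_coe]

/-- The linear functional that agrees with the cost on a facet. -/
noncomputable def support (hF : Maximal Face F) : W →ₗ[ℚ] ℚ :=
  Fintype.linearCombination ℚ ω ∘ₗ T.coord hF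

theorem support_mem (hF : Maximal Face F) {v : V} (hv : v ∈ F) : T.support hF (A v) = ω v := by
  simp [support, T.coord_apply_mem hF hv]

/-- Expand `A w` in the basis `F` and move the negative coefficients to the side of `w`. This gives
combinations `e` (containing `w`) and `f` (over `F`) of equal value. The support of `e` is no face,
since otherwise `e = f`; hence reducing `e` yields `f` at a strictly smaller cost. -/
theorem support_lt (hF : Maximal Face F) {w : V} (hw : Face {w}) (hwF : w ∉ F) :
    T.support hF (A w) < ω w := by
  set c := T.coord hF (A w) with hc
  have hcw : c w = 0 := T.coord_of_notMem hF _ hwF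
  set e : V → ℚ := Pi.single w 1 + fun v => max (-c v) 0 with he
  set f : V → ℚ := fun v => max (c v) 0 with hf
  have hfe : f - e = c - Pi.single w 1 := by
    funext v
    have : max (c v) 0 - max (-c v) 0 = c v := by
      rcases le_total 0 (c v) with h | h
      · rw [max_eq_left h, max_eq_right (by linarith)]; ring
      · rw [max_eq_right h, max_eq_left (by linarith)]; ring
    simp only [he, hf, Pi.sub_apply, Pi.add_apply]
    linarith
  have hsF : nzSupport f ⊆ F := by
    intro v hv
    by_contra h
    simp [mem_nzSupport, hf, hc, T.coord_of_notMem hF _ h] at hv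
  have hAe : Fintype.linearCombination ℚ A f = Fintype.linearCombination ℚ A e := by
    rw [← sub_eq_zero, ← map_sub, hfe, map_sub, comb_single, hc, T.comb_coord, one_smul, sub_self]
  have hf0 : 0 ≤ f := fun v => le_max_right _ _
  have hew : 1 ≤ e w := by simp [he]
  have he0 : 0 ≤ e := by
    intro v
    have h1 : (0 : ℚ) ≤ (Pi.single w 1 : V → ℚ) v := by
      by_cases h : v = w
      · subst h; simp
      · simp [h]
    exact add_nonneg h1 (le_max_right _ _)
  obtain ⟨e', he'0, he'F, he'A, hlt⟩ := T.reduce e he0 (by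
    intro v hv
    by_cases h : v = w
    · rw [h]; exact hw
    · by_cases hvF : v ∈ F
      · exact T.mono hF.prop (by simpa using hvF)
      · simp [he, h, hc, T.coord_of_notMem hF _ hvF] at hv)
  have hne : ¬ Face (nzSupport e) := by
    intro h
    have := T.inj e f he0 hf0 h (T.mono hF.prop hsF) hAe.symm
    have h2 : f w = 0 := by simp [hf, hcw]
    rw [this, h2] at hew
    norm_num at hew
  have heq : e' = f := T.inj e' f he'0 hf0 he'F (T.mono hF.prop hsF) (he'A.trans hAe.symm)
  have hlt := hlt hne
  rw [heq, ← sub_neg, ← map_sub, hfe, map_sub, comb_single, one_smul, sub_neg] at hlt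
  exact hlt

/-- Both functionals equal the cost on `F ∩ G`, so in the expansion of `x` in the basis `F` only the
vertices outside `G` contribute. -/
theorem support_eq_add (hF : Maximal Face F) (hG : Maximal Face G) (x : W) :
    T.support hG x - T.support hF x =
      ∑ v ∈ F \ G, T.coord hF x v * (T.support hG (A v) - ω v) := by
  have h1 : T.support hG x = ∑ v, T.coord hF x v * T.support hG (A v) := by
    conv_lhs => rw [← T.comb_coord hF x, Fintype.linearCombination_apply, map_sum]
    simp
  have h2 : T.support hF x = ∑ v, T.coord hF x v * ω v := by
    simp [support, Fintype.linearCombination_apply]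
  rw [h1, h2, ← Finset.sum_sub_distrib]
  symm
  rw [Finset.sum_subset (Finset.subset_univ (F \ G))]
  · exact Finset.sum_congr rfl fun v _ => by ring
  · intro v _ hv
    by_cases hvF : v ∈ F
    · have hvG : v ∈ G := by
        by_contra h
        exact hv (Finset.mem_sdiff.2 ⟨hvF, h⟩)
      rw [T.support_mem hG hvG, sub_self, mul_zero]
    · rw [T.coord_of_notMem hF x hvF, zero_mul]

/-- Pivoting: a facet of `F` that does not bound the cone lies in another facet. -/
theorem exists_pivot (hF : Maximal Face F) {v w : V} (hv : v ∈ F) (hw : Face {w})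
    (hneg : T.coord hF (A w) v < 0) : ∃ G, Maximal Face G ∧ F \ G = {v} := by
  obtain ⟨g, N, hg0, hgF, hFg, hA⟩ :=
    T.exists_face_of_direction (T.mono hF.prop (F.erase_subset v)) hw
  obtain ⟨G, hgG, hG⟩ := exists_maximal_superset hgF
  refine ⟨G, hG, Finset.sdiff_eq_singleton_of_erase_subset
    ((T.card_facet hF).trans (T.card_facet hG).symm) hv (hFg.trans hgG) ?_⟩
  -- If `G = F`, compare coordinates at `v`: that of `g` is nonnegative, while `F.erase v`
  -- contributes nothing and `A w` something negative.
  rintro rfl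
  have h1 := congrArg (fun x => T.coord hF x v) hA
  simp only [map_add, map_smul, Pi.add_apply, Pi.smul_apply] at h1
  rw [T.coord_comb hF, T.coord_comb hF] at h1
  · have := hg0 v
    simp only [Finset.mem_erase, ne_eq, not_true_eq_false, false_and, if_false, smul_zero,
      zero_add, Pi.zero_apply] at h1 this
    linarith
  · intro u hu
    simp [Finset.mem_erase, hu]
  · intro u hu
    by_contra h
    exact hu (hgG (mem_nzSupport.2 h))

/-- The key by which facets are ordered along a sequence of vectors. -/
noncomputable def key (p : ℕ → V) (hF : Maximal Face F) : Lex (ℕ → ℚ) :=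
  toLex fun n => -T.support hF (A (p n))

/-- Comparing keys means comparing functionals at the infinitesimally perturbed point `p 0 + ε p 1 +
ε² p 2 + ⋯`, larger values coming first. If this point lies beyond the wall opposite to `v`,
crossing the wall changes the functional by a negative coordinate times a negative number. -/
theorem exists_lt_of_coord_neg {p : ℕ → V} (hp : ∀ n, Face {p n}) (hF : Maximal Face F) {v : V}
    (hv : v ∈ F) {n : ℕ} (hneg : T.coord hF (A (p n)) v < 0)
    (hzero : ∀ k < n, T.coord hF (A (p k)) v = 0) :
    ∃ (G : Finset V) (hG : Maximal Face G), T.key p hG < T.key p hF ∧ F \ G = {v} := by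
  obtain ⟨G, hG, hFG⟩ := T.exists_pivot hF hv (hp n) hneg
  have hvG : v ∉ G := (Finset.mem_sdiff.1 (hFG ▸ Finset.mem_singleton_self v)).2
  have hlt := T.support_lt hG (T.mono hF.prop (by simpa using hv)) hvG
  refine ⟨G, hG, ⟨n, fun k hk => ?_, ?_⟩, hFG⟩
  · have := T.support_eq_add hF hG (A (p k))
    rw [hFG, Finset.sum_singleton, hzero k hk, zero_mul] at this
    simp only [key, toLex]
    change -T.support hG (A (p k)) = -T.support hF (A (p k))
    linarith
  · have := T.support_eq_add hF hG (A (p n))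
    rw [hFG, Finset.sum_singleton] at this
    change -T.support hG (A (p n)) < -T.support hF (A (p n))
    nlinarith

/-- Look at the first `p k` with a nonzero coordinate at a vertex of `F \ G`. If all these
coordinates were nonnegative, `support_eq_add` and `support_lt` would make the functional of `G`
smaller than that of `F` at `p k`, against the order of the keys. So one is negative, and the wall
opposite to its vertex can be crossed. -/
theorem exists_lt_of_key_lt {p : ℕ → V} (hp : ∀ n, Face {p n}) (hF : Maximal Face F)
    (hG : Maximal Face G) (hlt : T.key p hG < T.key p hF) :
    ∃ v ∈ F \ G, ∃ (H : Finset V) (hH : Maximal Face H), T.key p hH < T.key p hF ∧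
      F \ H = {v} := by
  obtain ⟨n, hn0, hn⟩ := hlt
  change ∀ k < n, -T.support hG (A (p k)) = -T.support hF (A (p k)) at hn0
  change -T.support hG (A (p n)) < -T.support hF (A (p n)) at hn
  have hsum := fun k => T.support_eq_add hF hG (A (p k))
  have hex : ∃ k, ∃ v ∈ F \ G, T.coord hF (A (p k)) v ≠ 0 := by
    by_contra! h
    have := hsum n
    rw [Finset.sum_eq_zero fun v hv => by rw [h n v hv, zero_mul]] at this
    linarith
  classical
  have hmin : ∀ j < Nat.find hex, ∀ v ∈ F \ G, T.coord hF (A (p j)) v = 0 := by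
    intro j hj v hv
    by_contra h
    exact Nat.find_min hex hj ⟨v, hv, h⟩
  obtain ⟨v₀, hv₀, hne⟩ := Nat.find_spec hex
  by_cases hneg : ∃ v ∈ F \ G, T.coord hF (A (p (Nat.find hex))) v < 0
  · obtain ⟨v, hv, hneg⟩ := hneg
    obtain ⟨H, hH⟩ := T.exists_lt_of_coord_neg hp hF (Finset.mem_sdiff.1 hv).1 hneg
      (fun k hk => hmin k hk v hv)
    exact ⟨v, hv, H, hH⟩
  · push Not at hneg
    have hδ : ∀ v ∈ F \ G, T.support hG (A v) - ω v < 0 := fun v hv =>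
      sub_neg.2 (T.support_lt hG (T.mono hF.prop (by simpa using (Finset.mem_sdiff.1 hv).1))
        (Finset.mem_sdiff.1 hv).2)
    have hlt : ∑ v ∈ F \ G, T.coord hF (A (p (Nat.find hex))) v *
        (T.support hG (A v) - ω v) < 0 :=
      Finset.sum_neg' (fun v hv => mul_nonpos_of_nonneg_of_nonpos (hneg v hv) (hδ v hv).le)
        ⟨v₀, hv₀, mul_neg_of_pos_of_neg (lt_of_le_of_ne (hneg v₀ hv₀) hne.symm) (hδ v₀ hv₀)⟩
    rw [← hsum] at hlt
    have hle : Nat.find hex ≤ n := by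
      by_contra! h
      have := hsum n
      rw [Finset.sum_eq_zero fun v hv => by rw [hmin n h v hv, zero_mul]] at this
      linarith
    rcases hle.lt_or_eq with h | h
    · have := hn0 _ h; linarith
    · rw [h] at hlt; linarith

/-- If a linear functional vanishes on an initial part of the sequence and on all vertices of a
facet but those in `S`, where it is constant, then we can move to an earlier facet by removing a
vertex of `S`. -/
theorem exists_lt_of_functional {p : ℕ → V} (hp : ∀ n, Face {p n}) (hF : Maximal Face F)
    (l : W →ₗ[ℚ] ℚ) {N : ℕ} (hN : ∀ n < N, l (A (p n)) = 0) (hl : ∀ v ∈ F, l (A v) = 0 ∨ l (A v) = 1)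
    {v₀ : V} (hv₀ : v₀ ∈ F) (hlv₀ : l (A v₀) = 1) {n₀ : ℕ} (hn₀ : n₀ < N)
    (hne₀ : T.coord hF (A (p n₀)) v₀ ≠ 0) :
    ∃ v ∈ F, l (A v) = 1 ∧ ∃ (H : Finset V) (hH : Maximal Face H), T.key p hH < T.key p hF ∧
      F \ H = {v} := by
  classical
  set S := F.filter fun v => l (A v) = 1 with hS
  -- In the basis `F` the functional is the sum of the coordinates on `S`. It vanishes on the first
  -- `N` vectors, so the first nonzero coordinates on `S` cannot all be positive.
  have hsum : ∀ x, l x = ∑ v ∈ S, T.coord hF x v := by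
    intro x
    conv_lhs => rw [← T.comb_coord hF x, Fintype.linearCombination_apply, map_sum]
    rw [← Finset.sum_subset (Finset.subset_univ S)]
    · refine Finset.sum_congr rfl fun v hv => ?_
      rw [map_smul, (Finset.mem_filter.1 hv).2, smul_eq_mul, mul_one]
    · intro v _ hv
      by_cases hvF : v ∈ F
      · rcases hl v hvF with h | h
        · rw [map_smul, h, smul_zero]
        · exact absurd (Finset.mem_filter.2 ⟨hvF, h⟩) hv
      · rw [T.coord_of_notMem hF x hvF, zero_smul, map_zero]
  have hex : ∃ k, ∃ v ∈ S, T.coord hF (A (p k)) v ≠ 0 :=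
    ⟨n₀, v₀, Finset.mem_filter.2 ⟨hv₀, hlv₀⟩, hne₀⟩
  have hmin : ∀ j < Nat.find hex, ∀ v ∈ S, T.coord hF (A (p j)) v = 0 := by
    intro j hj v hv
    by_contra h
    exact Nat.find_min hex hj ⟨v, hv, h⟩
  have hlt : Nat.find hex < N :=
    (Nat.find_min' hex ⟨v₀, Finset.mem_filter.2 ⟨hv₀, hlv₀⟩, hne₀⟩).trans_lt hn₀
  have h0 := hN _ hlt
  rw [hsum] at h0
  obtain ⟨v, hv, hneg⟩ : ∃ v ∈ S, T.coord hF (A (p (Nat.find hex))) v < 0 := by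
    by_contra! h
    obtain ⟨v, hv, hne⟩ := Nat.find_spec hex
    exact hne ((Finset.sum_eq_zero_iff_of_nonneg h).1 h0 v hv)
  obtain ⟨hvF, hlv⟩ := Finset.mem_filter.1 hv
  obtain ⟨H, hH⟩ := T.exists_lt_of_coord_neg hp hF hvF hneg (fun k hk => hmin k hk v hv)
  exact ⟨v, hvF, hlv, H, hH⟩

/-- A facet is recovered from its functional as the set of vertices where the cost is attained. -/
theorem key_injective {p : ℕ → V} (hp : ∀ v, Face {v} → ∃ n, p n = v)
    (hF : Maximal Face F) (hG : Maximal Face G) (h : T.key p hF = T.key p hG) : F = G := by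
  have hsub : F ⊆ G := by
    intro v hv
    by_contra hvG
    have hfv : Face {v} := T.mono hF.prop (by simpa using hv)
    obtain ⟨n, rfl⟩ := hp v hfv
    have h1 := T.support_lt hG hfv hvG
    have h2 : -T.support hF (A (p n)) = -T.support hG (A (p n)) := congrFun h n
    rw [T.support_mem hF hv] at h2
    linarith
  exact hF.eq_of_le hG.prop hsub

end IsRegularTriangulation

end RegularTriangulation

/-- A pure complex whose facets carry distinct keys in a linear order is shellable, if every facet
can be moved to an earlier one by removing a vertex not in a given earlier facet. -/
theorem isShellable_of_key {σ κ : Type*} [Fintype σ] [DecidableEq σ] [LinearOrder κ]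
    (Δ : PreAbstractSimplicialComplex σ)
    (hpure : ∀ F G : Finset σ, IsFacet Δ F → IsFacet Δ G → F.card = G.card)
    (key : Finset σ → κ) (hinj : ∀ F G, IsFacet Δ F → IsFacet Δ G → key F = key G → F = G)
    (hshell : ∀ F G, IsFacet Δ F → IsFacet Δ G → key G < key F →
      ∃ v ∈ F \ G, ∃ H, IsFacet Δ H ∧ key H < key F ∧ F \ H = {v}) :
    IsShellable Δ := by
  classical
  refine ⟨hpure, ?_⟩
  set 𝓕 : Finset (Finset σ) := Finset.univ.filter (IsFacet Δ) with h𝓕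
  have hmem : ∀ {F}, F ∈ 𝓕 ↔ IsFacet Δ F := by simp [h𝓕]
  set s := 𝓕.image key with hs
  set φ := s.orderEmbOfFin rfl with hφ
  have hφmem : ∀ i, ∃ F, IsFacet Δ F ∧ key F = φ i := by
    intro i
    obtain ⟨F, hF, h⟩ := Finset.mem_image.1 (s.orderEmbOfFin_mem rfl i)
    exact ⟨F, hmem.1 hF, h⟩
  choose F hF hkey using hφmem
  have hsurj : ∀ G, IsFacet Δ G → ∃ j, F j = G := by
    intro G hG
    have : key G ∈ Set.range φ := by
      rw [hφ, Finset.range_orderEmbOfFin]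
      exact Finset.mem_image_of_mem key (hmem.2 hG)
    obtain ⟨j, hj⟩ := this
    exact ⟨j, hinj _ _ (hF j) hG ((hkey j).trans hj)⟩
  refine ⟨s.card, F, ?_, fun G => ⟨hsurj G, ?_⟩, ?_⟩
  · intro i j h
    apply φ.injective
    rw [← hkey, ← hkey, h]
  · rintro ⟨j, rfl⟩; exact hF j
  · intro i j hij
    have : key (F i) < key (F j) := by rw [hkey, hkey]; exact φ.strictMono hij
    obtain ⟨v, hv, H, hH, hlt, hd⟩ := hshell _ _ (hF j) (hF i) this
    obtain ⟨k, rfl⟩ := hsurj H hH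
    refine ⟨v, hv, k, ?_, hd⟩
    rw [hkey, hkey] at hlt
    exact φ.lt_iff_lt.1 hlt

/-! ### Chords -/

namespace ScrollVertex

variable {c : ℕ}

/-- The chord with the given end points. -/
def pair (i j : Fin c) (h : i ≠ j) : ScrollVertex c :=
  ⟨toLex (min i j, max i j), min_lt_max.2 h⟩

@[simp] theorem left_pair (i j : Fin c) (h : i ≠ j) : (pair i j h).left = min i j := rfl

@[simp] theorem right_pair (i j : Fin c) (h : i ≠ j) : (pair i j h).right = max i j := rfl

theorem left_lt_right (v : ScrollVertex c) : v.left < v.right := v.2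

theorem ext_ends {u v : ScrollVertex c} (h1 : u.left = v.left) (h2 : u.right = v.right) : u = v :=
  Subtype.ext (congrArg toLex (Prod.ext h1 h2))

/-- Two chords cross, the first one starting first. -/
def Cross (u v : ScrollVertex c) : Prop :=
  u.left < v.left ∧ v.left < u.right ∧ u.right < v.right

/-- The weight of a chord. -/
def weight (v : ScrollVertex c) : ℕ :=
  ((v.right : ℕ) - (v.left : ℕ)) * (c - ((v.right : ℕ) - (v.left : ℕ)))

/-- The end point of smaller rank. -/
def lo (rk : Fin c → ℕ) (v : ScrollVertex c) : Fin c :=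
  if rk v.left < rk v.right then v.left else v.right

/-- The end point of larger rank. -/
def hi (rk : Fin c → ℕ) (v : ScrollVertex c) : Fin c :=
  if rk v.left < rk v.right then v.right else v.left

theorem lo_hi (rk : Fin c → ℕ) (v : ScrollVertex c) :
    (lo rk v = v.left ∧ hi rk v = v.right) ∨ (lo rk v = v.right ∧ hi rk v = v.left) := by
  unfold lo hi; split_ifs <;> simp

theorem lo_ne_hi (rk : Fin c → ℕ) (v : ScrollVertex c) : lo rk v ≠ hi rk v := by
  have := v.left_lt_right
  rcases lo_hi rk v with ⟨h1, h2⟩ | ⟨h1, h2⟩ <;> rw [h1, h2]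
  exacts [this.ne, this.ne']

theorem rk_lo_lt_rk_hi {rk : Fin c → ℕ} (hrk : Function.Injective rk) (v : ScrollVertex c) :
    rk (lo rk v) < rk (hi rk v) := by
  have h := hrk.ne v.left_lt_right.ne
  unfold lo hi; split_ifs <;> omega

theorem lo_pair {rk : Fin c → ℕ} {i j : Fin c} (h : i ≠ j) (hij : rk i < rk j) :
    lo rk (pair i j h) = i := by
  rcases lt_or_gt_of_ne h with h' | h'
  · simp [lo, min_eq_left h'.le, max_eq_right h'.le, hij]
  · simp [lo, min_eq_right h'.le, max_eq_left h'.le, hij.le]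

theorem hi_pair {rk : Fin c → ℕ} {i j : Fin c} (h : i ≠ j) (hij : rk i < rk j) :
    hi rk (pair i j h) = j := by
  rcases lt_or_gt_of_ne h with h' | h'
  · simp [hi, min_eq_left h'.le, max_eq_right h'.le, hij]
  · simp [hi, min_eq_right h'.le, max_eq_left h'.le, hij.le]

theorem eq_pair (rk : Fin c → ℕ) (v : ScrollVertex c) :
    v = pair (lo rk v) (hi rk v) (lo_ne_hi rk v) := by
  have := v.left_lt_right
  rcases lo_hi rk v with ⟨h1, h2⟩ | ⟨h1, h2⟩ <;> apply ext_ends <;>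
    simp [h1, h2, this.le]

theorem eq_of_lo_hi {rk : Fin c → ℕ} {u v : ScrollVertex c} (h1 : lo rk u = lo rk v)
    (h2 : hi rk u = hi rk v) : u = v := by
  rw [eq_pair rk u, eq_pair rk v]; simp only [h1, h2]

end ScrollVertex

/-- The rank function `rk` is increasing up to `r` and decreasing from `r` on. -/
structure IsTent {c : ℕ} (rk : Fin c → ℕ) (r : ℕ) : Prop where
  inj : Function.Injective rk
  mono : ∀ i j : Fin c, i < j → (j : ℕ) < r → rk i < rk j
  anti : ∀ i j : Fin c, r ≤ (i : ℕ) → i < j → rk j < rk i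

namespace IsTent

open ScrollVertex

variable {c r : ℕ} {rk : Fin c → ℕ}

theorem side (h : IsTent rk r) {i j : Fin c} (hij : rk i < rk j) :
    i ≠ j ∧ (j < i → r ≤ (i : ℕ)) ∧ (i < j → (i : ℕ) < r) := by
  refine ⟨fun e => by simp [e] at hij, fun hji => ?_, fun hlt => ?_⟩
  · by_contra! hir
    exact absurd (h.mono j i hji hir) (by omega)
  · by_contra! hir
    exact absurd (h.anti i j hir hlt) (by omega)

/-- Crossing chords are not separated by the rank. -/
theorem lo_lt_hi_of_cross (h : IsTent rk r) {u v : ScrollVertex c} (huv : u.Cross v) :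
    rk (lo rk u) < rk (hi rk v) ∧ rk (lo rk v) < rk (hi rk u) := by
  obtain ⟨h1, h2, h3⟩ := huv
  have hu := rk_lo_lt_rk_hi h.inj u
  have hv := rk_lo_lt_rk_hi h.inj v
  rw [Fin.lt_def] at h1 h2 h3
  -- The columns of rank at least a given value form an interval. If a claimed inequality failed,
  -- both ends of one chord would lie in such an interval and both ends of the other outside it,
  -- crossing chords having no common end; then they could not cross.
  have e1 : ∀ i j : Fin c, rk i ≤ rk j → i = j ∨ ((j < i → r ≤ (i : ℕ)) ∧ (i < j → (i : ℕ) < r)) := by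
    intro i j hij
    rcases hij.lt_or_eq with hij | hij
    · exact Or.inr (h.side hij).2
    · exact Or.inl (h.inj hij)
  constructor
  · by_contra! hle
    have a1 := e1 _ _ hle
    have a2 := e1 _ _ (hv.le.trans hle)
    have a3 := e1 _ _ (hle.trans hu.le)
    have a4 := e1 _ _ ((hv.le.trans hle).trans hu.le)
    simp only [Fin.ext_iff, Fin.lt_def] at a1 a2 a3 a4
    rcases lo_hi rk u with ⟨p1, p2⟩ | ⟨p1, p2⟩ <;> rcases lo_hi rk v with ⟨q1, q2⟩ | ⟨q1, q2⟩ <;>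
      rw [p1] at a1 a2 <;> rw [p2] at a3 a4 <;> rw [q1] at a2 a4 <;> rw [q2] at a1 a3 <;> omega
  · by_contra! hle
    have a1 := e1 _ _ hle
    have a2 := e1 _ _ (hu.le.trans hle)
    have a3 := e1 _ _ (hle.trans hv.le)
    have a4 := e1 _ _ ((hu.le.trans hle).trans hv.le)
    simp only [Fin.ext_iff, Fin.lt_def] at a1 a2 a3 a4
    rcases lo_hi rk u with ⟨p1, p2⟩ | ⟨p1, p2⟩ <;> rcases lo_hi rk v with ⟨q1, q2⟩ | ⟨q1, q2⟩ <;>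
      rw [p1] at a2 a4 <;> rw [p2] at a1 a3 <;> rw [q1] at a1 a2 <;> rw [q2] at a3 a4 <;> omega

/-- The rank determines which of two chords with given ends of smaller rank is closed first. -/
theorem cross_or_cross (h : IsTent rk r) {u₁ u₂ w₁ w₂ : ScrollVertex c}
    (hne : lo rk u₁ ≠ lo rk u₂) (hu : hi rk u₁ = hi rk u₂) (hw₁ : lo rk w₁ = lo rk u₁)
    (hw₂ : lo rk w₂ = lo rk u₂) (hlt₁ : rk (hi rk u₁) < rk (hi rk w₁))
    (hlt₂ : rk (hi rk u₁) < rk (hi rk w₂)) :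
    (u₁.Cross w₂ ∨ w₂.Cross u₁) ∨ (u₂.Cross w₁ ∨ w₁.Cross u₂) := by
  have b1 := rk_lo_lt_rk_hi h.inj u₁
  have b2 := rk_lo_lt_rk_hi h.inj u₂
  rw [← hu] at b2
  rw [eq_pair rk u₁, eq_pair rk u₂, eq_pair rk w₁, eq_pair rk w₂]
  simp only [Cross, left_pair, right_pair, hw₁, hw₂, ← hu]
  generalize lo rk u₁ = α₁ at *
  generalize lo rk u₂ = α₂ at *
  generalize hi rk u₁ = β at *
  generalize hi rk w₁ = β₁ at *
  generalize hi rk w₂ = β₂ at *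
  -- The columns of rank above that of `β` form an interval containing `β₁` and `β₂`, and `β` is
  -- cyclically adjacent to it. Moving on from `β` away from the interval, one of `α₁`, `α₂` is met
  -- first. The chord from that one into the interval crosses the chord from `β` to the other.
  have s1 := h.side b1
  have s2 := h.side b2
  have s3 := h.side hlt₁
  have s4 := h.side hlt₂
  have s5 := h.side (b1.trans hlt₁)
  have s6 := h.side (b1.trans hlt₂)
  have s7 := h.side (b2.trans hlt₁)
  have s8 := h.side (b2.trans hlt₂)
  clear b1 b2 hlt₁ hlt₂ hw₁ hw₂ hu
  have dich : ∀ x y : Fin c, (x ≠ y ∧ (y < x → r ≤ (x : ℕ)) ∧ (x < y → (x : ℕ) < r)) →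
      ((x : ℕ) < r → x < y) ∧ (r ≤ (x : ℕ) → y < x) := by
    intro x y ⟨h1, h2, h3⟩
    refine ⟨fun h => ?_, fun h => ?_⟩
    · by_contra! hle
      have := h2 (lt_of_le_of_ne hle h1.symm)
      omega
    · by_contra! hle
      have := h3 (lt_of_le_of_ne hle h1)
      omega
  replace s1 := dich _ _ s1
  replace s2 := dich _ _ s2
  replace s3 := dich _ _ s3
  replace s4 := dich _ _ s4
  replace s5 := dich _ _ s5
  replace s6 := dich _ _ s6
  replace s7 := dich _ _ s7
  replace s8 := dich _ _ s8
  rcases lt_or_ge (α₁ : ℕ) r with l1 | l1 <;> rcases lt_or_ge (α₂ : ℕ) r with l2 | l2 <;>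
    rcases lt_or_ge (β : ℕ) r with l3 | l3 <;>
    simp only [l1, l2, l3, not_lt_of_ge, not_le_of_gt, forall_true_left, false_imp_iff, and_true,
      true_and] at s1 s2 s3 s4 s5 s6 s7 s8 <;>
    simp only [Fin.lt_def, ne_eq, Fin.ext_iff, Fin.coe_min, Fin.coe_max] at * <;>
    clear dich <;> omega

end IsTent

/-! ### Uncrossing and the chord weight -/

namespace ScrollVertex

variable {c r : ℕ} {rk : Fin c → ℕ}

/-- Here `p`, `q`, `s` are the gaps between the four ends of two crossing chords. With `c = p + q +
s + t + 1` the two differences are exactly `2q(t + 1)` and `2ps`. -/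
theorem weight_swap_aux {p q s c : ℕ} (hq : 0 < q) (hp : 0 < p) (hs : 0 < s)
    (ht : p + q + s < c) :
    p * (c - p) + s * (c - s) < (p + q) * (c - (p + q)) + (q + s) * (c - (q + s)) ∧
    (p + q + s) * (c - (p + q + s)) + q * (c - q) <
      (p + q) * (c - (p + q)) + (q + s) * (c - (q + s)) := by
  obtain ⟨t, rfl⟩ := Nat.exists_eq_add_of_lt ht
  have e1 : p + q + s + t + 1 - p = q + s + t + 1 := by omega
  have e2 : p + q + s + t + 1 - s = p + q + t + 1 := by omega
  have e3 : p + q + s + t + 1 - (p + q) = s + t + 1 := by omega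
  have e4 : p + q + s + t + 1 - (q + s) = p + t + 1 := by omega
  have e5 : p + q + s + t + 1 - (p + q + s) = t + 1 := by omega
  have e6 : p + q + s + t + 1 - q = p + s + t + 1 := by omega
  rw [e1, e2, e3, e4, e5, e6]
  have h1 : 0 < q * t + q := by positivity
  have h2 : 0 < p * s := by positivity
  constructor <;> nlinarith

/-- Uncrossing two chords lowers the weight. -/
theorem weight_lt_of_cross {u v : ScrollVertex c} (h : u.Cross v)
    {u' v' : ScrollVertex c}
    (h' : (u'.left = u.left ∧ u'.right = v.left ∧ v'.left = u.right ∧ v'.right = v.right) ∨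
      (u'.left = u.left ∧ u'.right = v.right ∧ v'.left = v.left ∧ v'.right = u.right)) :
    weight u' + weight v' < weight u + weight v := by
  obtain ⟨h1, h2, h3⟩ := h
  have hc := v.right.2
  rw [Fin.lt_def] at h1 h2 h3
  obtain ⟨a, b⟩ := weight_swap_aux (p := v.left - u.left) (q := u.right - v.left)
    (s := v.right - u.right) (c := c) (by omega) (by omega) (by omega) (by omega)
  have e1 : (v.left : ℕ) - u.left + (u.right - v.left) = u.right - u.left := by omega
  have e2 : (u.right : ℕ) - v.left + (v.right - u.right) = v.right - v.left := by omega
  have e3 : (u.right : ℕ) - u.left + (v.right - u.right) = v.right - u.left := by omega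
  rw [e1, e2] at a b
  rw [e3] at b
  unfold weight
  rcases h' with ⟨p1, p2, p3, p4⟩ | ⟨p1, p2, p3, p4⟩ <;> rw [p1, p2, p3, p4]
  · exact a
  · exact b

/-- Crossing chords can be uncrossed keeping the ends of smaller and of larger rank. -/
theorem exists_swap (h : IsTent rk r) {u v : ScrollVertex c} (huv : u.Cross v) :
    ∃ u' v' : ScrollVertex c, lo rk u' = lo rk u ∧ hi rk u' = hi rk v ∧ lo rk v' = lo rk v ∧
      hi rk v' = hi rk u ∧ weight u' + weight v' < weight u + weight v := by
  obtain ⟨h1, h2⟩ := h.lo_lt_hi_of_cross huv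
  have n1 : lo rk u ≠ hi rk v := fun e => by simp [e] at h1
  have n2 : lo rk v ≠ hi rk u := fun e => by simp [e] at h2
  refine ⟨pair _ _ n1, pair _ _ n2, lo_pair _ h1, hi_pair _ h1, lo_pair _ h2, hi_pair _ h2, ?_⟩
  have hc := huv
  obtain ⟨c1, c2, c3⟩ := huv
  rcases lo_hi rk u with ⟨p1, p2⟩ | ⟨p1, p2⟩ <;> rcases lo_hi rk v with ⟨q1, q2⟩ | ⟨q1, q2⟩
  · refine weight_lt_of_cross hc (Or.inr ?_)
    simp [p1, p2, q1, q2, (c1.trans (c2.trans c3)).le, c2.le]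
  · refine weight_lt_of_cross hc (Or.inl ?_)
    simp [p1, p2, q1, q2, c1.le, c3.le]
  · rw [add_comm]
    refine weight_lt_of_cross hc (Or.inl ?_)
    simp [p1, p2, q1, q2, c1.le, c3.le]
  · rw [add_comm]
    refine weight_lt_of_cross hc (Or.inr ?_)
    simp [p1, p2, q1, q2, (c1.trans (c2.trans c3)).le, c2.le]

end ScrollVertex

/-! ### Columns with shifts -/

/-- Two injections of `c` columns into a set of variables (the upper and the lower entry of each
column), such that the lower entry of each of the first `m` columns is the upper entry of a later
column. -/
structure ShiftedColumns (c m : ℕ) (X : Type*) where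
  top : Fin c → X
  bot : Fin c → X
  next : Fin c → Fin c
  top_injective : Function.Injective top
  bot_injective : Function.Injective bot
  top_eq_bot : ∀ γ δ, top γ = bot δ ↔ (δ : ℕ) < m ∧ next δ = γ
  lt_next : ∀ δ : Fin c, (δ : ℕ) < m → δ < next δ
  exists_eq : ∀ x, (∃ γ, top γ = x) ∨ ∃ γ, bot γ = x
  -- This makes the columns in `Far a` consecutive, and it places `next a` beside them.
  ordConnected : ∀ a γ₁ γ₂ ψ : Fin c, a ≤ γ₁ → (γ₁ : ℕ) < m → a ≤ γ₂ → (γ₂ : ℕ) < m →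
    next γ₁ ≤ ψ → ψ ≤ next γ₂ → ∃ γ, a ≤ γ ∧ (γ : ℕ) < m ∧ next γ = ψ

namespace ShiftedColumns

open ScrollVertex

variable {c m : ℕ} {X : Type*} (D : ShiftedColumns c m X)

/-- The columns that are the shift of a column to the right of `a`. -/
def Far (a γ : Fin c) : Prop := ∃ δ, a < δ ∧ (δ : ℕ) < m ∧ D.next δ = γ

theorem next_injOn {δ δ' : Fin c} (h : (δ : ℕ) < m) (h' : (δ' : ℕ) < m)
    (he : D.next δ = D.next δ') : δ = δ' :=
  D.bot_injective (((D.top_eq_bot _ _).2 ⟨h, rfl⟩).symm.trans ((D.top_eq_bot _ _).2 ⟨h', he.symm⟩))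

theorem not_far_next {a δ : Fin c} (ha : (a : ℕ) < m) (h : δ ≤ a) : ¬ D.Far a (D.next δ) := by
  rintro ⟨γ, h1, h2, h3⟩
  have := D.next_injOn h2 (lt_of_le_of_lt h ha) h3
  exact absurd h (not_le.2 (this ▸ h1))

theorem lt_of_far {a γ : Fin c} (h : D.Far a γ) : a < γ := by
  obtain ⟨δ, h1, h2, rfl⟩ := h
  exact h1.trans (D.lt_next δ h2)

theorem Far.anti {a b γ : Fin c} (hab : a ≤ b) (h : D.Far b γ) : D.Far a γ := by
  obtain ⟨δ, h1, h2, h3⟩ := h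
  exact ⟨δ, lt_of_le_of_lt hab h1, h2, h3⟩

/-- The columns split into those left of `a`, the shifts of those right of `a`, and the rest. A
rank function for this splitting puts the first kind first and the second kind last. -/
structure IsRank (a : Fin c) (rk : Fin c → ℕ) (r : ℕ) : Prop extends IsTent rk r where
  near_lt : ∀ γ δ, γ < a → ¬ δ < a → rk γ < rk δ
  lt_far : ∀ γ δ, ¬ D.Far a γ → D.Far a δ → rk γ < rk δ
  -- Consequently a chord whose lower-ranked end is `next a` has its other end in `Far a`, and
  -- tie-breaking never needs a positive weight on `top (next a)`.
  lt_next : ∀ γ, ¬ D.Far a γ → γ ≠ D.next a → rk γ < rk (D.next a)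

/-- By `ordConnected` the shifts from `a + 1` on form an interval, and so do those from `a` on. The
second set has just the additional element `next a`, which therefore lies at one of its two ends. -/
theorem exists_far_interval {a : Fin c} (ha : (a : ℕ) + 2 ≤ m) (hm : m ≤ c) :
    ∃ l r : ℕ, l < r ∧ r ≤ c ∧ (a : ℕ) < l ∧ (∀ γ, D.Far a γ ↔ l ≤ (γ : ℕ) ∧ (γ : ℕ) < r) ∧
      (((D.next a : ℕ) + 1 = l ∧ a < D.next a) ∨ (D.next a : ℕ) = r) := by
  classical
  have ham : (a : ℕ) < m := by omega
  set F := Finset.univ.filter (D.Far a) with hF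
  have hmem : ∀ {γ}, γ ∈ F ↔ D.Far a γ := by simp [hF]
  have hne : F.Nonempty := ⟨D.next ⟨a + 1, by omega⟩, hmem.2 ⟨⟨a + 1, by omega⟩,
    by simp [Fin.lt_def], by simpa using (show (a : ℕ) + 1 < m by omega), rfl⟩⟩
  obtain ⟨γ₁, h11, h12, h13⟩ := hmem.1 (F.min'_mem hne)
  obtain ⟨γ₂, h21, h22, h23⟩ := hmem.1 (F.max'_mem hne)
  have hiff : ∀ γ, D.Far a γ ↔ F.min' hne ≤ γ ∧ γ ≤ F.max' hne := by
    intro γ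
    refine ⟨fun h => ⟨F.min'_le _ (hmem.2 h), F.le_max' _ (hmem.2 h)⟩, fun ⟨h1, h2⟩ => ?_⟩
    obtain ⟨δ, hd1, hd2, hd3⟩ := D.ordConnected ⟨a + 1, by omega⟩ γ₁ γ₂ γ
      (by rw [Fin.le_def]; exact h11) h12 (by rw [Fin.le_def]; exact h21) h22 (h13 ▸ h1) (h23 ▸ h2)
    exact ⟨δ, by rw [Fin.le_def] at hd1; rw [Fin.lt_def]; exact hd1, hd2, hd3⟩
  have hwide : ∀ γ₁ γ₂ ψ : Fin c, a ≤ γ₁ → (γ₁ : ℕ) < m → a ≤ γ₂ → (γ₂ : ℕ) < m →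
      D.next γ₁ ≤ ψ → ψ ≤ D.next γ₂ → ψ = D.next a ∨ D.Far a ψ := by
    intro γ₁ γ₂ ψ h1 h2 h3 h4 h5 h6
    obtain ⟨δ, hd1, hd2, hd3⟩ := D.ordConnected a γ₁ γ₂ ψ h1 h2 h3 h4 h5 h6
    rcases hd1.eq_or_lt with rfl | h
    · exact Or.inl hd3.symm
    · exact Or.inr ⟨δ, h, hd2, hd3⟩
  have hna := D.not_far_next ham le_rfl
  have hnext := D.lt_next a ham
  have hmin := D.lt_of_far (hmem.1 (F.min'_mem hne))
  have hmm : F.min' hne ≤ F.max' hne := F.min'_le _ (F.max'_mem hne)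
  have hmaxc := (F.max' hne).2
  refine ⟨F.min' hne, F.max' hne + 1, by rw [Fin.le_def] at hmm; omega, by omega, hmin,
    fun γ => by rw [hiff, Fin.le_def, Fin.le_def]; omega, ?_⟩
  rcases lt_or_ge (D.next a) (F.min' hne) with h | h
  · left
    refine ⟨?_, hnext⟩
    by_contra hgap
    have hminc := (F.min' hne).2
    rw [Fin.lt_def] at h
    rcases hwide a γ₁ ⟨F.min' hne - 1, by omega⟩ le_rfl ham h11.le h12
      (by rw [Fin.le_def]; simp only; omega)
      (by rw [h13, Fin.le_def]; simp only; omega) with h' | h'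
    · have := congrArg Fin.val h'
      simp only at this
      omega
    · have := (hiff _).1 h'
      rw [Fin.le_def] at this
      simp only at this
      omega
  · right
    have h2 : ¬ D.next a ≤ F.max' hne := fun h2 => hna ((hiff _).2 ⟨h, h2⟩)
    rw [Fin.le_def] at h2
    have hac := (D.next a).2
    by_contra hgap
    rcases hwide γ₂ a ⟨F.max' hne + 1, by omega⟩ h21.le h22 le_rfl ham
      (by rw [h23, Fin.le_def]; simp only; omega)
      (by rw [Fin.le_def]; simp only; omega) with h' | h'
    · have := congrArg Fin.val h'
      simp only at this
      omega
    · have := (hiff _).1 h'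
      rw [Fin.le_def, Fin.le_def] at this
      simp only at this
      omega

theorem exists_isRank {a : Fin c} (ha : (a : ℕ) + 2 ≤ m) (hm : m ≤ c) :
    ∃ rk r, D.IsRank a rk r := by
  obtain ⟨l, r, hlr, hrc, hal, hfar, hadj⟩ := D.exists_far_interval ha hm
  -- Columns left of `a` get values below `c`, far columns values from `4 * c` on. Of the remaining
  -- columns, those on the side of the far interval that contains `next a` get the larger values.
  -- Values rise to the left of the far interval and fall to its right, so that `next a`, being
  -- adjacent to it, gets the largest of them.
  set rk : Fin c → ℕ := fun γ => if γ < a then (γ : ℕ) else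
    if l ≤ (γ : ℕ) ∧ (γ : ℕ) < r then 4 * c + γ else
    if (γ : ℕ) < l then (if (D.next a : ℕ) < l then 2 * c + 1 + γ else c + γ) else
      (if (D.next a : ℕ) < l then 2 * c - γ else 3 * c + 1 - γ) with hrk
  have hac := a.2
  refine ⟨rk, r, ⟨fun i j h => ?_, fun i j hij hj => ?_, fun i j hi hij => ?_⟩,
    fun γ δ hγ hδ => ?_, fun γ δ hγ hδ => ?_, fun γ hγ hne => ?_⟩
  · simp only [hrk, Fin.lt_def] at h
    rw [Fin.ext_iff]
    split_ifs at h <;> omega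
  · simp only [hrk, Fin.lt_def] at hij ⊢
    split_ifs <;> omega
  · simp only [hrk, Fin.lt_def] at hij ⊢
    split_ifs <;> omega
  · simp only [hrk, Fin.lt_def] at hγ hδ ⊢
    split_ifs <;> omega
  · rw [hfar] at hγ hδ
    simp only [hrk, Fin.lt_def]
    split_ifs <;> omega
  · rw [hfar] at hγ
    rw [ne_eq, Fin.ext_iff] at hne
    simp only [hrk, Fin.lt_def] at hadj ⊢
    split_ifs <;> omega

/-- The chords that lie neither left of `a` nor among the shifts of the columns right of `a`. -/
def Allowed (a : Fin c) (v : ScrollVertex c) : Prop :=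
  ¬ (v.left < a ∧ v.right < a) ∧ ¬ (D.Far a v.left ∧ D.Far a v.right)

/-- The sets of pairwise noncrossing allowed chords. -/
def Face (a : Fin c) (F : Finset (ScrollVertex c)) : Prop :=
  ∀ v ∈ F, D.Allowed a v ∧ ∀ u ∈ F, ¬ u.Cross v

variable {D} {a : Fin c} {rk : Fin c → ℕ} {r : ℕ}

/-- Columns left of `a` have the smallest ranks and far columns the largest, so one end decides each
condition. Allowedness thus constrains the two ends independently and survives uncrossing. -/
theorem IsRank.allowed_iff (h : D.IsRank a rk r) {v : ScrollVertex c} :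
    D.Allowed a v ↔ ¬ hi rk v < a ∧ ¬ D.Far a (lo rk v) := by
  have hv := rk_lo_lt_rk_hi h.inj v
  have h1 : hi rk v < a ↔ v.left < a ∧ v.right < a := by
    have : hi rk v < a → lo rk v < a := fun h1 => by
      by_contra h2
      have := h.near_lt _ _ h1 h2
      omega
    rcases lo_hi rk v with ⟨p, q⟩ | ⟨p, q⟩ <;> rw [p, q] at this <;> rw [q] <;> tauto
  have h2 : D.Far a (lo rk v) ↔ D.Far a v.left ∧ D.Far a v.right := by
    have : D.Far a (lo rk v) → D.Far a (hi rk v) := fun h1 => by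
      by_contra h2
      have := h.lt_far _ _ h2 h1
      omega
    rcases lo_hi rk v with ⟨p, q⟩ | ⟨p, q⟩ <;> rw [p, q] at this <;> rw [p] <;> tauto
  rw [Allowed, h1, h2]

theorem Face.mono {F G : Finset (ScrollVertex c)} (hG : D.Face a G) (h : F ⊆ G) : D.Face a F :=
  fun v hv => ⟨(hG v (h hv)).1, fun u hu => (hG v (h hv)).2 u (h hu)⟩

theorem face_singleton {v : ScrollVertex c} : D.Face a {v} ↔ D.Allowed a v := by
  simp [Face, Cross]

/-- Noncrossing sets of chords are determined by the ends of smaller and of larger rank. -/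
theorem _root_.IsTent.eq_of_degrees (h : IsTent rk r) {e f : ScrollVertex c → ℚ} (he : 0 ≤ e)
    (hf : 0 ≤ f) (hce : ∀ u ∈ nzSupport e, ∀ v ∈ nzSupport e, ¬ u.Cross v)
    (hcf : ∀ u ∈ nzSupport f, ∀ v ∈ nzSupport f, ¬ u.Cross v)
    (hlo : ∀ γ, ∑ v, (e v - f v) * (if lo rk v = γ then 1 else 0) = 0)
    (hhi : ∀ γ, ∑ v, (e v - f v) * (if hi rk v = γ then 1 else 0) = 0) : e = f := by
  classical
  simp only [mul_ite, mul_one, mul_zero, ← Finset.sum_filter] at hlo hhi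
  by_contra hne
  set S := Finset.univ.filter fun v => e v ≠ f v with hS
  have hSmem : ∀ {v}, v ∈ S ↔ e v ≠ f v := by simp [hS]
  have hSne : S.Nonempty := by
    obtain ⟨v, hv⟩ := Function.ne_iff.1 hne
    exact ⟨v, hSmem.2 hv⟩
  obtain ⟨v₀, hv₀, hmin⟩ := S.exists_min_image (fun v => rk (hi rk v)) hSne
  -- Where a difference with zero sum is not identically zero, it takes both signs. At the end `hi
  -- rk v₀` of least rank this gives `u₁` with `f < e` and `u₂` with `e < f`; their other ends give
  -- `w₁` and `w₂` with the opposite signs, which end at larger rank. One of the pairs `u₁, w₂` in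
  -- the support of `e` and `u₂, w₁` in the support of `f` must cross.
  have hpick : ∀ (s : Finset (ScrollVertex c)), ∑ v ∈ s, (e v - f v) = 0 →
      (∃ v ∈ s, e v ≠ f v) → (∃ v ∈ s, f v < e v) ∧ ∃ v ∈ s, e v < f v := by
    intro s hs ⟨w, hw, hwne⟩
    constructor
    · by_contra! hle
      have := (Finset.sum_eq_zero_iff_of_nonpos fun v hv => sub_nonpos.2 (hle v hv)).1 hs w hw
      exact hwne (sub_eq_zero.1 this)
    · by_contra! hle
      have := (Finset.sum_eq_zero_iff_of_nonneg fun v hv => sub_nonneg.2 (hle v hv)).1 hs w hw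
      exact hwne (sub_eq_zero.1 this)
  obtain ⟨⟨u₁, hu₁, hlt₁⟩, u₂, hu₂, hlt₂⟩ := hpick _ (hhi (hi rk v₀))
    ⟨v₀, by simp, hSmem.1 hv₀⟩
  simp only [Finset.mem_filter, Finset.mem_univ, true_and] at hu₁ hu₂
  obtain ⟨-, w₁, hw₁, hltw₁⟩ := hpick _ (hlo (lo rk u₁)) ⟨u₁, by simp, hlt₁.ne'⟩
  obtain ⟨⟨w₂, hw₂, hltw₂⟩, -⟩ := hpick _ (hlo (lo rk u₂)) ⟨u₂, by simp, hlt₂.ne⟩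
  simp only [Finset.mem_filter, Finset.mem_univ, true_and] at hw₁ hw₂
  have hlast : ∀ u w : ScrollVertex c, lo rk w = lo rk u → hi rk u = hi rk v₀ → u ≠ w →
      w ∈ S → rk (hi rk u) < rk (hi rk w) := by
    intro u w h1 h2 h3 h4
    refine lt_of_le_of_ne (h2 ▸ hmin w h4) fun h5 => h3 (eq_of_lo_hi h1.symm (h.inj h5))
  have hne12 : lo rk u₁ ≠ lo rk u₂ := by
    intro h'
    have := eq_of_lo_hi h' (hu₁.trans hu₂.symm)
    rw [this] at hlt₁
    exact lt_asymm hlt₁ hlt₂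
  have m1 : u₁ ∈ nzSupport e := mem_nzSupport.2 ((hf u₁).trans_lt hlt₁).ne'
  have m2 : u₂ ∈ nzSupport f := mem_nzSupport.2 ((he u₂).trans_lt hlt₂).ne'
  have m3 : w₁ ∈ nzSupport f := mem_nzSupport.2 ((he w₁).trans_lt hltw₁).ne'
  have m4 : w₂ ∈ nzSupport e := mem_nzSupport.2 ((hf w₂).trans_lt hltw₂).ne'
  rcases h.cross_or_cross hne12 (hu₁.trans hu₂.symm) hw₁ hw₂
    (hlast u₁ w₁ hw₁ hu₁ (fun e => by rw [e] at hlt₁; exact lt_asymm hlt₁ hltw₁) (hSmem.2 hltw₁.ne))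
    (by
      have := hlast u₂ w₂ hw₂ hu₂ (fun e => by rw [e] at hlt₂; exact lt_asymm hlt₂ hltw₂)
        (hSmem.2 hltw₂.ne')
      rwa [hu₂, ← hu₁] at this) with (h1 | h1) | (h1 | h1)
  · exact hce _ m1 _ m4 h1
  · exact hce _ m4 _ m1 h1
  · exact hcf _ m2 _ m3 h1
  · exact hcf _ m3 _ m2 h1

end ShiftedColumns

/-! ### The vector configuration of the allowed chords and its regular triangulation -/

namespace ShiftedColumns

open ScrollVertex

variable {c m : ℕ} {X : Type*} [DecidableEq X] (D : ShiftedColumns c m X)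

/-- The exponent vector of the product of the upper entry of the column of smaller rank and the
lower entry of the column of larger rank. -/
def vec (rk : Fin c → ℕ) (v : ScrollVertex c) : X → ℚ :=
  Pi.single (D.top (lo rk v)) 1 + Pi.single (D.bot (hi rk v)) 1

variable {D} {a : Fin c} {rk : Fin c → ℕ} {r : ℕ}

theorem comb_vec_apply (e : ScrollVertex c → ℚ) (x : X) :
    Fintype.linearCombination ℚ (D.vec rk) e x =
      (∑ v, e v * (if D.top (lo rk v) = x then 1 else 0)) +
        ∑ v, e v * (if D.bot (hi rk v) = x then 1 else 0) := by
  rw [Fintype.linearCombination_apply, Finset.sum_apply, ← Finset.sum_add_distrib]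
  refine Finset.sum_congr rfl fun v _ => ?_
  simp [vec, Pi.single_apply, mul_add, eq_comm]

/-- A shared variable `bot δ = top (next δ)` only shows the sum of the degree of `δ` as higher end
and of `next δ` as lower end. For `δ < a` the former is zero on allowed chords, for `δ > a` the
latter. Only `δ = a` is ambiguous. There the differences of the two degrees add up to zero, but both
equal the difference of the numbers of chords, so they vanish and `IsTent.eq_of_degrees` applies. -/
theorem IsRank.eq_of_comb_eq (h : D.IsRank a rk r) (ha : (a : ℕ) < m) {e f : ScrollVertex c → ℚ}
    (he : 0 ≤ e) (hf : 0 ≤ f) (hce : D.Face a (nzSupport e)) (hcf : D.Face a (nzSupport f))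
    (heq : Fintype.linearCombination ℚ (D.vec rk) e = Fintype.linearCombination ℚ (D.vec rk) f) :
    e = f := by
  set d : ScrollVertex c → ℚ := fun v => e v - f v with hd
  have hd0 : ∀ v, d v ≠ 0 → ¬ hi rk v < a ∧ ¬ D.Far a (lo rk v) := by
    intro v hv
    rw [← h.allowed_iff]
    by_cases h1 : e v = 0
    · have h2 : f v ≠ 0 := fun h2 => hv (by simp [hd, h1, h2])
      exact (hcf v (mem_nzSupport.2 h2)).1
    · exact (hce v (mem_nzSupport.2 h1)).1
  set L : Fin c → ℚ := fun γ => ∑ v, d v * (if lo rk v = γ then 1 else 0) with hL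
  set R : Fin c → ℚ := fun γ => ∑ v, d v * (if hi rk v = γ then 1 else 0) with hR
  have hRnear : ∀ γ, γ < a → R γ = 0 := by
    intro γ hγ
    refine Finset.sum_eq_zero fun v _ => ?_
    split_ifs with h1
    · rw [mul_one]
      by_contra h2
      exact (hd0 v h2).1 (h1 ▸ hγ)
    · exact mul_zero _
  have hLfar : ∀ γ, D.Far a γ → L γ = 0 := by
    intro γ hγ
    refine Finset.sum_eq_zero fun v _ => ?_
    split_ifs with h1
    · rw [mul_one]
      by_contra h2
      exact (hd0 v h2).2 (h1 ▸ hγ)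
    · exact mul_zero _
  have hcomb : ∀ x, (∑ v, d v * (if D.top (lo rk v) = x then 1 else 0)) +
        ∑ v, d v * (if D.bot (hi rk v) = x then 1 else 0) = 0 := by
    intro x
    have := congrFun heq x
    rw [comb_vec_apply, comb_vec_apply] at this
    simp only [hd, sub_mul, Finset.sum_sub_distrib]
    linarith
  have htop : ∀ γ, (∀ δ, D.top γ ≠ D.bot δ) → L γ = 0 := by
    intro γ hγ
    have := hcomb (D.top γ)
    simp only [D.top_injective.eq_iff, fun δ => (hγ δ).symm, if_false, mul_zero,
      Finset.sum_const_zero, add_zero] at this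
    exact this
  have hbot : ∀ δ, (∀ γ, D.top γ ≠ D.bot δ) → R δ = 0 := by
    intro δ hδ
    have := hcomb (D.bot δ)
    simp only [D.bot_injective.eq_iff, hδ, if_false, mul_zero,
      Finset.sum_const_zero, zero_add] at this
    exact this
  have hboth : ∀ γ δ, D.top γ = D.bot δ → L γ + R δ = 0 := by
    intro γ δ hγ
    have := hcomb (D.top γ)
    rw [hγ] at this
    simp only [D.bot_injective.eq_iff] at this
    rw [← hγ] at this
    simp only [D.top_injective.eq_iff] at this
    exact this
  have hL0 : ∀ γ, γ ≠ D.next a → L γ = 0 := by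
    intro γ hγ
    by_cases hex : ∃ δ, D.top γ = D.bot δ
    · obtain ⟨δ, hδ⟩ := hex
      obtain ⟨h1, rfl⟩ := (D.top_eq_bot _ _).1 hδ
      rcases lt_trichotomy δ a with h2 | h2 | h2
      · have := hboth _ _ hδ
        rwa [hRnear _ h2, add_zero] at this
      · exact absurd (by rw [h2]) hγ
      · exact hLfar _ ⟨δ, h2, h1, rfl⟩
    · push Not at hex
      exact htop γ hex
  have hLsum : ∑ γ, L γ = ∑ v, d v := by
    simp only [hL]
    rw [Finset.sum_comm]
    simp
  have hRsum : ∑ γ, R γ = ∑ v, d v := by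
    simp only [hR]
    rw [Finset.sum_comm]
    simp
  have hR0 : ∀ δ, δ ≠ a → R δ = 0 := by
    intro δ hδ
    by_cases hex : ∃ γ, D.top γ = D.bot δ
    · obtain ⟨γ, hγ⟩ := hex
      obtain ⟨h1, rfl⟩ := (D.top_eq_bot _ _).1 hγ
      have := hboth _ _ hγ
      rwa [hL0 _ fun h2 => hδ (D.next_injOn h1 ha h2), zero_add] at this
    · push Not at hex
      exact hbot δ hex
  rw [Finset.sum_eq_single (D.next a) (fun γ _ hγ => hL0 γ hγ) (by simp)] at hLsum
  rw [Finset.sum_eq_single a (fun γ _ hγ => hR0 γ hγ) (by simp)] at hRsum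
  have hLR := hboth (D.next a) a ((D.top_eq_bot _ _).2 ⟨ha, rfl⟩)
  refine h.eq_of_degrees he hf (fun u hu v hv => (hce v hv).2 u hu)
    (fun u hu v hv => (hcf v hv).2 u hu) (fun γ => ?_) (fun γ => ?_)
  · change L γ = 0
    by_cases hγ : γ = D.next a
    · rw [hγ]; linarith
    · exact hL0 γ hγ
  · change R γ = 0
    by_cases hγ : γ = a
    · rw [hγ]; linarith
    · exact hR0 γ hγ

/-- Uncrossing turns a combination of allowed chords with natural coefficients into a
noncrossing one. -/
theorem IsRank.exists_noncrossing (h : D.IsRank a rk r) (e : ScrollVertex c → ℕ)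
    (he : ∀ v, e v ≠ 0 → D.Allowed a v) :
    ∃ e' : ScrollVertex c → ℕ, D.Face a (Finset.univ.filter fun v => e' v ≠ 0) ∧
      Fintype.linearCombination ℚ (D.vec rk) (fun v => (e' v : ℚ)) =
        Fintype.linearCombination ℚ (D.vec rk) (fun v => (e v : ℚ)) ∧
      ∑ v, e' v * weight v ≤ ∑ v, e v * weight v ∧
      (¬ D.Face a (Finset.univ.filter fun v => e v ≠ 0) →
        ∑ v, e' v * weight v < ∑ v, e v * weight v) := by
  classical
  -- Each uncrossing recombines lower and higher ends, hence keeps the sum of the vectors and the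
  -- allowedness of the chords, while the total weight drops.
  induction hn : ∑ v, e v * weight v using Nat.strong_induction_on generalizing e with
  | _ n ih =>
    by_cases hface : D.Face a (Finset.univ.filter fun v => e v ≠ 0)
    · exact ⟨e, hface, rfl, hn.le, fun h => absurd hface h⟩
    have hcr : ∃ u v, e u ≠ 0 ∧ e v ≠ 0 ∧ u.Cross v := by
      by_contra! hcon
      refine hface fun v hv => ⟨he v (by simpa using hv), fun u hu => hcon u v (by simpa using hu)
        (by simpa using hv)⟩
    obtain ⟨u, v, hu, hv, huv⟩ := hcr
    obtain ⟨u', v', h1, h2, h3, h4, h5⟩ := exists_swap h.toIsTent huv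
    have hne : u ≠ v := fun h => absurd huv.1 (by rw [h]; exact lt_irrefl _)
    set s : ScrollVertex c → ℕ := fun w => e w - (Pi.single u 1 + Pi.single v 1 :
      ScrollVertex c → ℕ) w with hs
    have hes : e = s + (Pi.single u 1 + Pi.single v 1) := by
      funext w
      simp only [hs, Pi.add_apply, Pi.single_apply]
      by_cases hwu : w = u
      · subst hwu; simp [hne]; omega
      · by_cases hwv : w = v
        · subst hwv; simp [hwu]; omega
        · simp [hwu, hwv]
    set e₁ : ScrollVertex c → ℕ := s + (Pi.single u' 1 + Pi.single v' 1) with he₁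
    have hw : ∀ (f : ScrollVertex c → ℕ) (p q : ScrollVertex c), ∑ w, (f + (Pi.single p 1 + Pi.single q 1) : ScrollVertex c → ℕ) w *
        weight w = ∑ w, f w * weight w + (weight p + weight q) := by
      intro f p q
      simp [add_mul, Finset.sum_add_distrib, Pi.single_apply]
    have hlt : ∑ w, e₁ w * weight w < n := by
      rw [← hn, he₁, hw]
      conv_rhs => rw [hes, hw]
      omega
    have hA : ∀ (f : ScrollVertex c → ℕ) (p q : ScrollVertex c), Fintype.linearCombination ℚ (D.vec rk)
        (fun w => ((f + (Pi.single p 1 + Pi.single q 1) : ScrollVertex c → ℕ) w : ℚ)) =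
        Fintype.linearCombination ℚ (D.vec rk) (fun w => (f w : ℚ)) +
          (D.vec rk p + D.vec rk q) := by
      intro f p q
      have : (fun w => ((f + (Pi.single p 1 + Pi.single q 1) : ScrollVertex c → ℕ) w : ℚ)) =
          (fun w => (f w : ℚ)) + (Pi.single p 1 + Pi.single q 1) := by
        funext w
        simp [Pi.single_apply]
      rw [this, map_add, map_add, IsRegularTriangulation.comb_single,
        IsRegularTriangulation.comb_single, one_smul, one_smul]
    have hau := h.allowed_iff.1 (he u hu)
    have hav := h.allowed_iff.1 (he v hv)
    have hall : ∀ w, e₁ w ≠ 0 → D.Allowed a w := by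
      intro w hw
      by_cases h6 : w = u'
      · rw [h6, h.allowed_iff, h1, h2]; exact ⟨hav.1, hau.2⟩
      by_cases h7 : w = v'
      · rw [h7, h.allowed_iff, h3, h4]; exact ⟨hau.1, hav.2⟩
      · apply he
        simp only [he₁, hs, Pi.add_apply, Pi.single_apply, h6, h7, if_false, add_zero] at hw
        omega
    obtain ⟨e', he', hA', hle', -⟩ := ih _ hlt e₁ hall rfl
    refine ⟨e', he', ?_, (hle'.trans_lt hlt).le, fun _ => hle'.trans_lt hlt⟩
    rw [hA', he₁, hA]
    conv_rhs => rw [hes, hA]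
    congr 1
    simp only [vec, h1, h2, h3, h4]
    abel

theorem _root_.exists_nat_mul_eq {V : Type*} [Fintype V] (e : V → ℚ) (he : 0 ≤ e) :
    ∃ N : ℕ, 0 < N ∧ ∃ n : V → ℕ, ∀ v, (N : ℚ) * e v = n v := by
  classical
  refine ⟨∏ v, (e v).den, Finset.prod_pos fun v _ => (e v).den_pos,
    fun v => (∏ w ∈ Finset.univ.erase v, (e w).den) * (e v).num.toNat, fun v => ?_⟩
  rw [← Finset.mul_prod_erase _ _ (Finset.mem_univ v)]
  have h1 : (((e v).num.toNat : ℕ) : ℚ) = (e v).num := by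
    have : (((e v).num.toNat : ℕ) : ℤ) = (e v).num :=
      Int.toNat_of_nonneg (Rat.num_nonneg.2 (he v))
    exact_mod_cast congrArg (fun z : ℤ => (z : ℚ)) this
  push_cast
  rw [h1]
  have h2 : ((e v).den : ℚ) * e v = (e v).num := Rat.den_mul_eq_num _
  linear_combination (∏ w ∈ Finset.univ.erase v, ((e w).den : ℚ)) * h2

theorem IsRank.exists_reduction (h : D.IsRank a rk r) (e : ScrollVertex c → ℚ) (he : 0 ≤ e)
    (hall : ∀ v, e v ≠ 0 → D.Allowed a v) :
    ∃ e' : ScrollVertex c → ℚ, 0 ≤ e' ∧ D.Face a (nzSupport e') ∧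
      Fintype.linearCombination ℚ (D.vec rk) e' = Fintype.linearCombination ℚ (D.vec rk) e ∧
      (¬ D.Face a (nzSupport e) →
        Fintype.linearCombination ℚ (fun v => (weight v : ℚ)) e' <
          Fintype.linearCombination ℚ (fun v => (weight v : ℚ)) e) := by
  obtain ⟨N, hN, n, hn⟩ := exists_nat_mul_eq e he
  have hN0 : (0 : ℚ) < N := by exact_mod_cast hN
  have hen : (fun v => (n v : ℚ)) = (N : ℚ) • e := by
    funext v; rw [← hn]; rfl
  have hsupp : ∀ v, n v ≠ 0 ↔ e v ≠ 0 := by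
    intro v
    have := hn v
    rw [← Nat.cast_ne_zero (R := ℚ), ← this]
    simp [hN0.ne']
  obtain ⟨n', hface, hA, -, hlt⟩ := h.exists_noncrossing n fun v hv => hall v ((hsupp v).1 hv)
  rw [Finset.filter_congr fun v _ => hsupp v] at hlt
  refine ⟨(N : ℚ)⁻¹ • fun v => (n' v : ℚ), fun v => ?_, ?_, ?_, fun hne => ?_⟩
  · simp only [Pi.zero_apply, Pi.smul_apply, smul_eq_mul]; positivity
  · convert hface using 2
    ext v
    simp [mem_nzSupport, hN0.ne']
  · rw [map_smul, hA, hen, map_smul, smul_smul, inv_mul_cancel₀ hN0.ne', one_smul]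
  · have h1 := hlt hne
    have h2 : ∀ k : ScrollVertex c → ℕ, Fintype.linearCombination ℚ (fun v => (weight v : ℚ))
        (fun v => (k v : ℚ)) = ((∑ v, k v * weight v : ℕ) : ℚ) := by
      intro k
      simp [Fintype.linearCombination_apply]
    have h3 : Fintype.linearCombination ℚ (fun v => (weight v : ℚ)) e =
        (N : ℚ)⁻¹ * ((∑ v, n v * weight v : ℕ) : ℚ) := by
      rw [← h2, hen, map_smul, smul_eq_mul, inv_mul_cancel_left₀ hN0.ne']
    rw [map_smul, h2, h3, smul_eq_mul]
    exact mul_lt_mul_of_pos_left (by exact_mod_cast h1) (inv_pos.2 hN0)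

/-- The variables `top 0`, `bot a = top (next a)` and `bot φ` with `φ = next (a + 1)` are joined
pairwise by allowed chords. This odd cycle isolates `top 0`, and all other variables follow. The
bounds on `a` make column 0 lie left of `a` and provide the far column `φ`. -/
theorem IsRank.span_eq_top [Finite X] (h : D.IsRank a rk r) (ha0 : 0 < (a : ℕ))
    (ha : (a : ℕ) + 2 ≤ m) (hm : m ≤ c) :
    Submodule.span ℚ (D.vec rk '' {v | D.Face a {v}}) = ⊤ := by
  set S := Submodule.span ℚ (D.vec rk '' {v | D.Face a {v}}) with hS
  have hmem : ∀ γ δ : Fin c, rk γ < rk δ → ¬ D.Far a γ → ¬ δ < a →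
      (Pi.single (D.top γ) 1 + Pi.single (D.bot δ) 1 : X → ℚ) ∈ S := by
    intro γ δ hγδ hγ hδ
    have hne : γ ≠ δ := fun e => by simp [e] at hγδ
    refine Submodule.subset_span ⟨pair γ δ hne, ?_, ?_⟩
    · rw [Set.mem_ofPred_eq, face_singleton, h.allowed_iff, lo_pair hne hγδ, hi_pair hne hγδ]
      exact ⟨hδ, hγ⟩
    · rw [vec, lo_pair hne hγδ, hi_pair hne hγδ]
  have ham : (a : ℕ) < m := by omega
  set z : Fin c := ⟨0, by omega⟩ with hz
  have hza : z < a := by rw [Fin.lt_def]; exact ha0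
  have hzF : ¬ D.Far a z := fun hf => absurd (D.lt_of_far hf) (not_lt.2 hza.le)
  set b : Fin c := ⟨a + 1, by omega⟩ with hb
  set φ := D.next b with hφ
  have hφF : D.Far a φ := ⟨b, by simp [hb, Fin.lt_def], by simp only [hb]; omega, rfl⟩
  have hφE : ¬ φ < a := not_lt.2 (D.lt_of_far hφF).le
  have hzφ := hmem z φ (h.near_lt _ _ hza hφE) hzF hφE
  have hnF : ¬ D.Far a (D.next a) := D.not_far_next ham le_rfl
  have h1 := hmem z a (h.near_lt _ _ hza (lt_irrefl _)) hzF (lt_irrefl _)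
  have h2 := hmem (D.next a) φ (h.lt_far _ _ hnF hφF) hnF hφE
  rw [(D.top_eq_bot _ _).2 ⟨ham, rfl⟩] at h2
  have htz : (Pi.single (D.top z) 1 : X → ℚ) ∈ S := by
    have : (Pi.single (D.top z) 1 : X → ℚ) = (2 : ℚ)⁻¹ •
        ((Pi.single (D.top z) 1 + Pi.single (D.bot a) 1) +
          (Pi.single (D.top z) 1 + Pi.single (D.bot φ) 1) -
          (Pi.single (D.bot a) 1 + Pi.single (D.bot φ) 1)) := by
      rw [show ∀ x y w : X → ℚ, (x + y) + (x + w) - (y + w) = (2 : ℚ) • x from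
        fun x y w => by rw [two_smul]; abel, smul_smul]
      norm_num
    rw [this]
    exact S.smul_mem _ (S.sub_mem (S.add_mem h1 hzφ) h2)
  have hbφ : (Pi.single (D.bot φ) 1 : X → ℚ) ∈ S := by
    have := S.sub_mem hzφ htz
    rwa [add_sub_cancel_left] at this
  have htop : ∀ γ, ¬ D.Far a γ → (Pi.single (D.top γ) 1 : X → ℚ) ∈ S := by
    intro γ hγ
    have := S.sub_mem (hmem γ φ (h.lt_far _ _ hγ hφF) hγ hφE) hbφ
    rwa [add_sub_cancel_right] at this
  have hbot : ∀ δ, ¬ δ < a → (Pi.single (D.bot δ) 1 : X → ℚ) ∈ S := by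
    intro δ hδ
    have := S.sub_mem (hmem z δ (h.near_lt _ _ hza hδ) hzF hδ) htz
    rwa [add_sub_cancel_left] at this
  have hall : ∀ x, (Pi.single x 1 : X → ℚ) ∈ S := by
    intro x
    rcases D.exists_eq x with ⟨γ, rfl⟩ | ⟨δ, rfl⟩
    · by_cases hγ : D.Far a γ
      · obtain ⟨δ, hd1, hd2, rfl⟩ := hγ
        rw [(D.top_eq_bot _ _).2 ⟨hd2, rfl⟩]
        exact hbot δ (not_lt.2 hd1.le)
      · exact htop γ hγ
    · by_cases hδ : δ < a
      · have hδm : (δ : ℕ) < m := lt_trans hδ ham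
        rw [← (D.top_eq_bot _ _).2 ⟨hδm, rfl⟩]
        exact htop _ (D.not_far_next ham hδ.le)
      · exact hbot δ hδ
  have := Fintype.ofFinite X
  rw [eq_top_iff, ← (Pi.basisFun ℚ X).span_eq, Submodule.span_le]
  rintro _ ⟨x, rfl⟩
  rw [Pi.basisFun_apply]
  exact hall x

theorem IsRank.isRegularTriangulation [Finite X] (h : D.IsRank a rk r) (ha0 : 0 < (a : ℕ))
    (ha : (a : ℕ) + 2 ≤ m) (hm : m ≤ c) :
    IsRegularTriangulation (D.vec rk) (fun v => (weight v : ℚ)) (D.Face a) where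
  empty := fun v hv => absurd hv (Finset.notMem_empty v)
  mono := Face.mono
  reduce e he hall := h.exists_reduction e he fun v hv => face_singleton.1 (hall v hv)
  inj e f he hf hce hcf heq := h.eq_of_comb_eq (by omega) he hf hce hcf heq
  span := h.span_eq_top ha0 ha hm

end ShiftedColumns

theorem exists_enumeration {V : Type*} {s t : Finset V} (hst : s ⊆ t) (ht : t.Nonempty) :
    ∃ (p : ℕ → V) (N : ℕ), (∀ n, p n ∈ t) ∧ (∀ n < N, p n ∈ s) ∧ (∀ v ∈ s, ∃ n < N, p n = v) ∧
      ∀ v ∈ t, ∃ n, p n = v := by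
  obtain ⟨v₀, hv₀⟩ := ht
  have hget : ∀ (l : List V) (v : V), v ∈ l → ∃ n < l.length, l.getD n v₀ = v := by
    intro l v hv
    obtain ⟨n, hn, h⟩ := List.getElem_of_mem hv
    exact ⟨n, hn, by rw [List.getD_eq_getElem _ _ hn, h]⟩
  refine ⟨fun n => (s.toList ++ t.toList).getD n v₀, s.toList.length, fun n => ?_, fun n hn => ?_,
    fun v hv => ?_, fun v hv => ?_⟩
  · rcases lt_or_ge n (s.toList ++ t.toList).length with h | h
    · simp only [List.getD_eq_getElem _ _ h]
      rcases List.mem_append.1 (List.getElem_mem h) with h | h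
      · exact hst (Finset.mem_toList.1 h)
      · exact Finset.mem_toList.1 h
    · simp only [List.getD_eq_default _ _ h]; exact hv₀
  · simp only [List.getD_append _ _ _ _ hn, List.getD_eq_getElem _ _ hn]
    exact Finset.mem_toList.1 (List.getElem_mem hn)
  · obtain ⟨n, hn, h⟩ := hget _ _ (Finset.mem_toList.2 hv)
    exact ⟨n, hn, by simp only [List.getD_append _ _ _ _ hn, h]⟩
  · obtain ⟨n, -, h⟩ := hget (s.toList ++ t.toList) v
      (List.mem_append_right _ (Finset.mem_toList.2 hv))
    exact ⟨n, h⟩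

/-! ### Standard sets and the shelling of their complex -/

namespace ShiftedColumns

open ScrollVertex

variable {c m : ℕ} {X : Type*} (D : ShiftedColumns c m X)

/-- The pairs of chords whose product is a leading monomial. -/
def Bad (u v : ScrollVertex c) : Prop :=
  u.Cross v ∨ D.Far u.right v.left ∧ D.Far u.right v.right

/-- The sets of chords without bad pairs. -/
def Standard (F : Finset (ScrollVertex c)) : Prop := ∀ u ∈ F, ∀ v ∈ F, ¬ D.Bad u v

variable {D}

/-- Take for `a` the least right end of a chord, or `m - 2` if that is smaller. No chord then lies
left of `a`. If `a = u.right`, a chord between far columns would be bad with `u`; if `a = m - 2`,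
the only far column is the shift of column `m - 1`, which leaves no room for a chord. -/
theorem Standard.exists_face (hm : 3 ≤ m) (hmc : m ≤ c) {F : Finset (ScrollVertex c)}
    (hF : D.Standard F) : ∃ a : Fin c, 0 < (a : ℕ) ∧ (a : ℕ) + 2 ≤ m ∧ D.Face a F := by
  classical
  set t : Fin c := ⟨m - 2, by omega⟩ with ht
  set s := insert t (F.image fun v => v.right) with hs
  have hne : s.Nonempty := Finset.insert_nonempty _ _
  set a := s.min' hne with ha
  have hat : a ≤ t := s.min'_le _ (Finset.mem_insert_self _ _)
  have hav : ∀ v ∈ F, a ≤ v.right := fun v hv =>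
    s.min'_le _ (Finset.mem_insert_of_mem (Finset.mem_image_of_mem _ hv))
  have ham := s.min'_mem hne
  rw [← ha, hs, Finset.mem_insert, Finset.mem_image] at ham
  refine ⟨a, ?_, ?_, fun v hv => ⟨⟨fun h => ?_, fun h => ?_⟩, fun u hu huv =>
    hF u hu v hv (Or.inl huv)⟩⟩
  · rcases ham with h | ⟨v, hv, h⟩
    · rw [h, ht]; simp only; omega
    · have := v.left_lt_right
      rw [h, Fin.lt_def] at this
      omega
  · rw [Fin.le_def, ht] at hat
    simp only at hat
    omega
  · exact absurd h.2 (not_lt.2 (hav v hv))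
  · rcases ham with hat | ⟨u, hu, hua⟩
    · obtain ⟨⟨δ, h1, h2, h3⟩, δ', h1', h2', h3'⟩ := h
      have : δ = δ' := by
        rw [hat, Fin.lt_def, ht] at h1 h1'
        simp only at h1 h1'
        exact Fin.ext (by omega)
      rw [this, h3'] at h3
      exact absurd h3 v.left_lt_right.ne'
    · exact hF u hu v hv (Or.inr (by rwa [hua]))

theorem Face.standard {a : Fin c} {F : Finset (ScrollVertex c)} (hF : D.Face a F) :
    D.Standard F := by
  rintro u hu v hv (h | ⟨h1, h2⟩)
  · exact (hF v hv).2 u hu h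
  · rcases lt_or_ge u.right a with h | h
    · exact (hF u hu).1.1 ⟨u.left_lt_right.trans h, h⟩
    · exact (hF v hv).1.2 ⟨h1.anti _ h, h2.anti _ h⟩

variable {a : Fin c} {rk : Fin c → ℕ} {r : ℕ}

/-- An allowed chord whose end of smaller rank is the shift of `a` has its other end among the
shifts of later columns. -/
theorem IsRank.far_of_lo_eq (h : D.IsRank a rk r) {v : ScrollVertex c}
    (hlo : lo rk v = D.next a) : D.Far a (hi rk v) := by
  by_contra hf
  have h1 := rk_lo_lt_rk_hi h.inj v
  have h2 : hi rk v ≠ D.next a := fun e => lo_ne_hi rk v (hlo.trans e.symm)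
  have := h.lt_next _ hf h2
  rw [hlo] at h1
  omega

/-- Both `next a` and the other end, which is far for `a`, are far for `b`. Such chords distinguish
the facets for different values of `a`. -/
theorem IsRank.not_allowed_of_lo_eq (h : D.IsRank a rk r) (ham : (a : ℕ) < m)
    {v : ScrollVertex c} (hlo : lo rk v = D.next a) {b : Fin c} (hb : b < a) :
    ¬ D.Allowed b v := by
  intro hall
  have h1 : D.Far b (hi rk v) := (h.far_of_lo_eq hlo).anti _ hb.le
  have h2 : D.Far b (lo rk v) := hlo ▸ ⟨a, hb, ham, rfl⟩
  rcases lo_hi rk v with ⟨p, q⟩ | ⟨p, q⟩ <;> rw [q] at h1 <;> rw [p] at h2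
  exacts [hall.2 ⟨h2, h1⟩, hall.2 ⟨h1, h2⟩]

section

variable [Fintype X] [DecidableEq X]

/-- The multiplicity of the shift of `a` as the end of smaller rank is a linear functional of the
exponent vector. -/
theorem IsRank.exists_functional (h : D.IsRank a rk r) :
    ∃ l : (X → ℚ) →ₗ[ℚ] ℚ, ∀ v, D.Allowed a v →
      l (D.vec rk v) = if lo rk v = D.next a then 1 else 0 := by
  classical
  set s := Finset.univ.filter fun γ => ¬ D.Far a γ ∧ γ ≠ D.next a with hs
  -- Half the sum of the coordinates is 1 on every vector. The subtracted coordinates detect the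
  -- other possible lower-ranked ends; a lower entry `bot (hi rk v)` never interferes, because `hi
  -- rk v` is not left of `a` and so its shift, if any, is `next a` or far.
  refine ⟨(2 : ℚ)⁻¹ • (∑ x : X, LinearMap.proj x) - ∑ γ ∈ s, LinearMap.proj (D.top γ),
    fun v hv => ?_⟩
  obtain ⟨h1, h2⟩ := h.allowed_iff.1 hv
  simp only [LinearMap.sub_apply, LinearMap.smul_apply, LinearMap.sum_apply, LinearMap.proj_apply,
    vec, Pi.add_apply, Finset.sum_add_distrib, Finset.mem_univ, if_true,
    Pi.single_apply, Finset.sum_ite_eq', smul_eq_mul, D.top_injective.eq_iff]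
  have h3 : ∑ γ ∈ s, (if D.top γ = D.bot (hi rk v) then (1 : ℚ) else 0) = 0 := by
    refine Finset.sum_eq_zero fun γ hγ => if_neg fun he => ?_
    obtain ⟨h4, rfl⟩ := (D.top_eq_bot _ _).1 he
    obtain ⟨-, h5, h6⟩ := Finset.mem_filter.1 hγ
    rcases lt_trichotomy (hi rk v) a with h7 | h7 | h7
    · exact h1 h7
    · exact h6 (by rw [h7])
    · exact h5 ⟨_, h7, h4, rfl⟩
  rw [h3]
  have h4 : lo rk v ∈ s ↔ lo rk v ≠ D.next a := by simp [hs, h2]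
  by_cases h5 : lo rk v = D.next a
  · rw [if_neg fun h6 => h4.1 h6 h5, if_pos h5]; norm_num
  · rw [if_pos (h4.2 h5), if_neg h5]; norm_num

/-- Otherwise the functional counting lower-ranked ends at `next a` would vanish on the basis `F`,
although it is 1 on the chord from `next a` to `next (a + 1)`. -/
theorem IsRank.exists_lo_eq (h : D.IsRank a rk r) (ha0 : 0 < (a : ℕ)) (ha : (a : ℕ) + 2 ≤ m)
    (hm : m ≤ c) {F : Finset (ScrollVertex c)} (hF : Maximal (D.Face a) F) :
    ∃ v ∈ F, lo rk v = D.next a := by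
  have ham : (a : ℕ) < m := by omega
  by_contra! hno
  obtain ⟨l, hl⟩ := h.exists_functional
  have T := h.isRegularTriangulation ha0 ha hm
  have hzero : ∀ x, l x = 0 := by
    intro x
    rw [← T.comb_coord hF x, Fintype.linearCombination_apply, map_sum]
    refine Finset.sum_eq_zero fun v _ => ?_
    by_cases hv : v ∈ F
    · rw [map_smul, hl v (hF.prop v hv).1, if_neg (hno v hv), smul_zero]
    · rw [T.coord_of_notMem hF x hv, zero_smul, map_zero]
  have hφ : D.Far a (D.next ⟨a + 1, by omega⟩) :=
    ⟨⟨a + 1, by omega⟩, by simp [Fin.lt_def], by simpa using (show (a : ℕ) + 1 < m by omega), rfl⟩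
  have hn := D.not_far_next ham (le_refl a)
  have hlt := h.lt_far _ _ hn hφ
  have hne : D.next a ≠ D.next ⟨a + 1, by omega⟩ := fun e => hn (by rw [e]; exact hφ)
  have hall : D.Allowed a (pair _ _ hne) := by
    rw [h.allowed_iff, lo_pair _ hlt, hi_pair _ hlt]
    exact ⟨not_lt.2 (D.lt_of_far hφ).le, hn⟩
  have := hl _ hall
  rw [hzero, lo_pair _ hlt, if_pos rfl] at this
  norm_num at this

theorem facet_index_unique (hm : m ≤ c) {a b : Fin c} (ha0 : 0 < (a : ℕ)) (ha : (a : ℕ) + 2 ≤ m)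
    {F : Finset (ScrollVertex c)} (hF : Maximal (D.Face a) F) (hb : D.Face b F) : a ≤ b := by
  by_contra! hlt
  obtain ⟨rk, r, h⟩ := D.exists_isRank ha hm
  obtain ⟨v, hv, hlo⟩ := h.exists_lo_eq ha0 ha hm hF
  exact h.not_allowed_of_lo_eq (by omega) hlo hlt (hb v hv).1

theorem card_facet (hm : m ≤ c) (ha0 : 0 < (a : ℕ)) (ha : (a : ℕ) + 2 ≤ m)
    {F : Finset (ScrollVertex c)} (hF : Maximal (D.Face a) F) : F.card = Fintype.card X := by
  obtain ⟨rk, r, h⟩ := D.exists_isRank ha hm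
  rw [(h.isRegularTriangulation ha0 ha hm).card_facet hF, Module.finrank_fintype_fun_eq_card]

theorem exists_enumeration_allowed (h : D.IsRank a rk r) (ha0 : 0 < (a : ℕ))
    (ha : (a : ℕ) + 2 ≤ m) (hm : m ≤ c) :
    ∃ (p : ℕ → ScrollVertex c) (N : ℕ), (∀ n, D.Face a {p n}) ∧
      (∀ n < N, lo rk (p n) ≠ D.next a) ∧
      (∀ v, D.Allowed a v → lo rk v ≠ D.next a → ∃ n < N, p n = v) ∧
      ∀ v, D.Face a {v} → ∃ n, p n = v := by
  classical
  obtain ⟨F, -, hF⟩ := exists_maximal_superset (h.isRegularTriangulation ha0 ha hm).empty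
  obtain ⟨v, hv, -⟩ := h.exists_lo_eq ha0 ha hm hF
  obtain ⟨p, N, h1, h2, h3, h4⟩ := exists_enumeration
    (s := Finset.univ.filter fun v => D.Face a {v} ∧ lo rk v ≠ D.next a)
    (t := Finset.univ.filter fun v => D.Face a {v})
    (fun v hv => by simp only [Finset.mem_filter] at hv ⊢; exact ⟨hv.1, hv.2.1⟩)
    ⟨v, by simpa using hF.prop.mono (by simpa using hv)⟩
  simp only [Finset.mem_filter, Finset.mem_univ, true_and] at h1 h2 h3 h4
  exact ⟨p, N, h1, fun n hn => (h2 n hn).2, fun v h5 h6 => h3 v ⟨face_singleton.2 h5, h6⟩, h4⟩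

/-- A facet with at least two chords starting at the shift of `a` can be moved to an earlier one
by removing one of them. -/
theorem IsRank.exists_lt_of_two (h : D.IsRank a rk r) (ha0 : 0 < (a : ℕ))
    (ham : (a : ℕ) < m) {p : ℕ → ScrollVertex c} {N : ℕ}
    (T : IsRegularTriangulation (D.vec rk) (fun v => (weight v : ℚ)) (D.Face a))
    (hp : ∀ n, D.Face a {p n}) (hN : ∀ n < N, lo rk (p n) ≠ D.next a)
    (hcov : ∀ v, D.Allowed a v → lo rk v ≠ D.next a → ∃ n < N, p n = v)
    {F : Finset (ScrollVertex c)} (hF : Maximal (D.Face a) F) {v₁ v₂ : ScrollVertex c}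
    (hv₁ : v₁ ∈ F) (hv₂ : v₂ ∈ F) (hne : v₁ ≠ v₂) (hlo₁ : lo rk v₁ = D.next a)
    (hlo₂ : lo rk v₂ = D.next a) :
    ∃ v ∈ F, lo rk v = D.next a ∧ ∃ (H : Finset (ScrollVertex c)) (hH : Maximal (D.Face a) H),
      T.key p hH < T.key p hF ∧ F \ H = {v} := by
  classical
  obtain ⟨l, hl⟩ := h.exists_functional
  have ha := a.2
  set z : Fin c := ⟨0, by omega⟩ with hz
  have hza : z < a := by rw [Fin.lt_def]; exact ha0
  have hzF : ¬ D.Far a z := fun hf => absurd (D.lt_of_far hf) (not_lt.2 hza.le)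
  have hzn : z ≠ D.next a := (hza.trans (D.lt_next a ham)).ne
  -- Replacing the end `next a` by column 0 turns `v₁` and `v₂` into chords among the first `N` and
  -- keeps the difference of the two vectors. That difference has coordinate 1 at `v₁`, so one of
  -- the replacements has a nonzero coordinate there.
  have hu : ∀ v : ScrollVertex c, lo rk v = D.next a → ∃ n < N,
      D.vec rk (p n) = Pi.single (D.top z) 1 + Pi.single (D.bot (hi rk v)) 1 := by
    intro v hv
    have hf := h.far_of_lo_eq hv
    have hlt : rk z < rk (hi rk v) := h.lt_far _ _ hzF hf
    have hne : z ≠ hi rk v := fun e => by simp [← e] at hlt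
    obtain ⟨n, hn, hpn⟩ := hcov (pair z (hi rk v) hne) (by
      rw [h.allowed_iff, lo_pair hne hlt, hi_pair hne hlt]
      exact ⟨not_lt.2 (D.lt_of_far hf).le, hzF⟩) (by rwa [lo_pair hne hlt])
    refine ⟨n, hn, ?_⟩
    rw [hpn, vec, lo_pair hne hlt, hi_pair hne hlt]
  obtain ⟨n₁, hn₁, hA₁⟩ := hu v₁ hlo₁
  obtain ⟨n₂, hn₂, hA₂⟩ := hu v₂ hlo₂
  have hdiff : D.vec rk v₁ - D.vec rk v₂ = D.vec rk (p n₁) - D.vec rk (p n₂) := by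
    rw [hA₁, hA₂, vec, vec, hlo₁, hlo₂]; abel
  have hcoord := congrArg (fun x => T.coord hF x v₁) hdiff
  simp only [map_sub, Pi.sub_apply, T.coord_apply_mem hF hv₁, T.coord_apply_mem hF hv₂,
    Pi.single_eq_same, Pi.single_eq_of_ne hne, sub_zero] at hcoord
  have hl01 : ∀ v ∈ F, l (D.vec rk v) = 0 ∨ l (D.vec rk v) = 1 := by
    intro v hv
    rw [hl v (hF.prop v hv).1]
    split_ifs <;> simp
  have hl0 : ∀ n < N, l (D.vec rk (p n)) = 0 := by
    intro n hn
    rw [hl _ (face_singleton.1 (hp n)), if_neg (hN n hn)]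
  obtain ⟨n₀, hn₀, hne₀⟩ : ∃ n₀ < N, T.coord hF (D.vec rk (p n₀)) v₁ ≠ 0 := by
    by_contra! hall
    rw [hall n₁ hn₁, hall n₂ hn₂] at hcoord
    norm_num at hcoord
  obtain ⟨v, hv, hlv, H⟩ := T.exists_lt_of_functional hp hF l hl0 hl01 hv₁
    (by rw [hl _ (hF.prop v₁ hv₁).1, if_pos hlo₁]) hn₀ hne₀
  refine ⟨v, hv, ?_, H⟩
  by_contra hlo
  rw [hl _ (hF.prop v hv).1, if_neg hlo] at hlv
  norm_num at hlv

/-- A facet with just one chord starting at the shift of `a` has a neighbour for the preceding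
value of `a`. -/
theorem IsRank.exists_facet_pred (h : D.IsRank a rk r) (hm : m ≤ c) (ha0 : 1 < (a : ℕ))
    (ha : (a : ℕ) + 2 ≤ m) {F : Finset (ScrollVertex c)} (hF : Maximal (D.Face a) F)
    {v : ScrollVertex c} (hv : v ∈ F)
    (huniq : ∀ w ∈ F, lo rk w = D.next a → w = v) {b : Fin c} (hb : (b : ℕ) + 1 = a) :
    ∃ H, Maximal (D.Face b) H ∧ F \ H = {v} := by
  have hba : b < a := by rw [Fin.lt_def]; omega
  -- Passing from `a` to `a - 1` adds only `next a` to the far columns. Hence the chords of `F` that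
  -- become forbidden have lower-ranked end `next a`, and `v` is the only one.
  have hface : D.Face b (F.erase v) := by
    intro w hw
    obtain ⟨hwv, hw⟩ := Finset.mem_erase.1 hw
    obtain ⟨hall, hcr⟩ := hF.prop w hw
    refine ⟨⟨fun h1 => hall.1 ⟨h1.1.trans hba, h1.2.trans hba⟩, fun h1 => ?_⟩,
      fun u hu => hcr u (Finset.mem_of_mem_erase hu)⟩
    have hor : ∀ γ, D.Far b γ → γ = D.next a ∨ D.Far a γ := by
      rintro γ ⟨δ, h2, h3, rfl⟩
      rcases (show a ≤ δ by rw [Fin.le_def]; rw [Fin.lt_def] at h2; omega).eq_or_lt with rfl | h4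
      · exact Or.inl rfl
      · exact Or.inr ⟨δ, h4, h3, rfl⟩
    have hlo : D.Far b (lo rk w) := by
      rcases lo_hi rk w with ⟨p, -⟩ | ⟨p, -⟩ <;> rw [p]
      exacts [h1.1, h1.2]
    rcases hor _ hlo with h2 | h2
    · exact hwv (huniq w hw h2)
    · exact (h.allowed_iff.1 hall).2 h2
  obtain ⟨H, hH1, hH2⟩ := exists_maximal_superset hface
  refine ⟨H, hH2, Finset.sdiff_eq_singleton_of_erase_subset ?_ hv hH1 ?_⟩
  · rw [card_facet hm (by omega) ha hF, card_facet hm (by omega) (by omega) hH2]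
  · rintro rfl
    exact absurd (facet_index_unique hm (by omega) ha hF hH2.prop) (not_le.2 hba)

end

/-- The complex of the sets of chords without bad pairs is shellable. -/
theorem isShellable [Fintype X] (hm : 3 ≤ m) (hmc : m ≤ c)
    (Δ : PreAbstractSimplicialComplex (ScrollVertex c))
    (hΔ : ∀ F, F ∈ Δ.faces ↔ F.Nonempty ∧ D.Standard F) : IsShellable Δ := by
  classical
  have hX : 0 < Fintype.card X := Fintype.card_pos_iff.2 ⟨D.top ⟨0, by omega⟩⟩
  have hfacet : ∀ F, IsFacet Δ F ↔
      ∃ a : Fin c, (0 < (a : ℕ) ∧ (a : ℕ) + 2 ≤ m) ∧ Maximal (D.Face a) F := by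
    intro F
    constructor
    · intro hF
      obtain ⟨hne, hst⟩ := (hΔ F).1 hF.prop
      obtain ⟨a, ha0, ha, hface⟩ := hst.exists_face hm hmc
      obtain ⟨G, hFG, hG⟩ := exists_maximal_superset hface
      have : F = G := hF.eq_of_le ((hΔ G).2 ⟨hne.mono hFG, hG.prop.standard⟩) hFG
      exact ⟨a, ⟨ha0, ha⟩, this ▸ hG⟩
    · rintro ⟨a, ⟨ha0, ha⟩, hF⟩
      -- The facets for all values of `a` have the same size, so a facet of one complex remains
      -- maximal in the union.
      have hcard := card_facet hmc ha0 ha hF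
      refine ⟨(hΔ F).2 ⟨Finset.card_pos.1 (by omega), hF.prop.standard⟩, fun H hH hFH => ?_⟩
      obtain ⟨b, hb0, hb, hface⟩ := ((hΔ H).1 hH).2.exists_face hm hmc
      obtain ⟨G, hHG, hG⟩ := exists_maximal_superset hface
      have hcard' := card_facet hmc hb0 hb hG
      have := Finset.eq_of_subset_of_card_le (Finset.Subset.trans hFH hHG) (by omega)
      exact this ▸ hHG
  have hrank : ∀ a : Fin c, ∃ rk r, (0 < (a : ℕ) ∧ (a : ℕ) + 2 ≤ m) → D.IsRank a rk r := by
    intro a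
    by_cases ha : 0 < (a : ℕ) ∧ (a : ℕ) + 2 ≤ m
    · obtain ⟨rk, r, h⟩ := D.exists_isRank ha.2 hmc
      exact ⟨rk, r, fun _ => h⟩
    · exact ⟨0, 0, fun h => absurd h ha⟩
  choose rk r hrk using hrank
  have hT : ∀ a : Fin c, (0 < (a : ℕ) ∧ (a : ℕ) + 2 ≤ m) →
      IsRegularTriangulation (D.vec (rk a)) (fun v => (weight v : ℚ)) (D.Face a) :=
    fun a ha => (hrk a ha).isRegularTriangulation ha.1 ha.2 hmc
  have hex : ∀ a : Fin c, ∃ (p : ℕ → ScrollVertex c) (N : ℕ), (0 < (a : ℕ) ∧ (a : ℕ) + 2 ≤ m) →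
      (∀ n, D.Face a {p n}) ∧ (∀ n < N, lo (rk a) (p n) ≠ D.next a) ∧
      (∀ v, D.Allowed a v → lo (rk a) v ≠ D.next a → ∃ n < N, p n = v) ∧
      ∀ v, D.Face a {v} → ∃ n, p n = v := by
    intro a
    by_cases ha : 0 < (a : ℕ) ∧ (a : ℕ) + 2 ≤ m
    · obtain ⟨p, N, h⟩ := exists_enumeration_allowed (hrk a ha) ha.1 ha.2 hmc
      exact ⟨p, N, fun _ => h⟩
    · exact ⟨fun _ => pair ⟨0, by omega⟩ ⟨1, by omega⟩ (by simp), 0, fun h => absurd h ha⟩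
  choose p N hp using hex
  -- The index `a` of a facet is unique by `facet_index_unique`, so the choice is harmless; the
  -- value at other sets plays no role.
  set key : Finset (ScrollVertex c) → ℕ ×ₗ Lex (ℕ → ℚ) := fun F =>
    if h : ∃ a : Fin c, (0 < (a : ℕ) ∧ (a : ℕ) + 2 ≤ m) ∧ Maximal (D.Face a) F then
      toLex ((h.choose : ℕ), (hT _ h.choose_spec.1).key (p _) h.choose_spec.2)
    else toLex (0, toLex 0) with hkey
  have hkeyeq : ∀ (a : Fin c) (ha : 0 < (a : ℕ) ∧ (a : ℕ) + 2 ≤ m) (F : Finset (ScrollVertex c))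
      (hF : Maximal (D.Face a) F), key F = toLex ((a : ℕ), (hT a ha).key (p a) hF) := by
    intro a ha F hF
    have h : ∃ a : Fin c, (0 < (a : ℕ) ∧ (a : ℕ) + 2 ≤ m) ∧ Maximal (D.Face a) F := ⟨a, ha, hF⟩
    have hcase : ∀ (b : Fin c) (hb : 0 < (b : ℕ) ∧ (b : ℕ) + 2 ≤ m) (hFb : Maximal (D.Face b) F),
        (toLex ((b : ℕ), (hT b hb).key (p b) hFb) : ℕ ×ₗ Lex (ℕ → ℚ)) =
          toLex ((a : ℕ), (hT a ha).key (p a) hF) := by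
      intro b hb hFb
      obtain rfl : a = b := le_antisymm (facet_index_unique hmc ha.1 ha.2 hF hFb.prop)
        (facet_index_unique hmc hb.1 hb.2 hFb hF.prop)
      rfl
    simp only [hkey, dif_pos h]
    exact hcase _ h.choose_spec.1 h.choose_spec.2
  refine isShellable_of_key Δ ?_ key ?_ ?_
  · intro F G hF hG
    obtain ⟨a, ha, hFa⟩ := (hfacet F).1 hF
    obtain ⟨b, hb, hGb⟩ := (hfacet G).1 hG
    rw [card_facet hmc ha.1 ha.2 hFa, card_facet hmc hb.1 hb.2 hGb]
  · intro F G hF hG heq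
    obtain ⟨a, ha, hFa⟩ := (hfacet F).1 hF
    obtain ⟨b, hb, hGb⟩ := (hfacet G).1 hG
    rw [hkeyeq a ha F hFa, hkeyeq b hb G hGb] at heq
    have h1 := congrArg (fun x => (ofLex x).1) heq
    have h2 := congrArg (fun x => (ofLex x).2) heq
    simp only [ofLex_toLex] at h1 h2
    obtain rfl : a = b := Fin.ext h1
    exact (hT a ha).key_injective (hp a ha).2.2.2 hFa hGb h2
  · intro F G hF hG hlt
    obtain ⟨a, ha, hFa⟩ := (hfacet F).1 hF
    obtain ⟨b, hb, hGb⟩ := (hfacet G).1 hG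
    have hFk := hkeyeq a ha F hFa
    rw [hFk, hkeyeq b hb G hGb, Prod.Lex.toLex_lt_toLex] at hlt
    -- A facet `G` of smaller index contains no chord with lower-ranked end `next a`, so any such
    -- chord of `F` may serve as the removed vertex.
    rcases hlt with hba | ⟨hab, hlt⟩
    · simp only at hba
      have hba : b < a := hba
      obtain ⟨v, hv, hlo⟩ := (hrk a ha).exists_lo_eq ha.1 ha.2 hmc hFa
      have hnot : ∀ w, lo (rk a) w = D.next a → w ∉ G := fun w hw hwG =>
        (hrk a ha).not_allowed_of_lo_eq (by omega) hw hba (hGb.prop w hwG).1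
      by_cases huniq : ∀ w ∈ F, lo (rk a) w = D.next a → w = v
      · have ha1 : 1 < (a : ℕ) := by rw [Fin.lt_def] at hba; omega
        have hac := a.2
        obtain ⟨H, hH, hFH⟩ := (hrk a ha).exists_facet_pred hmc ha1 ha.2 hFa hv huniq
          (b := ⟨a - 1, by omega⟩) (by simp only; omega)
        have hH' : (0 < (a : ℕ) - 1 ∧ (a : ℕ) - 1 + 2 ≤ m) := by omega
        refine ⟨v, Finset.mem_sdiff.2 ⟨hv, hnot v hlo⟩, H, (hfacet H).2 ⟨_, hH', hH⟩, ?_, hFH⟩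
        rw [hFk, hkeyeq _ hH' H hH, Prod.Lex.toLex_lt_toLex]
        left
        simp only
        omega
      · push Not at huniq
        obtain ⟨w, hw, hlow, hwv⟩ := huniq
        obtain ⟨u, hu, hlou, H, hH, hlt, hFH⟩ := (hrk a ha).exists_lt_of_two ha.1 (by omega)
          (hT a ha) (hp a ha).1 (hp a ha).2.1 (hp a ha).2.2.1 hFa hw hv hwv hlow hlo
        refine ⟨u, Finset.mem_sdiff.2 ⟨hu, hnot u hlou⟩, H, (hfacet H).2 ⟨a, ha, hH⟩, ?_, hFH⟩
        rw [hFk, hkeyeq a ha H hH, Prod.Lex.toLex_lt_toLex]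
        exact Or.inr ⟨rfl, hlt⟩
    · simp only at hab hlt
      obtain rfl : b = a := Fin.ext hab
      obtain ⟨v, hv, H, hH, hlt, hFH⟩ := (hT b ha).exists_lt_of_key_lt (hp b ha).1 hFa hGb hlt
      refine ⟨v, hv, H, (hfacet H).2 ⟨b, ha, hH⟩, ?_, hFH⟩
      rw [hFk, hkeyeq b ha H hH, Prod.Lex.toLex_lt_toLex]
      exact Or.inr ⟨rfl, hlt⟩

end ShiftedColumns

/-! ### Polynomials with a dominating monomial -/

section Lead

variable {X K Γ : Type*} [Field K] [AddCommGroup Γ] [LinearOrder Γ]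

/-- The monomial `d` of `p` has larger weight than all others. -/
def IsLead (φ : (X →₀ ℕ) →+ Γ) (p : MvPolynomial X K) (d : X →₀ ℕ) : Prop :=
  coeff d p ≠ 0 ∧ ∀ d' ∈ p.support, d' ≠ d → φ d' < φ d

/-- All monomials of `p` have weight at most `B`. -/
def WeightLE (φ : (X →₀ ℕ) →+ Γ) (p : MvPolynomial X K) (B : Γ) : Prop :=
  ∀ d ∈ p.support, φ d ≤ B

/-- All monomials of `p` have weight less than `B`. -/
def WeightLT (φ : (X →₀ ℕ) →+ Γ) (p : MvPolynomial X K) (B : Γ) : Prop :=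
  ∀ d ∈ p.support, φ d < B

variable {φ : (X →₀ ℕ) →+ Γ} {p q : MvPolynomial X K} {d d' : X →₀ ℕ} {B B' : Γ}

theorem IsLead.weightLE (h : IsLead φ p d) : WeightLE φ p (φ d) := by
  intro d' hd'
  by_cases he : d' = d
  · rw [he]
  · exact (h.2 d' hd' he).le

theorem IsLead.one : IsLead φ (1 : MvPolynomial X K) 0 := by
  classical
  refine ⟨by simp, fun d' hd' hne => ?_⟩
  rw [mem_support_iff, coeff_one] at hd'
  exact absurd (by simpa [eq_comm] using hd') hne

theorem exists_of_mem_support_mul (h : d ∈ (p * q).support) :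
    ∃ d₁ ∈ p.support, ∃ d₂ ∈ q.support, d₁ + d₂ = d := by
  classical
  exact Finset.mem_add.1 (support_mul p q h)

variable [IsOrderedAddMonoid Γ]

theorem IsLead.mul (hp : IsLead φ p d) (hq : IsLead φ q d') : IsLead φ (p * q) (d + d') := by
  classical
  have hlt : ∀ d₁ ∈ p.support, ∀ d₂ ∈ q.support, ¬ (d₁ = d ∧ d₂ = d') →
      φ (d₁ + d₂) < φ (d + d') := by
    intro d₁ h₁ d₂ h₂ hne
    rw [map_add, map_add]
    by_cases he : d₁ = d
    · rw [he]
      exact add_lt_add_of_le_of_lt le_rfl (hq.2 d₂ h₂ fun h => hne ⟨he, h⟩)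
    · exact add_lt_add_of_lt_of_le (hp.2 d₁ h₁ he) (hq.weightLE d₂ h₂)
  constructor
  · rw [coeff_mul, Finset.sum_eq_single (d, d')]
    · exact mul_ne_zero hp.1 hq.1
    · rintro ⟨d₁, d₂⟩ hmem hne
      by_contra h0
      have h1 := hlt d₁ (mem_support_iff.2 (left_ne_zero_of_mul h0)) d₂
        (mem_support_iff.2 (right_ne_zero_of_mul h0)) (fun h => hne (Prod.ext h.1 h.2))
      rw [Finset.HasAntidiagonal.mem_antidiagonal.1 hmem] at h1
      exact lt_irrefl _ h1
    · intro h; simp at h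
  · intro d₀ h₀ hne
    obtain ⟨d₁, h₁, d₂, h₂, rfl⟩ := exists_of_mem_support_mul h₀
    exact hlt d₁ h₁ d₂ h₂ fun h => hne (by rw [h.1, h.2])

theorem IsLead.pow (hp : IsLead φ p d) (n : ℕ) : IsLead φ (p ^ n) (n • d) := by
  induction n with
  | zero => simpa using IsLead.one
  | succ n ih => rw [pow_succ, succ_nsmul]; exact ih.mul hp

theorem IsLead.prod {V : Type*} (s : Finset V) (p : V → MvPolynomial X K) (d : V → X →₀ ℕ)
    (h : ∀ v ∈ s, IsLead φ (p v) (d v)) : IsLead φ (∏ v ∈ s, p v) (∑ v ∈ s, d v) := by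
  classical
  induction s using Finset.induction_on with
  | empty => simpa using IsLead.one
  | insert v s hv ih =>
    rw [Finset.prod_insert hv, Finset.sum_insert hv]
    exact (h v (Finset.mem_insert_self _ _)).mul
      (ih fun w hw => h w (Finset.mem_insert_of_mem hw))

theorem WeightLE.mul (hp : WeightLE φ p B) (hq : WeightLE φ q B') :
    WeightLE φ (p * q) (B + B') := by
  intro d hd
  obtain ⟨d₁, h₁, d₂, h₂, rfl⟩ := exists_of_mem_support_mul hd
  rw [map_add]
  exact add_le_add (hp d₁ h₁) (hq d₂ h₂)

theorem WeightLT.mul (hp : WeightLT φ p B) (hq : WeightLE φ q B') :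
    WeightLT φ (p * q) (B + B') := by
  intro d hd
  obtain ⟨d₁, h₁, d₂, h₂, rfl⟩ := exists_of_mem_support_mul hd
  rw [map_add]
  exact add_lt_add_of_lt_of_le (hp d₁ h₁) (hq d₂ h₂)

theorem WeightLE.pow (hp : WeightLE φ p B) (n : ℕ) : WeightLE φ (p ^ n) (n • B) := by
  induction n with
  | zero =>
    rw [pow_zero, zero_nsmul]
    simpa using (IsLead.one (K := K) (φ := φ)).weightLE
  | succ n ih => rw [pow_succ, succ_nsmul]; exact ih.mul hp

theorem WeightLE.prod {V : Type*} (s : Finset V) (p : V → MvPolynomial X K) (B : V → Γ)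
    (h : ∀ v ∈ s, WeightLE φ (p v) (B v)) : WeightLE φ (∏ v ∈ s, p v) (∑ v ∈ s, B v) := by
  classical
  induction s using Finset.induction_on with
  | empty => simpa using (IsLead.one (K := K) (φ := φ)).weightLE
  | insert v s hv ih =>
    rw [Finset.prod_insert hv, Finset.sum_insert hv]
    exact (h v (Finset.mem_insert_self _ _)).mul
      (ih fun w hw => h w (Finset.mem_insert_of_mem hw))

end Lead

namespace ShiftedColumns

open ScrollVertex

variable {c m : ℕ} {X : Type*} (D : ShiftedColumns c m X)

/-! ### The weights of the variables -/

/-- The weight of a column in the lexicographic group. -/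
def unitWeight (γ : Fin c) : Lex (Fin c → ℤ) := toLex (Pi.single γ 1)

/-- The difference of the weights of a column and its shift. -/
def slope (a : Fin c) : Lex (Fin c → ℤ) := unitWeight a - unitWeight (D.next a)

/-- Shifts move to the right, so the slopes first differ at coordinate `γ`, with values 1 and 0. -/
theorem slope_lt {γ δ : Fin c} (hγδ : γ < δ) (hδ : (δ : ℕ) < m) : D.slope δ < D.slope γ := by
  have h1 := D.lt_next γ (lt_trans hγδ hδ)
  have h2 := D.lt_next δ hδ
  have hs : ∀ a j : Fin c, D.slope a j =
      (if j = a then (1 : ℤ) else 0) - (if j = D.next a then 1 else 0) := by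
    intro a j
    change (Pi.single a 1 : Fin c → ℤ) j - (Pi.single (D.next a) 1 : Fin c → ℤ) j = _
    rw [Pi.single_apply, Pi.single_apply]
  refine ⟨γ, fun j hj => ?_, ?_⟩
  · rw [hs, hs, if_neg (hj.trans hγδ).ne, if_neg (hj.trans (hγδ.trans h2)).ne, if_neg hj.ne,
      if_neg (hj.trans h1).ne]
  · rw [hs, hs, if_neg hγδ.ne, if_neg (hγδ.trans h2).ne, if_pos rfl, if_neg h1.ne]
    norm_num

theorem slope_le {γ δ : Fin c} (hγδ : γ ≤ δ) (hδ : (δ : ℕ) < m) : D.slope δ ≤ D.slope γ := by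
  rcases hγδ.eq_or_lt with rfl | h
  · exact le_rfl
  · exact (D.slope_lt h hδ).le

variable [DecidableEq X]

/-- The candidates for the weight of a variable. -/
def weightCandidates (a : Fin c) (x : X) : Finset (Lex (Fin c → ℤ)) :=
  (Finset.univ.filter fun γ => D.top γ = x).image unitWeight ∪
    (Finset.univ.filter fun γ => D.bot γ = x).image fun γ => unitWeight γ - D.slope a

theorem weightCandidates_nonempty (a : Fin c) (x : X) : (D.weightCandidates a x).Nonempty := by
  rcases D.exists_eq x with ⟨γ, rfl⟩ | ⟨γ, rfl⟩
  · exact ⟨_, Finset.mem_union_left _ (Finset.mem_image.2 ⟨γ, by simp, rfl⟩)⟩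
  · exact ⟨_, Finset.mem_union_right _ (Finset.mem_image.2 ⟨γ, by simp, rfl⟩)⟩

/-- The weight of a variable. -/
noncomputable def varWeight (a : Fin c) (x : X) : Lex (Fin c → ℤ) :=
  (D.weightCandidates a x).min' (D.weightCandidates_nonempty a x)

theorem varWeight_top_le (a γ : Fin c) : D.varWeight a (D.top γ) ≤ unitWeight γ :=
  Finset.min'_le _ _ (Finset.mem_union_left _ (Finset.mem_image.2 ⟨γ, by simp, rfl⟩))

theorem varWeight_bot_le (a γ : Fin c) :
    D.varWeight a (D.bot γ) ≤ unitWeight γ - D.slope a :=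
  Finset.min'_le _ _ (Finset.mem_union_right _
    (Finset.mem_image.2 ⟨γ, by simp, rfl⟩))

theorem le_varWeight {a : Fin c} {x : X} {w : Lex (Fin c → ℤ)}
    (h1 : ∀ γ, D.top γ = x → w ≤ unitWeight γ)
    (h2 : ∀ γ, D.bot γ = x → w ≤ unitWeight γ - D.slope a) : w ≤ D.varWeight a x := by
  refine Finset.le_min' _ _ _ fun y hy => ?_
  rcases Finset.mem_union.1 hy with hy | hy
  · obtain ⟨γ, hγ, rfl⟩ := Finset.mem_image.1 hy
    exact h1 γ (by simpa using hγ)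
  · obtain ⟨γ, hγ, rfl⟩ := Finset.mem_image.1 hy
    exact h2 γ (by simpa using hγ)

/-- If `γ = next δ`, the competing candidate `unitWeight δ - slope a` equals `unitWeight γ + slope δ
- slope a`. Since slopes decrease, the candidate of the upper entry wins for `δ ≤ a` and that of the
lower entry for `δ ≥ a`. This is the source of the dichotomy between near and far columns. -/
theorem varWeight_top {a γ : Fin c} (ham : (a : ℕ) < m) (hγ : ¬ D.Far a γ) :
    D.varWeight a (D.top γ) = unitWeight γ := by
  refine le_antisymm (D.varWeight_top_le a γ) (D.le_varWeight (fun γ' h => ?_) fun δ h => ?_)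
  · rw [D.top_injective h]
  · obtain ⟨h1, rfl⟩ := (D.top_eq_bot _ _).1 h.symm
    have : δ ≤ a := not_lt.1 fun h2 => hγ ⟨δ, h2, h1, rfl⟩
    rw [le_sub_comm]
    exact D.slope_le this ham

theorem varWeight_top_lt {a γ : Fin c} (hγ : D.Far a γ) :
    D.varWeight a (D.top γ) < unitWeight γ := by
  obtain ⟨δ, h1, h2, rfl⟩ := hγ
  rw [(D.top_eq_bot _ _).2 ⟨h2, rfl⟩]
  refine (D.varWeight_bot_le a δ).trans_lt ?_
  rw [sub_lt_comm]
  exact D.slope_lt h1 h2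

theorem varWeight_bot {a γ : Fin c} (hγ : ¬ γ < a) :
    D.varWeight a (D.bot γ) = unitWeight γ - D.slope a := by
  refine le_antisymm (D.varWeight_bot_le a γ) (D.le_varWeight (fun δ h => ?_) fun γ' h => ?_)
  · obtain ⟨h1, rfl⟩ := (D.top_eq_bot _ _).1 h
    rw [sub_le_comm]
    exact D.slope_le (not_lt.1 hγ) h1
  · rw [D.bot_injective h]

theorem varWeight_bot_lt {a γ : Fin c} (ham : (a : ℕ) < m) (hγ : γ < a) :
    D.varWeight a (D.bot γ) < unitWeight γ - D.slope a := by
  rw [← (D.top_eq_bot _ _).2 ⟨lt_trans hγ ham, rfl⟩]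
  refine (D.varWeight_top_le a _).trans_lt ?_
  rw [lt_sub_comm]
  exact D.slope_lt hγ ham

open Classical in
/-- The tie-breaking weight of a variable. -/
noncomputable def tieWeight (a : Fin c) (rk : Fin c → ℕ) (x : X) : ℤ :=
  if h : ∃ γ, D.top γ = x ∧ ¬ γ < a ∧ ¬ D.Far a γ ∧ γ ≠ D.next a then
    (Finset.univ.sup rk : ℕ) + 1 - rk h.choose
  else if x = D.bot (D.next a) then 1 else 0

theorem tieWeight_top {a γ : Fin c} (rk : Fin c → ℕ) (h1 : ¬ γ < a) (h2 : ¬ D.Far a γ)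
    (h3 : γ ≠ D.next a) :
    D.tieWeight a rk (D.top γ) = (Finset.univ.sup rk : ℕ) + 1 - rk γ := by
  have h : ∃ γ', D.top γ' = D.top γ ∧ ¬ γ' < a ∧ ¬ D.Far a γ' ∧ γ' ≠ D.next a :=
    ⟨γ, rfl, h1, h2, h3⟩
  rw [tieWeight, dif_pos h, D.top_injective h.choose_spec.1]

/-- For `a < m` this variable is also `bot a`, so it must carry the value of a lower entry. This
does no harm, as `next a` has the largest rank among the columns that are not far. -/
theorem tieWeight_top_next {a : Fin c} (rk : Fin c → ℕ) :
    D.tieWeight a rk (D.top (D.next a)) = 0 := by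
  rw [tieWeight, dif_neg, if_neg]
  · intro h
    obtain ⟨h1, h2⟩ := (D.top_eq_bot _ _).1 h
    exact absurd h2 (D.lt_next _ h1).ne'
  · rintro ⟨γ, h1, -, -, h2⟩
    exact h2 (D.top_injective h1)

theorem tieWeight_bot {a γ : Fin c} (rk : Fin c → ℕ) (h1 : ¬ γ < a) :
    D.tieWeight a rk (D.bot γ) = if γ = D.next a then 1 else 0 := by
  rw [tieWeight, dif_neg]
  · simp only [D.bot_injective.eq_iff]
  · rintro ⟨δ, h2, h3, h4, h5⟩
    obtain ⟨h6, rfl⟩ := (D.top_eq_bot _ _).1 h2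
    rcases (not_lt.1 h1).eq_or_lt with rfl | h7
    · exact h5 rfl
    · exact h4 ⟨γ, h7, h6, rfl⟩

end ShiftedColumns

namespace ShiftedColumns

open ScrollVertex

variable {c m : ℕ} {X : Type*} (D : ShiftedColumns c m X) (K : Type*) [Field K]

/-! ### Linear independence of the standard monomials -/

/-- The minor on the columns of a chord. -/
noncomputable def minor (v : ScrollVertex c) : MvPolynomial X K :=
  MvPolynomial.X (D.top v.left) * MvPolynomial.X (D.bot v.right) -
    MvPolynomial.X (D.top v.right) * MvPolynomial.X (D.bot v.left)

/-- The map sending a chord to its minor. -/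
noncomputable def toMinors : MvPolynomial (ScrollVertex c) K →ₐ[K] MvPolynomial X K :=
  aeval (D.minor K)

variable {K}

/-- The additive extension of weights of variables to exponent vectors. -/
noncomputable def weightHom {Γ : Type*} [AddCommMonoid Γ] (w : X → Γ) : (X →₀ ℕ) →+ Γ :=
  (Finsupp.linearCombination ℕ w).toAddMonoidHom

theorem weightHom_single_add {Γ : Type*} [AddCommMonoid Γ] (w : X → Γ) (x y : X) :
    weightHom w (Finsupp.single x 1 + Finsupp.single y 1) = w x + w y := by
  simp [weightHom]

theorem toMinors_monomial (e : ScrollVertex c →₀ ℕ) (x : K) :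
    D.toMinors K (monomial e x) = C x * ∏ v, D.minor K v ^ e v := by
  rw [toMinors, aeval_monomial, algebraMap_eq, Finsupp.prod_fintype _ _ fun v => pow_zero _]

theorem monomial_eq_mul (x y : X) : (MvPolynomial.X x * MvPolynomial.X y : MvPolynomial X K) =
    monomial (Finsupp.single x 1 + Finsupp.single y 1) 1 := by
  rw [MvPolynomial.X, MvPolynomial.X, monomial_mul, one_mul]

theorem mem_support_minor {v : ScrollVertex c} {d : X →₀ ℕ} (h : d ∈ (D.minor K v).support) :
    d = Finsupp.single (D.top v.left) 1 + Finsupp.single (D.bot v.right) 1 ∨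
      d = Finsupp.single (D.top v.right) 1 + Finsupp.single (D.bot v.left) 1 := by
  classical
  rw [minor, monomial_eq_mul, monomial_eq_mul, mem_support_iff, coeff_sub, coeff_monomial,
    coeff_monomial] at h
  by_contra! hne
  rw [if_neg hne.1.symm, if_neg hne.2.symm, sub_zero] at h
  exact h rfl

theorem minor_isHomogeneous (v : ScrollVertex c) : (D.minor K v).IsHomogeneous 2 :=
  ((isHomogeneous_X K _).mul (isHomogeneous_X K _)).sub
    ((isHomogeneous_X K _).mul (isHomogeneous_X K _))

theorem degree_of_mem_support {e : ScrollVertex c →₀ ℕ} {d : X →₀ ℕ}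
    (h : coeff d (∏ v, D.minor K v ^ e v) ≠ 0) : d.degree = 2 * ∑ v, e v := by
  have := IsHomogeneous.prod Finset.univ (fun v => D.minor K v ^ e v) (fun v => 2 * e v)
    (fun v _ => (D.minor_isHomogeneous v).pow (e v))
  rw [Finset.mul_sum]
  by_contra hne
  exact h (this.coeff_eq_zero hne)

/-- The largest possible first weight of the monomials of a minor. -/
def chordBound (a : Fin c) (v : ScrollVertex c) : Lex (Fin c → ℤ) :=
  unitWeight v.left + unitWeight v.right - D.slope a

/-- The largest possible first weight of the monomials of a product of minors. -/
def prodBound (a : Fin c) (e : ScrollVertex c →₀ ℕ) :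
    Lex (Fin c → ℤ) := ∑ v, e v • D.chordBound a v

/-- For a fixed number of factors the bound depends on the column degree alone, and comparing bounds
is comparing column degrees lexicographically. -/
theorem prodBound_eq (a : Fin c) (e : ScrollVertex c →₀ ℕ) :
    D.prodBound a e = toLex (fun γ => (columnDegree e γ : ℤ)) - (∑ v, e v) • D.slope a := by
  simp only [prodBound, chordBound, nsmul_sub, Finset.sum_sub_distrib, Finset.sum_smul]
  congr 1
  have happ : ∀ (s : Finset (ScrollVertex c)) (f : ScrollVertex c → Lex (Fin c → ℤ)) (γ : Fin c),
      (∑ v ∈ s, f v) γ = ∑ v ∈ s, f v γ := by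
    classical
    intro s f γ
    induction s using Finset.induction_on with
    | empty => rfl
    | insert v s hv ih => rw [Finset.sum_insert hv, Finset.sum_insert hv, ← ih]; rfl
  funext γ
  rw [happ]
  change _ = ((columnDegree e γ : ℕ) : ℤ)
  rw [columnDegree, Nat.cast_sum]
  refine Finset.sum_congr rfl fun v _ => ?_
  change e v • ((Pi.single v.left 1 : Fin c → ℤ) γ + (Pi.single v.right 1 : Fin c → ℤ) γ) = _
  simp [Pi.single_apply, eq_comm]

variable [DecidableEq X]

/-- The first weight of exponent vectors. -/
noncomputable def firstWeight (a : Fin c) : (X →₀ ℕ) →+ Lex (Fin c → ℤ) :=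
  weightHom (D.varWeight a)

/-- The weight of exponent vectors. -/
noncomputable def fullWeight (a : Fin c) (rk : Fin c → ℕ) :
    (X →₀ ℕ) →+ Lex (Fin c → ℤ) ×ₗ ℤ where
  toFun d := toLex (D.firstWeight a d, weightHom (D.tieWeight a rk) d)
  map_zero' := by rw [map_zero, map_zero]; rfl
  map_add' d d' := by rw [map_add, map_add]; rfl

variable {D} {a : Fin c} {rk : Fin c → ℕ} {r : ℕ}

theorem firstWeight_le (γ δ : Fin c) :
    D.varWeight a (D.top γ) + D.varWeight a (D.bot δ) ≤
      unitWeight γ + unitWeight δ - D.slope a := by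
  rw [add_sub_assoc]
  exact add_le_add (D.varWeight_top_le a γ) (D.varWeight_bot_le a δ)

theorem firstWeight_lt (ham : (a : ℕ) < m) {γ δ : Fin c} (h : D.Far a γ ∨ δ < a) :
    D.varWeight a (D.top γ) + D.varWeight a (D.bot δ) <
      unitWeight γ + unitWeight δ - D.slope a := by
  rw [add_sub_assoc]
  rcases h with h | h
  · exact add_lt_add_of_lt_of_le (D.varWeight_top_lt h) (D.varWeight_bot_le a δ)
  · exact add_lt_add_of_le_of_lt (D.varWeight_top_le a γ) (D.varWeight_bot_lt ham h)

theorem firstWeight_eq (ham : (a : ℕ) < m) {γ δ : Fin c} (h1 : ¬ D.Far a γ) (h2 : ¬ δ < a) :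
    D.varWeight a (D.top γ) + D.varWeight a (D.bot δ) =
      unitWeight γ + unitWeight δ - D.slope a := by
  rw [add_sub_assoc, D.varWeight_top ham h1, D.varWeight_bot h2]

theorem weightLE_minor (v : ScrollVertex c) :
    WeightLE (D.firstWeight a) (D.minor K v) (D.chordBound a v) := by
  intro d hd
  rcases D.mem_support_minor hd with rfl | rfl
  · rw [firstWeight, weightHom_single_add, chordBound]
    exact firstWeight_le _ _
  · rw [firstWeight, weightHom_single_add, chordBound, add_comm (unitWeight v.left)]
    exact firstWeight_le _ _

/-- When both ends are left of `a` or both are far, each of the two monomials contains a variable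
whose weight stays below its bound. -/
theorem weightLT_minor (ham : (a : ℕ) < m) {v : ScrollVertex c} (hv : ¬ D.Allowed a v) :
    WeightLT (D.firstWeight a) (D.minor K v) (D.chordBound a v) := by
  have hor : (v.left < a ∧ v.right < a) ∨ (D.Far a v.left ∧ D.Far a v.right) := by
    unfold Allowed at hv; tauto
  intro d hd
  rcases D.mem_support_minor hd with rfl | rfl
  · rw [firstWeight, weightHom_single_add, chordBound]
    exact firstWeight_lt ham (by tauto)
  · rw [firstWeight, weightHom_single_add, chordBound, add_comm (unitWeight v.left)]
    exact firstWeight_lt ham (by tauto)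

/-- The leading exponent of the minor of an allowed chord. -/
noncomputable def leadExponent (D : ShiftedColumns c m X) (rk : Fin c → ℕ) (v : ScrollVertex c) :
    X →₀ ℕ :=
  Finsupp.single (D.top (lo rk v)) 1 + Finsupp.single (D.bot (hi rk v)) 1

theorem unitWeight_lo_add_hi (rk : Fin c → ℕ) (v : ScrollVertex c) :
    unitWeight (lo rk v) + unitWeight (hi rk v) = unitWeight v.left + unitWeight v.right := by
  rcases lo_hi rk v with ⟨p, q⟩ | ⟨p, q⟩ <;> rw [p, q]
  exact add_comm _ _

theorem IsRank.firstWeight_leadExponent (h : D.IsRank a rk r) (ham : (a : ℕ) < m)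
    {v : ScrollVertex c} (hv : D.Allowed a v) :
    D.firstWeight a (D.leadExponent rk v) = D.chordBound a v := by
  obtain ⟨h1, h2⟩ := h.allowed_iff.1 hv
  rw [firstWeight, leadExponent, weightHom_single_add, firstWeight_eq ham h2 h1, chordBound,
    unitWeight_lo_add_hi]

theorem IsRank.tieWeight_lt (h : D.IsRank a rk r) {γ δ : Fin c} (hγδ : rk γ < rk δ)
    (h1 : ¬ γ < a) (h2 : ¬ D.Far a γ) (h3 : ¬ δ < a) (h4 : ¬ D.Far a δ) :
    D.tieWeight a rk (D.top δ) + D.tieWeight a rk (D.bot γ) <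
      D.tieWeight a rk (D.top γ) + D.tieWeight a rk (D.bot δ) := by
  have hγ : γ ≠ D.next a := by
    rintro rfl
    have := h.lt_next δ h4 (fun e => by simp [e] at hγδ)
    omega
  have hsup : rk γ ≤ Finset.univ.sup rk := Finset.le_sup (f := rk) (Finset.mem_univ γ)
  rw [D.tieWeight_top rk h1 h2 hγ, D.tieWeight_bot rk h1, D.tieWeight_bot rk h3, if_neg hγ]
  by_cases hδ : δ = D.next a
  · rw [if_pos hδ, hδ, D.tieWeight_top_next]
    omega
  · rw [if_neg hδ, D.tieWeight_top rk h3 h4 hδ]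
    omega

/-- The other monomial loses already in the first weight if its upper entry is in a far column or
its lower entry in a column left of `a`. Otherwise both ends are in between, and the tie-breaking
weight decides by rank. -/
theorem IsRank.isLead_minor (h : D.IsRank a rk r) (ham : (a : ℕ) < m) {v : ScrollVertex c}
    (hv : D.Allowed a v) :
    IsLead (D.fullWeight a rk) (D.minor K v) (D.leadExponent rk v) := by
  obtain ⟨h1, h2⟩ := h.allowed_iff.1 hv
  have hrk := rk_lo_lt_rk_hi h.inj v
  set d' : X →₀ ℕ := Finsupp.single (D.top (hi rk v)) 1 + Finsupp.single (D.bot (lo rk v)) 1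
    with hd'
  have hlt : D.fullWeight a rk d' < D.fullWeight a rk (D.leadExponent rk v) := by
    change toLex (_, _) < toLex (_, _)
    rw [Prod.Lex.toLex_lt_toLex]
    simp only [firstWeight, leadExponent, hd', weightHom_single_add]
    rw [firstWeight_eq ham h2 h1, add_comm (unitWeight (lo rk v))]
    by_cases hor : D.Far a (hi rk v) ∨ lo rk v < a
    · exact Or.inl (firstWeight_lt ham hor)
    · push Not at hor
      exact Or.inr ⟨firstWeight_eq ham hor.1 (not_lt.2 hor.2),
        h.tieWeight_lt hrk (not_lt.2 hor.2) h2 h1 hor.1⟩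
  have hne : d' ≠ D.leadExponent rk v := fun e => by rw [e] at hlt; exact lt_irrefl _ hlt
  have hsupp : ∀ d ∈ (D.minor K v).support, d = D.leadExponent rk v ∨ d = d' := by
    intro d hd
    rw [hd', leadExponent]
    rcases lo_hi rk v with ⟨p, q⟩ | ⟨p, q⟩ <;> rw [p, q]
    · exact D.mem_support_minor hd
    · exact (D.mem_support_minor hd).symm
  refine ⟨?_, fun d hd hdne => ?_⟩
  · rw [minor, monomial_eq_mul, monomial_eq_mul, coeff_sub, coeff_monomial, coeff_monomial]
    rw [hd', leadExponent] at hne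
    rw [leadExponent]
    rcases lo_hi rk v with ⟨p, q⟩ | ⟨p, q⟩ <;> rw [p, q] at hne ⊢
    · rw [if_pos rfl, if_neg hne]; simp
    · rw [if_pos rfl, if_neg hne]; simp
  · rcases hsupp d hd with h3 | h3
    · exact absurd h3 hdne
    · rw [h3]; exact hlt

/-- The leading exponent of a product of minors of allowed chords. -/
noncomputable def prodExponent (D : ShiftedColumns c m X) (rk : Fin c → ℕ)
    (e : ScrollVertex c →₀ ℕ) : X →₀ ℕ := ∑ v, e v • D.leadExponent rk v

theorem IsRank.isLead_prod (h : D.IsRank a rk r) (ham : (a : ℕ) < m) {e : ScrollVertex c →₀ ℕ}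
    (he : ∀ v ∈ e.support, D.Allowed a v) :
    IsLead (D.fullWeight a rk) (∏ v, D.minor K v ^ e v) (D.prodExponent rk e) := by
  refine IsLead.prod _ _ _ fun v _ => ?_
  by_cases hv : e v = 0
  · rw [hv, pow_zero, zero_nsmul]; exact IsLead.one
  · exact (h.isLead_minor ham (he v (Finsupp.mem_support_iff.2 hv))).pow _

theorem weightLE_prod (e : ScrollVertex c →₀ ℕ) :
    WeightLE (D.firstWeight a) (∏ v, D.minor K v ^ e v) (D.prodBound a e) :=
  WeightLE.prod _ _ _ fun v _ => (weightLE_minor v).pow _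

theorem weightLT_prod (ham : (a : ℕ) < m) {e : ScrollVertex c →₀ ℕ} {v : ScrollVertex c}
    (hv : v ∈ e.support) (hall : ¬ D.Allowed a v) :
    WeightLT (D.firstWeight a) (∏ v, D.minor K v ^ e v) (D.prodBound a e) := by
  obtain ⟨n, hn⟩ := Nat.exists_eq_succ_of_ne_zero (Finsupp.mem_support_iff.1 hv)
  rw [prodBound, ← Finset.mul_prod_erase _ _ (Finset.mem_univ v),
    ← Finset.add_sum_erase _ _ (Finset.mem_univ v), hn, pow_succ', succ_nsmul']
  exact ((weightLT_minor ham hall).mul ((weightLE_minor v).pow n)).mul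
    (WeightLE.prod _ _ _ fun w _ => (weightLE_minor w).pow _)

theorem IsRank.firstWeight_prodExponent (h : D.IsRank a rk r) (ham : (a : ℕ) < m)
    {e : ScrollVertex c →₀ ℕ} (he : ∀ v ∈ e.support, D.Allowed a v) :
    D.firstWeight a (D.prodExponent rk e) = D.prodBound a e := by
  rw [prodExponent, prodBound, map_sum]
  refine Finset.sum_congr rfl fun v _ => ?_
  by_cases hv : e v = 0
  · rw [hv, zero_nsmul, zero_nsmul, map_zero]
  · rw [map_nsmul, h.firstWeight_leadExponent ham (he v (Finsupp.mem_support_iff.2 hv))]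

theorem IsRank.prodExponent_injOn (h : D.IsRank a rk r) (ham : (a : ℕ) < m)
    {e f : ScrollVertex c →₀ ℕ} (he : D.Face a e.support) (hf : D.Face a f.support)
    (heq : D.prodExponent rk e = D.prodExponent rk f) : e = f := by
  have hcast : ∀ e : ScrollVertex c →₀ ℕ, Fintype.linearCombination ℚ (D.vec rk)
      (fun v => (e v : ℚ)) = fun x => ((D.prodExponent rk e x : ℕ) : ℚ) := by
    intro e
    funext x
    rw [Fintype.linearCombination_apply, Finset.sum_apply, prodExponent, Finsupp.finsetSum_apply,
      Nat.cast_sum]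
    refine Finset.sum_congr rfl fun v _ => ?_
    simp [vec, leadExponent, Pi.single_apply, Finsupp.single_apply, mul_add, eq_comm]
  have hsupp : ∀ e : ScrollVertex c →₀ ℕ, nzSupport (fun v => (e v : ℚ)) = e.support := by
    intro e; ext v; simp [mem_nzSupport]
  have := h.eq_of_comb_eq ham (e := fun v => (e v : ℚ)) (f := fun v => (f v : ℚ))
    (fun v => Nat.cast_nonneg _) (fun v => Nat.cast_nonneg _) (by rwa [hsupp]) (by rwa [hsupp])
    (by rw [hcast, hcast, heq])
  ext v
  exact_mod_cast congrFun this v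

theorem lex_intCast_le {f g : Fin c → ℕ}
    (h : toLex (fun γ => (f γ : ℤ)) ≤ toLex fun γ => (g γ : ℤ)) : toLex f ≤ toLex g := by
  rcases h.eq_or_lt with h | ⟨i, h1, h2⟩
  · refine le_of_eq (congrArg toLex (funext fun γ => ?_))
    have : ((f γ : ℕ) : ℤ) = (g γ : ℤ) := congrFun (congrArg ofLex h) γ
    exact_mod_cast this
  · refine le_of_lt ⟨i, fun j hj => ?_, ?_⟩
    · have := h1 j hj
      change ((f j : ℕ) : ℤ) = (g j : ℤ) at this
      exact_mod_cast this
    · change ((f i : ℕ) : ℤ) < (g i : ℤ) at h2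
      exact_mod_cast h2

/-- A polynomial in the minors with standard monomials only vanishes only if it is zero. -/
theorem eq_zero_of_standard (hm : 3 ≤ m) (hmc : m ≤ c) {g : MvPolynomial (ScrollVertex c) K}
    (hg : D.toMinors K g = 0) (hst : ∀ e ∈ g.support, D.Standard e.support) : g = 0 := by
  classical
  by_contra hne
  obtain ⟨e₀, he₀, hmax⟩ := g.support.exists_max_image (fun e => toLex (columnDegree e))
    (support_nonempty.2 hne)
  obtain ⟨a, ha0, ha, hface⟩ := (hst e₀ he₀).exists_face hm hmc
  have ham : (a : ℕ) < m := by omega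
  obtain ⟨rk, r, h⟩ := D.exists_isRank ha hmc
  -- The leading monomial of the maximal `e₁` in `S` occurs in no other term. A term containing it
  -- has as many factors, by degree. The weight bound makes its column degree at least the maximal
  -- one, hence equal, and strictness of the bound rules out forbidden chords. So the term is in
  -- `S`, where leading exponents are distinct.
  set S := g.support.filter fun e => columnDegree e = columnDegree e₀ ∧
    ∀ v ∈ e.support, D.Allowed a v with hS
  obtain ⟨e₁, he₁, hmax₁⟩ := S.exists_max_image (fun e => D.fullWeight a rk (D.prodExponent rk e))
    ⟨e₀, Finset.mem_filter.2 ⟨he₀, rfl, fun v hv => (hface v hv).1⟩⟩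
  obtain ⟨hs₁, hd₁, hall₁⟩ := Finset.mem_filter.1 he₁
  have hfaceS : ∀ e ∈ S, D.Face a e.support := by
    intro e he v hv
    obtain ⟨h1, -, h2⟩ := Finset.mem_filter.1 he
    exact ⟨h2 v hv, fun u hu huv => hst e h1 u hu v hv (Or.inl huv)⟩
  have hlead := h.isLead_prod (K := K) ham hall₁
  have hzero : ∀ e ∈ g.support, e ≠ e₁ →
      coeff (D.prodExponent rk e₁) (∏ v, D.minor K v ^ e v) = 0 := by
    intro e he hee
    by_contra hc
    have hcard : ∑ v, e v = ∑ v, e₁ v := by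
      have h1 := D.degree_of_mem_support hc
      have h2 := D.degree_of_mem_support hlead.1
      omega
    have hmem := mem_support_iff.2 hc
    have hle := weightLE_prod (D := D) (a := a) e _ hmem
    rw [h.firstWeight_prodExponent ham hall₁] at hle
    have hle' := hle
    rw [prodBound_eq, prodBound_eq, hcard, sub_le_sub_iff_right] at hle'
    have hdeg : columnDegree e = columnDegree e₀ := by
      have h1 := lex_intCast_le hle'
      rw [hd₁] at h1
      exact toLex.injective (le_antisymm (hmax e he) h1)
    have hall : ∀ v ∈ e.support, D.Allowed a v := by
      intro v hv
      by_contra hnot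
      have hlt := weightLT_prod ham hv hnot _ hmem
      rw [h.firstWeight_prodExponent ham hall₁, prodBound_eq, prodBound_eq, hcard, hdeg, hd₁] at hlt
      exact lt_irrefl _ hlt
    have heS : e ∈ S := Finset.mem_filter.2 ⟨he, hdeg, hall⟩
    have hne' : D.prodExponent rk e₁ ≠ D.prodExponent rk e := fun heq =>
      hee (h.prodExponent_injOn ham (hfaceS e heS) (hfaceS e₁ he₁) heq.symm)
    exact not_lt.2 (hmax₁ e heS) ((h.isLead_prod ham hall).2 _ hmem hne')
  have hcoeff := congrArg (coeff (D.prodExponent rk e₁)) hg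
  rw [g.as_sum, map_sum, coeff_sum, coeff_zero, Finset.sum_eq_single e₁] at hcoeff
  · rw [toMinors_monomial, coeff_C_mul] at hcoeff
    exact mul_ne_zero (mem_support_iff.1 hs₁) hlead.1 hcoeff
  · intro e he hee
    rw [toMinors_monomial, coeff_C_mul, hzero e he hee, mul_zero]
  · intro hn; exact absurd hs₁ hn

end ShiftedColumns

/-! ### Initial ideals generated by squarefree quadrics -/

section QuadraticInitialIdeal

variable {σ K : Type*} [Field K] {m : MonomialOrder σ} {P : Ideal (MvPolynomial σ K)}

theorem mem_initialIdeal_iff {p : MvPolynomial σ K} :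
    p ∈ initialIdeal m P ↔ ∀ d ∈ p.support, ∃ f ∈ P, f ≠ 0 ∧ m.degree f ≤ d := by
  have : {t : MvPolynomial σ K | ∃ f ∈ P, f ≠ 0 ∧ t = monomial (m.degree f) (1 : K)} =
      (fun s => monomial s (1 : K)) '' {e | ∃ f ∈ P, f ≠ 0 ∧ m.degree f = e} := by
    ext t
    constructor
    · rintro ⟨f, hf, h0, rfl⟩
      exact ⟨_, ⟨f, hf, h0, rfl⟩, rfl⟩
    · rintro ⟨_, ⟨f, hf, h0, rfl⟩, rfl⟩
      exact ⟨f, hf, h0, rfl⟩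
  rw [initialIdeal, this, mem_ideal_span_monomial_image]
  refine forall₂_congr fun d _ => ?_
  constructor
  · rintro ⟨_, ⟨f, hf, h0, rfl⟩, h⟩
    exact ⟨f, hf, h0, h⟩
  · rintro ⟨f, hf, h0, h⟩
    exact ⟨_, ⟨f, hf, h0, rfl⟩, h⟩

theorem degree_eq_of_forall_lt {f : MvPolynomial σ K} {e : σ →₀ ℕ} (he : coeff e f ≠ 0)
    (h : ∀ d ∈ f.support, d ≠ e → m.toSyn d < m.toSyn e) : m.degree f = e := by
  by_contra hne
  have hf : f ≠ 0 := by rintro rfl; simp at he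
  exact not_lt.2 (m.le_degree (mem_support_iff.2 he)) (h _ (m.degree_mem_support hf) hne)

theorem single_add_single_le {u v : σ} (huv : u ≠ v) {e : σ →₀ ℕ} (hu : u ∈ e.support)
    (hv : v ∈ e.support) : Finsupp.single u 1 + Finsupp.single v 1 ≤ e := by
  classical
  rw [Finsupp.mem_support_iff] at hu hv
  intro w
  rw [Finsupp.add_apply, Finsupp.single_apply, Finsupp.single_apply]
  split_ifs with h1 h2 h2
  · exact absurd (h1.trans h2.symm) huv
  · subst h1; omega
  · subst h2; omega
  · omega

theorem prod_X_eq_monomial (F : Finset σ) :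
    (∏ v ∈ F, X v : MvPolynomial σ K) = monomial (∑ v ∈ F, Finsupp.single v 1) 1 := by
  rw [monomial_sum_one]; rfl

theorem support_sum_single (F : Finset σ) :
    (∑ v ∈ F, Finsupp.single v 1 : σ →₀ ℕ).support = F := by
  classical
  ext w
  simp [Finsupp.mem_support_iff, Finsupp.finsetSum_apply, Finsupp.single_apply]

variable {Bad : σ → σ → Prop}

/-- If the monomials that avoid certain squarefree quadratic leading monomials of an ideal are
linearly independent modulo the ideal, then these quadrics divide all leading monomials. -/
theorem exists_bad_of_mem (hne : ∀ u v, Bad u v → u ≠ v)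
    (hbad : ∀ u v, Bad u v → ∃ f ∈ P, f ≠ 0 ∧
      m.degree f = Finsupp.single u 1 + Finsupp.single v 1)
    (hind : ∀ g ∈ P, (∀ e ∈ g.support, ∀ u ∈ e.support, ∀ v ∈ e.support, ¬ Bad u v) → g = 0)
    {f : MvPolynomial σ K} (hf : f ∈ P) (hf0 : f ≠ 0) :
    ∃ u ∈ (m.degree f).support, ∃ v ∈ (m.degree f).support, Bad u v := by
  classical
  by_contra! hstd
  -- Division by all of `P` leaves a remainder `r` without bad pairs. The difference to the monomial
  -- lies in `P` and has no bad pairs either, so it is zero; but then the remainder is the leading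
  -- monomial of `f`, which is divisible by itself.
  obtain ⟨q, r, h1, -, h3⟩ := m.div_set (B := {b | b ∈ P ∧ b ≠ 0})
    (fun b hb => (m.leadingCoeff_ne_zero_iff.2 hb.2).isUnit) (monomial (m.degree f) (1 : K))
  have hmem : monomial (m.degree f) (1 : K) - r ∈ P := by
    rw [h1, add_sub_cancel_right, Finsupp.linearCombination_apply]
    exact Ideal.sum_mem _ fun b _ => Ideal.mul_mem_left _ _ b.2.1
  have hzero := hind _ hmem fun e he u hu v hv huv => by
    rcases Finset.mem_union.1 (support_sub σ _ _ he) with he | he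
    · rw [support_monomial, if_neg one_ne_zero, Finset.mem_singleton] at he
      subst he
      exact hstd u hu v hv huv
    · obtain ⟨b, hb, hb0, hdeg⟩ := hbad u v huv
      exact h3 e he b ⟨hb, hb0⟩ (hdeg ▸ single_add_single_le (hne u v huv) hu hv)
  refine h3 (m.degree f) ?_ f ⟨hf, hf0⟩ le_rfl
  rw [← sub_eq_zero.1 hzero, mem_support_iff, coeff_monomial, if_pos rfl]
  exact one_ne_zero

theorem prod_X_mem_initialIdeal_iff (hne : ∀ u v, Bad u v → u ≠ v)
    (hbad : ∀ u v, Bad u v → ∃ f ∈ P, f ≠ 0 ∧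
      m.degree f = Finsupp.single u 1 + Finsupp.single v 1)
    (hind : ∀ g ∈ P, (∀ e ∈ g.support, ∀ u ∈ e.support, ∀ v ∈ e.support, ¬ Bad u v) → g = 0)
    (F : Finset σ) :
    (∏ v ∈ F, X v : MvPolynomial σ K) ∈ initialIdeal m P ↔ ∃ u ∈ F, ∃ v ∈ F, Bad u v := by
  classical
  rw [prod_X_eq_monomial, mem_initialIdeal_iff, support_monomial, if_neg one_ne_zero]
  simp only [Finset.mem_singleton, forall_eq]
  constructor
  · rintro ⟨f, hf, hf0, hle⟩
    obtain ⟨u, hu, v, hv, h⟩ := exists_bad_of_mem hne hbad hind hf hf0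
    have hs := Finsupp.support_mono hle
    rw [support_sum_single] at hs
    exact ⟨u, hs hu, v, hs hv, h⟩
  · rintro ⟨u, hu, v, hv, h⟩
    obtain ⟨f, hf, hf0, hdeg⟩ := hbad u v h
    refine ⟨f, hf, hf0, hdeg ▸ single_add_single_le (hne u v h) ?_ ?_⟩ <;>
    rwa [support_sum_single]

/-- In the situation of `exists_bad_of_mem` the initial ideal is a Stanley–Reisner ideal. -/
theorem initialIdeal_eq_stanleyReisnerIdeal (hne : ∀ u v, Bad u v → u ≠ v)
    (hbad : ∀ u v, Bad u v → ∃ f ∈ P, f ≠ 0 ∧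
      m.degree f = Finsupp.single u 1 + Finsupp.single v 1)
    (hind : ∀ g ∈ P, (∀ e ∈ g.support, ∀ u ∈ e.support, ∀ v ∈ e.support, ¬ Bad u v) → g = 0) :
    initialIdeal m P = stanleyReisnerIdeal K (stanleyReisnerComplex (initialIdeal m P)) := by
  classical
  apply le_antisymm
  · refine Ideal.span_le.2 ?_
    rintro _ ⟨f, hf, hf0, rfl⟩
    obtain ⟨u, hu, v, hv, h⟩ := exists_bad_of_mem hne hbad hind hf hf0
    have hle := single_add_single_le (hne u v h) hu hv
    have hprod : (∏ w ∈ ({u, v} : Finset σ), X w : MvPolynomial σ K) =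
        monomial (Finsupp.single u 1 + Finsupp.single v 1) 1 := by
      rw [prod_X_eq_monomial, Finset.sum_pair (hne u v h)]
    have hmem : (monomial (Finsupp.single u 1 + Finsupp.single v 1) 1 : MvPolynomial σ K) ∈
        stanleyReisnerIdeal K (stanleyReisnerComplex (initialIdeal m P)) := by
      rw [← hprod]
      refine Ideal.subset_span ⟨{u, v}, Finset.insert_nonempty _ _, fun hF => hF.2 ?_, rfl⟩
      exact (prod_X_mem_initialIdeal_iff hne hbad hind _).2 ⟨u, by simp, v, by simp, h⟩
    obtain ⟨e, he⟩ := exists_add_of_le hle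
    have : (monomial (m.degree f) 1 : MvPolynomial σ K) =
        monomial e 1 * monomial (Finsupp.single u 1 + Finsupp.single v 1) 1 := by
      rw [monomial_mul, one_mul, he, add_comm]
    rw [this]
    exact Ideal.mul_mem_left _ _ hmem
  · refine Ideal.span_le.2 ?_
    rintro _ ⟨F, hF, hnot, rfl⟩
    by_contra h
    exact hnot ⟨hF, h⟩

end QuadraticInitialIdeal

/-! ### The leading monomials of the quadratic relations -/

open ScrollVertex

section ScrollOrder

variable {c : ℕ}

theorem toSyn_lt_of_columnDegree_lt {e f : ScrollVertex c →₀ ℕ}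
    (h : toLex (columnDegree e) < toLex (columnDegree f)) :
    (scrollOrder c).toSyn e < (scrollOrder c).toSyn f :=
  scrollOrder_lt_iff.2 (Prod.Lex.toLex_lt_toLex.2 (Or.inl h))

theorem toSyn_lt_of_chordWeight_lt {e f : ScrollVertex c →₀ ℕ}
    (h : columnDegree e = columnDegree f) (h' : chordWeight e < chordWeight f) :
    (scrollOrder c).toSyn e < (scrollOrder c).toSyn f :=
  scrollOrder_lt_iff.2 (Prod.Lex.toLex_lt_toLex.2
    (Or.inr ⟨congrArg toLex h, Prod.Lex.toLex_lt_toLex.2 (Or.inl h')⟩))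

/-- The column degree of a single column. -/
def columnUnit (γ : Fin c) : Fin c → ℕ := fun δ => if γ = δ then 1 else 0

theorem columnDegree_add (e f : ScrollVertex c →₀ ℕ) :
    columnDegree (e + f) = columnDegree e + columnDegree f := by
  funext γ; simp [columnDegree, add_mul, Finset.sum_add_distrib]

theorem columnDegree_single (v : ScrollVertex c) :
    columnDegree (Finsupp.single v 1) = columnUnit v.left + columnUnit v.right := by
  funext γ
  simp [columnDegree, columnUnit, Finsupp.single_apply]

theorem chordWeight_single_add (u v : ScrollVertex c) :
    chordWeight (Finsupp.single u 1 + Finsupp.single v 1) = u.weight + v.weight := by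
  simp [chordWeight, weight, add_mul, Finset.sum_add_distrib, Finsupp.single_apply]

theorem columnUnit_lex_lt {β y z q r s : Fin c} {e e' : Fin c → ℕ} (he : ∀ j ≤ β, e j = e' j)
    (hq : β < q) (hr : β < r) (hs : β < s) (hy : β < y) (hz : β < z) :
    toLex (e + columnUnit q + columnUnit r + columnUnit s) <
      toLex (e' + columnUnit β + columnUnit y + columnUnit z) := by
  have h : ∀ w j : Fin c, j < w → columnUnit w j = 0 := fun w j hw => if_neg hw.ne'
  refine ⟨β, fun j hj => ?_, ?_⟩
  · change e j + columnUnit q j + columnUnit r j + columnUnit s j =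
      e' j + columnUnit β j + columnUnit y j + columnUnit z j
    rw [he j hj.le, h q j (hj.trans hq), h r j (hj.trans hr), h s j (hj.trans hs),
      h y j (hj.trans hy), h z j (hj.trans hz), h β j hj]
  · change e β + columnUnit q β + columnUnit r β + columnUnit s β <
      e' β + columnUnit β β + columnUnit y β + columnUnit z β
    rw [he β le_rfl, h q β hq, h r β hr, h s β hs, h y β hy, h z β hz,
      show columnUnit β β = 1 from if_pos rfl]
    omega

end ScrollOrder

/-! ### The Plücker relations and the relations from repeated rows -/

namespace ShiftedColumns

variable {c m : ℕ} {X : Type*} (D : ShiftedColumns c m X) (K : Type*) [Field K]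

/-- The variable of the chord with the given end points, as an alternating function. -/
noncomputable def altVar (x y : Fin c) : MvPolynomial (ScrollVertex c) K :=
  if h : x = y then 0 else
    if x < y then MvPolynomial.X (pair x y h) else -MvPolynomial.X (pair x y h)

variable {K}

theorem altVar_of_lt (v : ScrollVertex c) : altVar K v.left v.right = MvPolynomial.X v := by
  have h := v.left_lt_right
  rw [altVar, dif_neg h.ne, if_pos h]
  congr 1
  exact ext_ends (by simp [h.le]) (by simp [h.le])

theorem toMinors_altVar (x y : Fin c) : D.toMinors K (altVar K x y) =
    MvPolynomial.X (D.top x) * MvPolynomial.X (D.bot y) -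
      MvPolynomial.X (D.top y) * MvPolynomial.X (D.bot x) := by
  unfold altVar
  split_ifs with h1 h2
  · subst h1; rw [map_zero, sub_self]
  · rw [toMinors, aeval_X, minor, left_pair, right_pair, min_eq_left h2.le, max_eq_right h2.le]
  · rw [map_neg, toMinors, aeval_X, minor, left_pair, right_pair, min_eq_right (not_lt.1 h2),
      max_eq_left (not_lt.1 h2), neg_sub]

theorem exists_altVar_mul (x y z w : Fin c) :
    altVar K x y * altVar K z w = 0 ∨ ∃ e, columnDegree e = columnUnit x + columnUnit y +
      columnUnit z + columnUnit w ∧ ∃ s : K, altVar K x y * altVar K z w = monomial e s := by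
  have key : ∀ x y : Fin c, altVar K x y = 0 ∨ ∃ e, columnDegree e = columnUnit x + columnUnit y ∧
      ∃ s : K, altVar K x y = monomial e s := by
    intro x y
    unfold altVar
    split_ifs with h1 h2
    · exact Or.inl rfl
    · refine Or.inr ⟨_, ?_, 1, rfl⟩
      rw [columnDegree_single, left_pair, right_pair, min_eq_left h2.le, max_eq_right h2.le]
    · refine Or.inr ⟨Finsupp.single (pair x y h1) 1, ?_, -1, by rw [map_neg]; rfl⟩
      rw [columnDegree_single, left_pair, right_pair, min_eq_right (not_lt.1 h2),
        max_eq_left (not_lt.1 h2), add_comm]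
  rcases key x y with h | ⟨e, he, s, hs⟩
  · left; rw [h, zero_mul]
  rcases key z w with h | ⟨f, hf, t, ht⟩
  · left; rw [h, mul_zero]
  · exact Or.inr ⟨e + f, by rw [columnDegree_add, he, hf]; simp only [add_assoc], s * t,
      by rw [hs, ht, monomial_mul]⟩

/-- The polynomials with monomials smaller than a given one. -/
noncomputable def below (K : Type*) [Field K] (e : ScrollVertex c →₀ ℕ) :
    Submodule K (MvPolynomial (ScrollVertex c) K) :=
  restrictSupport K {d | (scrollOrder c).toSyn d < (scrollOrder c).toSyn e}

theorem monomial_mem_below {e d : ScrollVertex c →₀ ℕ}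
    (h : (scrollOrder c).toSyn d < (scrollOrder c).toSyn e) (s : K) :
    monomial d s ∈ below K e := by
  classical
  rw [below, mem_restrictSupport_iff]
  intro d' hd'
  have := support_monomial_subset hd'
  rw [Finset.mem_singleton] at this
  subst this
  exact h

theorem degree_of_sub_mem_below {f : MvPolynomial (ScrollVertex c) K} {e : ScrollVertex c →₀ ℕ}
    (h : f - monomial e 1 ∈ below K e) : f ≠ 0 ∧ (scrollOrder c).degree f = e := by
  classical
  rw [below, mem_restrictSupport_iff] at h
  have hcoeff : ∀ d, coeff d (f - monomial e 1) ≠ 0 →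
      (scrollOrder c).toSyn d < (scrollOrder c).toSyn e :=
    fun d hd => h (mem_support_iff.2 hd)
  have he : coeff e f = 1 := by
    by_contra hne
    refine lt_irrefl _ (hcoeff e ?_)
    rwa [coeff_sub, coeff_monomial, if_pos rfl, sub_ne_zero]
  refine ⟨fun h0 => ?_, degree_eq_of_forall_lt (by rw [he]; exact one_ne_zero) fun d hd hde => ?_⟩
  · rw [h0, coeff_zero] at he
    exact zero_ne_one he
  · refine hcoeff d ?_
    rw [coeff_sub, coeff_monomial, if_neg hde.symm, sub_zero]
    exact mem_support_iff.1 hd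

theorem altVar_mul_mem_below {e : ScrollVertex c →₀ ℕ} {x y z w : Fin c}
    (h : toLex (columnUnit x + columnUnit y + columnUnit z + columnUnit w) <
      toLex (columnDegree e)) : altVar K x y * altVar K z w ∈ below K e := by
  rcases exists_altVar_mul (K := K) x y z w with h0 | ⟨f, hf, s, hs⟩
  · rw [h0]; exact Submodule.zero_mem _
  · rw [hs]
    exact monomial_mem_below (toSyn_lt_of_columnDegree_lt (hf ▸ h)) s

/-- This is the three-term Plücker relation. Its terms have the same column degree, and the chord
weight singles out the crossing pair. -/
theorem exists_degree_eq_of_cross {u v : ScrollVertex c} (h : u.Cross v) :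
    ∃ f, D.toMinors K f = 0 ∧ f ≠ 0 ∧
      (scrollOrder c).degree f = Finsupp.single u 1 + Finsupp.single v 1 := by
  obtain ⟨h1, h2, h3⟩ := h
  set p := pair u.left v.left h1.ne
  set q := pair u.right v.right h3.ne
  set s := pair u.left v.right (h1.trans (h2.trans h3)).ne
  set t := pair v.left u.right h2.ne
  have hp : p.left = u.left ∧ p.right = v.left := ⟨min_eq_left h1.le, max_eq_right h1.le⟩
  have hq : q.left = u.right ∧ q.right = v.right := ⟨min_eq_left h3.le, max_eq_right h3.le⟩
  have hs : s.left = u.left ∧ s.right = v.right :=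
    ⟨min_eq_left (h1.trans (h2.trans h3)).le, max_eq_right (h1.trans (h2.trans h3)).le⟩
  have ht : t.left = v.left ∧ t.right = u.right := ⟨min_eq_left h2.le, max_eq_right h2.le⟩
  refine ⟨MvPolynomial.X u * MvPolynomial.X v - MvPolynomial.X p * MvPolynomial.X q -
    MvPolynomial.X s * MvPolynomial.X t, ?_, degree_of_sub_mem_below ?_⟩
  · simp only [toMinors, map_sub, map_mul, aeval_X, minor, hp.1, hp.2, hq.1, hq.2, hs.1, hs.2,
      ht.1, ht.2]
    ring
  · rw [monomial_eq_mul, monomial_eq_mul, monomial_eq_mul, sub_sub _ (monomial (Finsupp.single p 1 + Finsupp.single q 1) 1), sub_sub_cancel_left,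
      neg_add']
    refine Submodule.sub_mem _ (Submodule.neg_mem _ ?_) ?_
    · refine monomial_mem_below (toSyn_lt_of_chordWeight_lt ?_ ?_) 1
      · rw [columnDegree_add, columnDegree_add, columnDegree_single, columnDegree_single,
          columnDegree_single, columnDegree_single, hp.1, hp.2, hq.1, hq.2]
        abel
      · rw [chordWeight_single_add, chordWeight_single_add]
        exact weight_lt_of_cross ⟨h1, h2, h3⟩ (Or.inl ⟨hp.1, hp.2, hq.1, hq.2⟩)
    · refine monomial_mem_below (toSyn_lt_of_chordWeight_lt ?_ ?_) 1
      · rw [columnDegree_add, columnDegree_add, columnDegree_single, columnDegree_single,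
          columnDegree_single, columnDegree_single, hs.1, hs.2, ht.1, ht.2]
        abel
      · rw [chordWeight_single_add, chordWeight_single_add]
        exact weight_lt_of_cross ⟨h1, h2, h3⟩ (Or.inr ⟨hs.1, hs.2, ht.1, ht.2⟩)

/-- On the columns `α, β, γ, δ` take the 4×4 determinant whose rows are the upper entries, the lower
entries, and the upper and lower entries of the shifts. Its second and third rows coincide, so its
Laplace expansion along the first two rows vanishes. The column degree selects the leading term:
every other term has either all columns right of `α`, or `α` and three columns right of `β`. The
order of `γ` and `δ` is unknown, whence the alternating `altVar`. -/
theorem exists_degree_eq_of_far {u v : ScrollVertex c} (h : D.Far u.right v.left)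
    (h' : D.Far u.right v.right) :
    ∃ f, D.toMinors K f = 0 ∧ f ≠ 0 ∧
      (scrollOrder c).degree f = Finsupp.single u 1 + Finsupp.single v 1 := by
  obtain ⟨γ, hγ, hγm, hγv⟩ := h
  obtain ⟨δ, hδ, hδm, hδv⟩ := h'
  have hu := u.left_lt_right
  set α := u.left with hα
  set β := u.right with hβ
  have hβm : (β : ℕ) < m := lt_trans hγ hγm
  have hαm : (α : ℕ) < m := lt_trans hu hβm
  have hshift : ∀ x : Fin c, (x : ℕ) < m → D.top (D.next x) = D.bot x :=
    fun x hx => (D.top_eq_bot _ _).2 ⟨hx, rfl⟩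
  have hα' := D.lt_next α hαm
  have hβ' := D.lt_next β hβm
  have hγ' := D.lt_next γ hγm
  have hδ' := D.lt_next δ hδm
  have hcol : columnDegree (Finsupp.single u 1 + Finsupp.single v 1) = columnUnit α +
      columnUnit β + columnUnit (D.next γ) + columnUnit (D.next δ) := by
    rw [columnDegree_add, columnDegree_single, columnDegree_single, hγv, hδv, ← add_assoc]
  have hfirst : ∀ p q r s, α < p → α < q → α < r → α < s →
      altVar K p q * altVar K r s ∈ below K (Finsupp.single u 1 + Finsupp.single v 1) := by
    intro p q r s hp hq hr hs
    refine altVar_mul_mem_below ?_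
    rw [hcol, add_comm (columnUnit α)]
    refine columnUnit_lex_lt (fun j hj => ?_) hq hr hs (hu.trans (hγ.trans hγ'))
      (hu.trans (hδ.trans hδ'))
    exact (if_neg (hj.trans_lt hp).ne').trans (if_neg (hj.trans_lt hu).ne').symm
  have hsecond : ∀ q r s, β < q → β < r → β < s →
      altVar K α q * altVar K r s ∈ below K (Finsupp.single u 1 + Finsupp.single v 1) := by
    intro q r s hq hr hs
    refine altVar_mul_mem_below ?_
    rw [hcol]
    exact columnUnit_lex_lt (fun _ _ => rfl) hq hr hs (hγ.trans hγ') (hδ.trans hδ')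
  refine ⟨altVar K α β * altVar K (D.next γ) (D.next δ) -
    altVar K α γ * altVar K (D.next β) (D.next δ) +
    altVar K α δ * altVar K (D.next β) (D.next γ) +
    altVar K β γ * altVar K (D.next α) (D.next δ) -
    altVar K β δ * altVar K (D.next α) (D.next γ) +
    altVar K γ δ * altVar K (D.next α) (D.next β), ?_, degree_of_sub_mem_below ?_⟩
  · simp only [map_sub, map_add, map_mul, toMinors_altVar, hshift _ hαm, hshift _ hβm,
      hshift _ hγm, hshift _ hδm]
    ring
  · have hlead : altVar K α β * altVar K (D.next γ) (D.next δ) =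
        monomial (Finsupp.single u 1 + Finsupp.single v 1) 1 := by
      rw [hγv, hδv, hα, hβ, altVar_of_lt, altVar_of_lt, monomial_eq_mul]
    rw [← hlead]
    have e1 := hsecond γ (D.next β) (D.next δ) hγ hβ' (hδ.trans hδ')
    have e2 := hsecond δ (D.next β) (D.next γ) hδ hβ' (hγ.trans hγ')
    have e3 := hfirst β γ (D.next α) (D.next δ) hu (hu.trans hγ) hα' (hu.trans (hδ.trans hδ'))
    have e4 := hfirst β δ (D.next α) (D.next γ) hu (hu.trans hδ) hα' (hu.trans (hγ.trans hγ'))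
    have e5 := hfirst γ δ (D.next α) (D.next β) (hu.trans hγ) (hu.trans hδ) hα' (hu.trans hβ')
    convert Submodule.add_mem _ (Submodule.sub_mem _ (Submodule.add_mem _
      (Submodule.sub_mem _ e2 e1) e3) e4) e5 using 1
    ring

/-- The initial ideal of the ideal of relations is squarefree, and the faces of the initial complex
are the standard sets. -/
theorem initialIdeal_ker_toMinors (hm : 3 ≤ m) (hmc : m ≤ c) :
    initialIdeal (scrollOrder c) (RingHom.ker (D.toMinors K)) = stanleyReisnerIdeal K
        (stanleyReisnerComplex (initialIdeal (scrollOrder c) (RingHom.ker (D.toMinors K)))) ∧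
      ∀ F, F ∈ (stanleyReisnerComplex
        (initialIdeal (scrollOrder c) (RingHom.ker (D.toMinors K)))).faces ↔
          F.Nonempty ∧ D.Standard F := by
  classical
  have hne : ∀ u v, D.Bad u v → u ≠ v := by
    rintro u v h rfl
    rcases h with h | ⟨h, -⟩
    · exact lt_irrefl _ h.1
    · exact lt_asymm (D.lt_of_far h) u.left_lt_right
  have hbad : ∀ u v, D.Bad u v → ∃ f ∈ RingHom.ker (D.toMinors K), f ≠ 0 ∧
      (scrollOrder c).degree f = Finsupp.single u 1 + Finsupp.single v 1 := by
    rintro u v (h | ⟨h, h'⟩)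
    · exact D.exists_degree_eq_of_cross h
    · exact D.exists_degree_eq_of_far h h'
  have hind : ∀ g ∈ RingHom.ker (D.toMinors K),
      (∀ e ∈ g.support, ∀ u ∈ e.support, ∀ v ∈ e.support, ¬ D.Bad u v) → g = 0 :=
    fun g hg hst => eq_zero_of_standard hm hmc hg hst
  refine ⟨initialIdeal_eq_stanleyReisnerIdeal hne hbad hind, fun F => and_congr_right fun _ => ?_⟩
  rw [prod_X_mem_initialIdeal_iff hne hbad hind]
  simp only [Standard]
  push Not
  rfl

end ShiftedColumns

/-! ### The columns of a rational normal scroll -/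

section Scroll

variable {d : ℕ} {n : Fin d → ℕ}

/-- The order in which the columns of a scroll are listed. -/
def ColumnBefore (p q : Σ i : Fin d, Fin (n i)) : Prop :=
  ((p.2 : ℕ) + 1 < n p.1 ∧ (q.2 : ℕ) + 1 < n q.1 ∧
    ((p.2 : ℕ) < q.2 ∨ (p.2 : ℕ) = q.2 ∧ (p.1 : ℕ) < q.1)) ∨
  ((p.2 : ℕ) + 1 < n p.1 ∧ (q.2 : ℕ) + 1 = n q.1) ∨
  ((p.2 : ℕ) + 1 = n p.1 ∧ (q.2 : ℕ) + 1 = n q.1 ∧ (q.1 : ℕ) < p.1)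

theorem ColumnBefore.asymm {p q : Σ i : Fin d, Fin (n i)} (h : ColumnBefore p q) :
    ¬ ColumnBefore q p := by
  unfold ColumnBefore at *; omega

theorem sigma_fin_ext {f : Fin d → ℕ} {x y : Σ i : Fin d, Fin (f i)} (h1 : x.1 = y.1)
    (h2 : (x.2 : ℕ) = y.2) : x = y := by
  obtain ⟨i, j⟩ := x
  obtain ⟨i', j'⟩ := y
  obtain rfl : i = i' := h1
  exact congrArg _ (Fin.ext h2)

variable (n) in
/-- The columns of a scroll that are not the last ones of their blocks. -/
def innerColumns : List (Σ i : Fin d, Fin (n i)) :=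
  (List.range (∑ i, n i)).flatMap fun j =>
    (List.finRange d).filterMap fun i =>
      if h : j + 1 < n i then some ⟨i, ⟨j, by omega⟩⟩ else none

variable (n) in
/-- The last columns of the blocks of a scroll. -/
def lastColumns : List (Σ i : Fin d, Fin (n i)) :=
  (List.finRange d).reverse.filterMap fun i =>
    if h : 0 < n i then some ⟨i, ⟨n i - 1, by omega⟩⟩ else none

theorem scrollColumns_eq : scrollColumns n = innerColumns n ++ lastColumns n := rfl

theorem mem_innerColumns {p : Σ i : Fin d, Fin (n i)} (h : p ∈ innerColumns n) :
    (p.2 : ℕ) + 1 < n p.1 := by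
  simp only [innerColumns, List.mem_flatMap, List.mem_filterMap] at h
  obtain ⟨j, -, i, -, h⟩ := h
  split_ifs at h with hj
  cases h
  exact hj

theorem mem_lastColumns {p : Σ i : Fin d, Fin (n i)} (h : p ∈ lastColumns n) :
    (p.2 : ℕ) + 1 = n p.1 := by
  simp only [lastColumns, List.mem_filterMap] at h
  obtain ⟨i, -, h⟩ := h
  split_ifs at h with hj
  cases h
  exact Nat.sub_add_cancel hj

theorem pairwise_scrollColumns : (scrollColumns n).Pairwise ColumnBefore := by
  rw [scrollColumns_eq, List.pairwise_append]
  refine ⟨?_, ?_, fun p hp q hq => Or.inr (Or.inl ⟨mem_innerColumns hp, mem_lastColumns hq⟩)⟩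
  · rw [innerColumns, List.pairwise_flatMap]
    refine ⟨fun j _ => ?_, ?_⟩
    · rw [List.pairwise_filterMap]
      refine (List.pairwise_lt_finRange d).imp fun {i i'} hlt p hp q hq => ?_
      split_ifs at hp hq with h1 h2
      cases hp; cases hq
      exact Or.inl ⟨h1, h2, Or.inr ⟨rfl, hlt⟩⟩
    · refine List.pairwise_lt_range.imp fun {j j'} hlt p hp q hq => ?_
      rw [List.mem_filterMap] at hp hq
      obtain ⟨i, -, hp⟩ := hp
      obtain ⟨i', -, hq⟩ := hq
      split_ifs at hp hq with h1 h2
      cases hp; cases hq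
      exact Or.inl ⟨h1, h2, Or.inl hlt⟩
  · rw [lastColumns, List.pairwise_filterMap, List.pairwise_reverse]
    refine (List.pairwise_lt_finRange d).imp fun {i i'} hlt p hp q hq => ?_
    split_ifs at hp hq with h1 h2
    cases hp; cases hq
    exact Or.inr (Or.inr ⟨Nat.sub_add_cancel h1, Nat.sub_add_cancel h2, hlt⟩)

theorem columnBefore_of_lt {α β : Fin (∑ i, n i)} (h : α < β) :
    ColumnBefore (scrollColumn n α) (scrollColumn n β) :=
  List.pairwise_iff_getElem.1 pairwise_scrollColumns _ _ _ _ h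

theorem columnBefore_iff {α β : Fin (∑ i, n i)} :
    ColumnBefore (scrollColumn n α) (scrollColumn n β) ↔ α < β := by
  refine ⟨fun h => ?_, columnBefore_of_lt⟩
  rcases lt_trichotomy α β with h' | rfl | h'
  · exact h'
  · exact absurd h h.asymm
  · exact absurd h (columnBefore_of_lt h').asymm

theorem scrollColumn_bijective : Function.Bijective (scrollColumn n) := by
  refine (Fintype.bijective_iff_injective_and_card _).2 ⟨fun α β h => ?_, by simp⟩
  rcases lt_trichotomy α β with h' | h' | h'
  · have := columnBefore_of_lt h'
    rw [h] at this
    exact absurd this this.asymm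
  · exact h'
  · have := columnBefore_of_lt h'
    rw [h] at this
    exact absurd this this.asymm

theorem length_lastColumns (hpos : ∀ i, 0 < n i) : (lastColumns n).length = d := by
  rw [lastColumns, length_filterMap_dite]
  simp [hpos]

theorem lt_sub_iff (hpos : ∀ i, 0 < n i) (α : Fin (∑ i, n i)) :
    (α : ℕ) < ∑ i, n i - d ↔ ((scrollColumn n α).2 : ℕ) + 1 < n (scrollColumn n α).1 := by
  have hlen := length_scrollColumns n
  rw [scrollColumns_eq, List.length_append, length_lastColumns hpos] at hlen
  have hinner : (innerColumns n).length = ∑ i, n i - d := by omega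
  have hcol : scrollColumn n α = (innerColumns n ++ lastColumns n)[(α : ℕ)]'(by
    rw [← scrollColumns_eq, length_scrollColumns]; exact α.2) := rfl
  by_cases h : (α : ℕ) < (innerColumns n).length
  · rw [List.getElem_append_left h] at hcol
    exact iff_of_true (hinner ▸ h) (mem_innerColumns (hcol ▸ List.getElem_mem h))
  · rw [List.getElem_append_right (not_lt.1 h)] at hcol
    have := mem_lastColumns (hcol ▸ List.getElem_mem _)
    exact iff_of_false (hinner ▸ h) (by omega)

/-- The position of a column of a scroll. -/
noncomputable def columnPosition : (Σ i : Fin d, Fin (n i)) → Fin (∑ i, n i) :=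
  (Equiv.ofBijective _ scrollColumn_bijective).symm

theorem scrollColumn_columnPosition (p : Σ i : Fin d, Fin (n i)) :
    scrollColumn n (columnPosition p) = p :=
  (Equiv.ofBijective _ scrollColumn_bijective).apply_symm_apply p

/-- The position of the next column in the same block. -/
noncomputable def nextColumn (α : Fin (∑ i, n i)) : Fin (∑ i, n i) :=
  if h : ((scrollColumn n α).2 : ℕ) + 1 < n (scrollColumn n α).1 then
    columnPosition ⟨(scrollColumn n α).1, ⟨(scrollColumn n α).2 + 1, h⟩⟩ else α

theorem scrollColumn_nextColumn {α : Fin (∑ i, n i)}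
    (h : ((scrollColumn n α).2 : ℕ) + 1 < n (scrollColumn n α).1) :
    scrollColumn n (nextColumn α) = ⟨(scrollColumn n α).1, ⟨(scrollColumn n α).2 + 1, h⟩⟩ := by
  rw [nextColumn, dif_pos h, scrollColumn_columnPosition]

theorem nextColumn_eq_iff {α β : Fin (∑ i, n i)}
    (h : ((scrollColumn n α).2 : ℕ) + 1 < n (scrollColumn n α).1) :
    nextColumn α = β ↔ (scrollColumn n β).1 = (scrollColumn n α).1 ∧
      ((scrollColumn n β).2 : ℕ) = (scrollColumn n α).2 + 1 := by
  rw [← scrollColumn_bijective.1.eq_iff, scrollColumn_nextColumn h]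
  refine ⟨fun e => by rw [← e]; exact ⟨rfl, rfl⟩, fun e => sigma_fin_ext e.1.symm e.2.symm⟩

/-- The candidate is the column before `ψ` in its block. If `ψ` is not the last column of its block,
comparison with `nextColumn γ₁` puts the candidate at or after `γ₁`. If it is the last, so is
`nextColumn γ₂`, in a block of no larger index and hence no larger length, and the candidate comes
at or after `γ₂`. The reversed order of the last columns is essential here. -/
theorem exists_nextColumn_eq (hpos : ∀ i, 0 < n i) (hmono : Monotone n)
    {a γ₁ γ₂ ψ : Fin (∑ i, n i)} (h1 : a ≤ γ₁) (hm1 : (γ₁ : ℕ) < ∑ i, n i - d) (h2 : a ≤ γ₂)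
    (hm2 : (γ₂ : ℕ) < ∑ i, n i - d) (hψ1 : nextColumn γ₁ ≤ ψ) (hψ2 : ψ ≤ nextColumn γ₂) :
    ∃ γ, a ≤ γ ∧ (γ : ℕ) < ∑ i, n i - d ∧ nextColumn γ = ψ := by
  have hma : (a : ℕ) < ∑ i, n i - d := lt_of_le_of_lt h1 hm1
  rw [lt_sub_iff hpos] at hm1 hm2 hma
  rw [← not_lt, ← columnBefore_iff] at h1 h2 hψ1 hψ2
  rw [scrollColumn_nextColumn hm1] at hψ1
  rw [scrollColumn_nextColumn hm2] at hψ2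
  have hψ := (scrollColumn n ψ).2.2
  have hle : ((scrollColumn n γ₂).1 : ℕ) ≤ (scrollColumn n ψ).1 →
      n (scrollColumn n γ₂).1 ≤ n (scrollColumn n ψ).1 := fun h => hmono h
  simp only [ColumnBefore] at h1 h2 hψ1 hψ2
  have hj : 0 < ((scrollColumn n ψ).2 : ℕ) := by omega
  obtain ⟨γ, hγ⟩ := scrollColumn_bijective.2 (⟨(scrollColumn n ψ).1,
    ⟨(scrollColumn n ψ).2 - 1, lt_of_le_of_lt (Nat.sub_le _ _) hψ⟩⟩ : Σ i : Fin d, Fin (n i))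
  have e1 : (scrollColumn n γ).1 = (scrollColumn n ψ).1 := by rw [hγ]
  have e2 : ((scrollColumn n γ).2 : ℕ) = (scrollColumn n ψ).2 - 1 := by rw [hγ]
  have e3 : n (scrollColumn n γ).1 = n (scrollColumn n ψ).1 := by rw [e1]
  have e4 : ((scrollColumn n γ).1 : ℕ) = (scrollColumn n ψ).1 := by rw [e1]
  clear hγ
  have h3 : ¬ ColumnBefore (scrollColumn n γ) (scrollColumn n a) := by
    simp only [ColumnBefore]
    by_cases hl : ((scrollColumn n ψ).2 : ℕ) + 1 < n (scrollColumn n ψ).1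
    · clear hψ2 h2 hle
      omega
    · clear hψ1 h1
      omega
  rw [columnBefore_iff, not_lt] at h3
  exact ⟨γ, h3, (lt_sub_iff hpos γ).2 (by omega),
    (nextColumn_eq_iff (by omega)).2 ⟨e1.symm, by omega⟩⟩

/-- The columns of a rational normal scroll. -/
noncomputable def scrollShiftedColumns (hpos : ∀ i, 0 < n i) (hmono : Monotone n) :
    ShiftedColumns (∑ i, n i) (∑ i, n i - d) (Σ i : Fin d, Fin (n i + 1)) where
  top α := ⟨(scrollColumn n α).1, (scrollColumn n α).2.castSucc⟩
  bot α := ⟨(scrollColumn n α).1, (scrollColumn n α).2.succ⟩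
  next := nextColumn
  top_injective α β h := scrollColumn_bijective.1 (sigma_fin_ext (Sigma.mk.inj_iff.1 h).1
    (congrArg (fun x : Σ i : Fin d, Fin (n i + 1) => (x.2 : ℕ)) h))
  bot_injective α β h := scrollColumn_bijective.1 (sigma_fin_ext (Sigma.mk.inj_iff.1 h).1
    (Nat.succ_injective (congrArg (fun x : Σ i : Fin d, Fin (n i + 1) => (x.2 : ℕ)) h)))
  top_eq_bot γ δ := by
    rw [lt_sub_iff hpos]
    constructor
    · intro h
      have e1 : (scrollColumn n γ).1 = (scrollColumn n δ).1 := (Sigma.mk.inj_iff.1 h).1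
      have e2 : ((scrollColumn n γ).2 : ℕ) = (scrollColumn n δ).2 + 1 :=
        congrArg (fun x : Σ i : Fin d, Fin (n i + 1) => (x.2 : ℕ)) h
      have hδ : ((scrollColumn n δ).2 : ℕ) + 1 < n (scrollColumn n δ).1 := by
        have := (scrollColumn n γ).2.2
        rwa [e2, e1] at this
      exact ⟨hδ, (nextColumn_eq_iff hδ).2 ⟨e1, e2⟩⟩
    · rintro ⟨hδ, h⟩
      obtain ⟨e1, e2⟩ := (nextColumn_eq_iff hδ).1 h
      exact sigma_fin_ext e1 e2
  lt_next δ h := by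
    rw [lt_sub_iff hpos] at h
    rw [← columnBefore_iff, scrollColumn_nextColumn h]
    simp only [ColumnBefore]
    omega
  exists_eq x := by
    obtain ⟨i, j⟩ := x
    induction j using Fin.lastCases with
    | last =>
      refine Or.inr ⟨columnPosition ⟨i, ⟨n i - 1, Nat.sub_lt (hpos i) one_pos⟩⟩, ?_⟩
      rw [scrollColumn_columnPosition]
      exact sigma_fin_ext rfl (Nat.sub_add_cancel (hpos i))
    | cast j =>
      refine Or.inl ⟨columnPosition ⟨i, j⟩, ?_⟩
      rw [scrollColumn_columnPosition]
  ordConnected _ _ _ _ := exists_nextColumn_eq hpos hmono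

theorem top_scrollShiftedColumns (hpos : ∀ i, 0 < n i) (hmono : Monotone n)
    (α : Fin (∑ i, n i)) : (scrollShiftedColumns hpos hmono).top α =
      ⟨(scrollColumn n α).1, (scrollColumn n α).2.castSucc⟩ := rfl

theorem bot_scrollShiftedColumns (hpos : ∀ i, 0 < n i) (hmono : Monotone n)
    (α : Fin (∑ i, n i)) : (scrollShiftedColumns hpos hmono).bot α =
      ⟨(scrollColumn n α).1, (scrollColumn n α).2.succ⟩ := rfl

theorem fiberConeMap_eq (K : Type*) [Field K] (hpos : ∀ i, 0 < n i) (hmono : Monotone n) :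
    fiberConeMap K n = (scrollShiftedColumns hpos hmono).toMinors K := by
  refine algHom_ext fun v => ?_
  rw [fiberConeMap, ShiftedColumns.toMinors, aeval_X, aeval_X, ShiftedColumns.minor,
    top_scrollShiftedColumns, top_scrollShiftedColumns, bot_scrollShiftedColumns,
    bot_scrollShiftedColumns, Matrix.det_fin_two]
  rfl

end Scroll

theorem mainTheorem3 {K : Type*} [Field K] {d : ℕ} (n : Fin d → ℕ) (hpos : ∀ i, 0 < n i)
    (hmono : Monotone n) (hc : d + 4 ≤ ∑ i, n i) :
    fiberConeInitialIdeal K n = stanleyReisnerIdeal K (initialComplex K n) ∧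
      IsShellable (initialComplex K n) := by
  -- With at least three shiftable columns there is an index `a` with `0 < a ≤ m - 2`.
  have hm : 3 ≤ ∑ i, n i - d := by omega
  obtain ⟨h1, h2⟩ := (scrollShiftedColumns hpos hmono).initialIdeal_ker_toMinors
    (K := K) hm (Nat.sub_le _ _)
  rw [initialComplex, fiberConeInitialIdeal, fiberConeIdeal, fiberConeMap_eq K hpos hmono]
  exact ⟨h1, ShiftedColumns.isShellable hm (Nat.sub_le _ _) _ h2⟩
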